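/- Let $\mathbb T=\mathbb R/2\pi\mathbb Z$ and $\Gamma=\mathbb T\times\mathbb R$ (with Lebesgue measure $d\theta\,d\omega$). For a coupling constant $K\ge 0$ and a Borel probability measure $\rho_{in}$ on $\Gamma$, a (measure-valued) solution of the Kuramoto equation with initial data $\rho_{in}$ is a weakly continuous family $(\rho_t)_{t\ge 0}$ of Borel probability measures on $\Gamma$ such that for every compactly supported $C^1$ function $h$ on $[0,\infty)\times\Gamma$ $$0=\int_\Gamma h(0,P)\,\rho_{in}(dP)+\int_0^\infty\!\!\int_\Gamma\bigl[V(t,P)\,\partial_\theta h(t,P)+\partial_t h(t,P)\bigr]\rho_t(dP)\,dt,$$ $$V(t,\theta,\omega)=\omega+\frac{K}{2i}\bigl(\eta(t)e^{-i\theta}-\overline{\eta(t)}e^{i\theta}\bigr),\qquad \eta(t)=\int_\Gamma e^{i\theta}\rho_t(d\theta,d\omega).$$ Put $u(t,l,\xi)=\int_\Gamma e^{il\theta}e^{i\xi\omega}\rho_t(d\theta,d\omega)$. Let $g$ be a Borel probability measure on $\mathbb R$ and $\hat g(\xi)=\int_{\mathbb R}e^{i\xi\omega}g(d\omega)$. Suppose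 $\int_0^\infty|\hat g(\xi)|\,d\xi<\infty$, put $K_{ec}=2/\int_0^\infty|\hat g(\xi)|\,d\xi$, and let $0\le K<K_{ec}$. Then there are a constant $c>0$ and a bounded, (strictly) increasing weight $\varphi\in C^1([0,\infty))$ with $\varphi(0)=1$, depending only on $g$ and $K$, such that for every $\rho_{in}$ whose marginal in $\omega$ is $g$ and every solution $(\rho_t)$ of the Kuramoto equation with initial data $\rho_{in}$, the energy $$I(t)=\int_0^\infty\sum_{l\ge 1}\frac1l|u(t,l,\xi)|^2\varphi(\xi)\,d\xi\in[0,\infty]$$ satisfies $$I(t)+c\int_0^t|\eta(s)|^2\,ds\le I(0)\qquad\text{for all }t\ge 0 .$$ In particular $I$ is non-increasing and $\int_0^\infty|\eta(s)|^2\,ds\le c^{-1}I(0)$, so that $\int_0^\infty|\eta(s)|^2\,ds<\infty$ whenever $I(0)<\infty$. If moreover $\rho_{in}$ has a density $f_{in}\in L^2(\Gamma)$, then $I(0)\le 4\pi^2\,\|\varphi\|_\infty\|f_{in}\|_{L^2(\Gamma,d\theta\,d\omega)}^2<\infty$, and hence $\int_0^\infty|\eta(s)|^2\,ds<\infty$.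 -/

import Mathlib

open MeasureTheory Set
open scoped ENNReal

noncomputable section

namespace Kuramoto

instance factTwoPiPos : Fact (0 < 2 * Real.pi) := ⟨Real.two_pi_pos⟩

/-- The torus of phase angles, i.e. the reals modulo `2 π`. Its `volume` has total mass `2 π`
(Lebesgue measure `dθ`). -/
abbrev Torus : Type := AddCircle (2 * Real.pi)

/-- The phase space `Γ = 𝕋 × ℝ` of pairs (phase angle, natural frequency). -/
abbrev Phase : Type := Torus × ℝ

/-- `e^{i l θ}` for an integer `l` and an angle `θ`. -/
def angleExp (l : ℤ) (θ : Torus) : ℂ := fourier l θ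

theorem angleExp_coe (l : ℤ) (x : ℝ) :
    angleExp l (x : Torus) = Complex.exp (Complex.I * l * x) := by
  have h : (2 * Real.pi : ℂ) ≠ 0 := by exact_mod_cast Real.two_pi_pos.ne'
  rw [angleExp, fourier_coe_apply]
  congr 1
  push_cast
  field_simp

/-- The order parameter `η = ∫ e^{iθ} ρ(dθ, dω)`. -/
def orderParam (ρ : Measure Phase) : ℂ := ∫ P, angleExp 1 P.1 ∂ρ

/-- The Fourier transform `u(l, ξ) = ∫ e^{i l θ} e^{i ξ ω} ρ(dθ, dω)`. -/
def fourierTransform (ρ : Measure Phase) (l : ℤ) (ξ : ℝ) : ℂ :=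
  ∫ P, angleExp l P.1 * Complex.exp (Complex.I * ξ * P.2) ∂ρ

/-- The phase velocity `ω + K/(2i) (η e^{-iθ} - η̄ e^{iθ})`, which is the real number
`ω + K Im (η e^{-iθ})`, see `velocity_eq`. -/
def velocity (K : ℝ) (η : ℂ) (P : Phase) : ℝ := P.2 + K * (η * angleExp (-1) P.1).im

theorem velocity_eq (K : ℝ) (η : ℂ) (P : Phase) :
    (velocity K η P : ℂ) = P.2 + K / (2 * Complex.I) *
      (η * angleExp (-1) P.1 - (starRingEnd ℂ) η * angleExp 1 P.1) := by
  have h1 : angleExp 1 P.1 = (starRingEnd ℂ) (angleExp (-1) P.1) := by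
    simp only [angleExp]
    rw [fourier_neg, Complex.conj_conj]
  rw [h1, ← map_mul, Complex.sub_conj, velocity]
  push_cast
  field_simp

/-- `C¹` test functions of compact support on `[0, ∞) × Γ`, given as restrictions of compactly
supported `C¹` functions on `ℝ × Γ`. They need not vanish at time `0`. A function on `ℝ × Γ` is
`C¹` iff its lift, `2 π`-periodic in the angle, is `C¹` on `ℝ × ℝ × ℝ`. -/
structure IsTestFunction (h : ℝ × Phase → ℝ) : Prop where
  contDiff : ContDiff ℝ 1 (fun p : ℝ × ℝ × ℝ => h (p.1, ((p.2.1 : ℝ) : Torus), p.2.2))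
  hasCompactSupport : HasCompactSupport h

/-- The partial derivative `∂_t h (t, P)`. -/
def timeDeriv (h : ℝ × Phase → ℝ) (t : ℝ) (P : Phase) : ℝ := deriv (fun s : ℝ => h (s, P)) t

/-- The partial derivative `∂_θ h (t, θ, ω)`. -/
def angleDeriv (h : ℝ × Phase → ℝ) (t : ℝ) (P : Phase) : ℝ :=
  deriv (fun s : ℝ => h (t, (P.1 + (s : Torus), P.2))) 0

/-- `ρ` is a measure-valued solution of the Kuramoto equation with coupling constant `K` and
initial data `ρin`: a weakly continuous family of probability measures on `Γ`, indexed by times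
`t ≥ 0` (values at negative times are irrelevant), that solves the equation in the weak sense. -/
structure IsSolution (K : ℝ) (ρin : ProbabilityMeasure Phase) (ρ : ℝ → ProbabilityMeasure Phase) :
    Prop where
  continuousOn : ContinuousOn ρ (Ici 0)
  weak : ∀ h : ℝ × Phase → ℝ, IsTestFunction h →
    0 = (∫ P, h (0, P) ∂(ρin : Measure Phase)) +
      ∫ t in Ioi (0 : ℝ), ∫ P, (velocity K (orderParam (ρ t)) P * angleDeriv h t P
        + timeDeriv h t P) ∂(ρ t : Measure Phase)

/-- The threshold `2 / ∫_0^∞ |ĝ(ξ)| dξ`, where `ĝ(ξ) = ∫ e^{iξω} g(dω)` is the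
characteristic function of `g`. -/
def criticalCoupling (g : ProbabilityMeasure ℝ) : ℝ :=
  2 / ∫ ξ in Ioi (0 : ℝ), ‖charFun (g : Measure ℝ) ξ‖

/-- The energy `∫_0^∞ ∑_{l ≥ 1} (1/l) |u(l, ξ)|² φ(ξ) dξ ∈ [0, ∞]` of a measure `ρ` for a
non-negative weight `φ`; the summation index is `k = l - 1`. -/
def energy (φ : ℝ → ℝ) (ρ : Measure Phase) : ℝ≥0∞ :=
  ∫⁻ ξ in Ioi (0 : ℝ), ∑' k : ℕ,
    ENNReal.ofReal (1 / ((k : ℝ) + 1) * ‖fourierTransform ρ ((k : ℤ) + 1) ξ‖ ^ 2 * φ ξ)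

end Kuramoto

end

noncomputable section

namespace Kuramoto

open Filter Topology
open scoped BoundedContinuousFunction

/-! Write `u_l(t,ξ)` for the modes and `G = ĝ`. Along `ξ = ζ - l t` free transport disappears: `d/dt
u_l = (K l / 2)(η u_{l-1} - η̄ u_{l+1})`, and `u_0 = G` for all times. Now differentiate `∫ ∑
(1/l)|u_l|² φ dξ`. The weight `1/l` makes the coupling telescope, so only the term `K Re⟨u_1, η G⟩
φ` survives. Transport yields the boundary loss `-∑ |u_l(t,0)|² φ(0)`, whose first term is `-|η|²`,
and the damping `-∑ ∫ φ' |u_l|²`.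

If `φ' ≥ lam |G| φ²`, Young's inequality bounds the surviving term by the damping of `u_1` plus
`K²/(4 lam) |η|² |G|`. With `M = ∫ |G|`, the energy then falls at rate at least `c |η|²`, where `c =
1 - K² M / (4 lam)`. A bounded `φ` exists when `lam M < 1` (solve the Riccati equation), and `c > 0`
needs `lam > K² M / 4`. Both hold for some `lam` precisely when `K M < 2`, which is `K < K_ec`
(`exists_coupling_rate`, `exists_isEnergyWeight`).

The modes of a measure are merely bounded, so sum and integral may diverge. Hence the energy is cut
off by `(1 + δ(ξ + k))⁻²`, `k = l - 1`, and by `k ≤ n`. The pointwise estimate `sum_modeRate_le`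
leaves a tail of order `1/(δ(1 + δ n))` and a cutoff error of density at most `(2 + 4K) φ δ (1 +
δ(ξ+k))⁻³ |u_l|²`. This error is used twice. A factor `e^{-Ct}` with `C = 2 + 4K` absorbs it and
gives exponential growth at worst (`modesEnergy_le_exp_mul`). The finite energy so obtained is the
dominating function that makes the error vanish as `δ → 0` when `C = 0` (`modesEnergy_add_le`).

Passing from the weak formulation to the mode equations is the task of `IsSolution.isMildFamily`.
The `L²` bound on the initial energy is Plancherel in `ω` combined with Bessel in `θ`. -/

/-! ### Weak continuity and the weak form of an ordinary differential equation -/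

/-- The integral of a jointly continuous, spatially compactly supported function against a weakly
continuous family of probability measures depends continuously on the parameter. -/
theorem continuous_integral_of_weakly_continuous {X : Type*} [TopologicalSpace X]
    [MeasurableSpace X] [BorelSpace X] {μ : ℝ → ProbabilityMeasure X}
    (hμ : Continuous μ) {Φ : ℝ → X → ℂ} (hΦ : Continuous (Function.uncurry Φ)) {k : Set X}
    (hk : IsCompact k) (hzero : ∀ t, ∀ x ∉ k, Φ t x = 0) :
    Continuous fun t => ∫ x, Φ t x ∂(μ t : Measure X) := by
  have hcont : ∀ t, Continuous (Φ t) := fun t => hΦ.comp (Continuous.prodMk_right t)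
  have hbdd : ∀ t, ∃ C, ∀ x, ‖Φ t x‖ ≤ C := by
    intro t
    obtain ⟨C, hC⟩ := hk.exists_bound_of_continuousOn (hcont t).continuousOn
    refine ⟨max C 0, fun x => ?_⟩
    by_cases hx : x ∈ k
    · exact (hC x hx).trans (le_max_left _ _)
    · rw [hzero t x hx, norm_zero]
      exact le_max_right _ _
  have hint : ∀ t s, Integrable (Φ t) (μ s : Measure X) := by
    intro t s
    obtain ⟨C, hC⟩ := hbdd t
    exact Integrable.of_bound
      ((hcont t).stronglyMeasurable_of_support_subset_isCompact hk
        (fun x hx => by by_contra h; exact hx (hzero t x h))).aestronglyMeasurable C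
      (ae_of_all _ hC)
  rw [continuous_iff_continuousAt]
  intro t₀
  obtain ⟨C, hC⟩ := hbdd t₀
  let f : X →ᵇ ℂ := BoundedContinuousFunction.ofNormedAddCommGroup (Φ t₀) (hcont t₀) C hC
  have h1 := (ProbabilityMeasure.tendsto_iff_forall_integral_rclike_tendsto ℂ).1
    (hμ.tendsto t₀) f
  -- The change in `t` splits into a change of integrand, uniformly small because everything happens
  -- on the compact set `k`, and a change of measure, which is weak convergence `h1`.
  have h2 : Tendsto (fun t => (∫ x, Φ t x ∂(μ t : Measure X)) - ∫ x, Φ t₀ x ∂(μ t : Measure X))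
      (𝓝 t₀) (𝓝 0) := by
    rw [Metric.tendsto_nhds]
    intro ε hε
    obtain ⟨v, hv, hv'⟩ := hk.mem_uniformity_of_prod (s := univ) (q := t₀) hΦ.continuousOn
      (mem_univ _) (Metric.dist_mem_uniformity (half_pos hε))
    rw [nhdsWithin_univ] at hv
    filter_upwards [hv] with t ht
    rw [dist_zero_right, ← integral_sub (hint t t) (hint t₀ t)]
    have hle : ∀ x, ‖Φ t x - Φ t₀ x‖ ≤ ε / 2 := by
      intro x
      by_cases hx : x ∈ k
      · have := hv' t ht x hx
        rw [← dist_eq_norm]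
        exact le_of_lt this
      · rw [hzero t x hx, hzero t₀ x hx, sub_zero, norm_zero]
        exact (half_pos hε).le
    calc _ ≤ ε / 2 * (μ t : Measure X).real univ :=
          norm_integral_le_of_norm_le_const (ae_of_all _ hle)
      _ < ε := by rw [probReal_univ, mul_one]; exact half_lt_self hε
  have h3 := h2.add h1
  simp only [zero_add] at h3
  refine h3.congr fun t => ?_
  change _ - _ + ∫ x, Φ t₀ x ∂(μ t : Measure X) = _
  ring

/-- A weak formulation of `v' = F`, `v 0 = v₀` on `[0, ∞)` implies the integrated equation. -/
theorem eq_add_integral_of_weak {v F : ℝ → ℝ} (hv : Continuous v) (hF : Continuous F) {v₀ : ℝ}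
    (hweak : ∀ a : ℝ → ℝ, ContDiff ℝ 1 a → HasCompactSupport a →
      0 = a 0 * v₀ + ∫ t in Ioi (0 : ℝ), (deriv a t * v t + a t * F t))
    {t : ℝ} (ht : 0 ≤ t) : v t = v₀ + ∫ s in (0 : ℝ)..t, F s := by
  set Φ : ℝ → ℝ := fun t => v₀ + ∫ s in (0 : ℝ)..t, F s with hΦ
  have hΦ' : ∀ t, HasDerivAt Φ (F t) t := fun t =>
    (intervalIntegral.integral_hasDerivAt_right (hF.intervalIntegrable _ _)
      hF.aestronglyMeasurable.stronglyMeasurableAtFilter hF.continuousAt).const_add v₀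
  have hΦc : Continuous Φ := continuous_iff_continuousAt.2 fun t => (hΦ' t).continuousAt
  set w : ℝ → ℝ := fun t => v t - Φ t with hw
  have hwc : Continuous w := hv.sub hΦc
  suffices H : ∀ T > 0, ∀ t ∈ Ioo 0 T, w t = 0 by
    have hpos : EqOn w 0 (Ioi 0) := fun t ht => H (t + 1) (by simp at ht; linarith) t
      ⟨ht, by linarith⟩
    have hcl := hpos.closure hwc continuous_zero
    rw [closure_Ioi] at hcl
    have := hcl (show t ∈ Ici (0 : ℝ) from ht)
    simp only [hw, Pi.zero_apply] at this
    linarith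
  intro T hT
  -- Testing with a primitive `A` of `b` that vanishes from `T` on and integrating by parts yields
  -- `∫ b w = ∫ w² (T - t)₊ = 0`, which forces `w = 0` on `(0, T)`.
  set b : ℝ → ℝ := fun t => w t * max (T - t) 0 with hb
  have hbc : Continuous b := by fun_prop
  set A : ℝ → ℝ := fun t => ∫ s in T..t, b s with hA
  have hA' : ∀ t, HasDerivAt A (b t) t := fun t =>
    intervalIntegral.integral_hasDerivAt_right (hbc.intervalIntegrable _ _)
      hbc.aestronglyMeasurable.stronglyMeasurableAtFilter hbc.continuousAt
  have hAT : ∀ t, T ≤ t → A t = 0 := by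
    intro t ht
    rw [hA]
    simp only
    rw [intervalIntegral.integral_congr (g := fun _ => 0), intervalIntegral.integral_zero]
    intro s hs
    rw [uIcc_of_le ht] at hs
    simp [hb, max_eq_right (sub_nonpos.2 hs.1)]
  have hA1 : ContDiff ℝ 1 A := by
    rw [contDiff_one_iff_deriv]
    exact ⟨fun t => (hA' t).differentiableAt, by
      rw [show deriv A = b from funext fun t => (hA' t).deriv]; exact hbc⟩
  -- `A` already vanishes beyond `T`; the bump truncates it only at negative times, which the weak
  -- equation does not see.
  let κ : ContDiffBump (0 : ℝ) := ⟨T, T + 1, hT, by linarith⟩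
  have hκ1 : ∀ t, t ∈ Icc 0 T → κ t = 1 := fun t ht =>
    κ.one_of_mem_closedBall (by
      rw [Metric.mem_closedBall, dist_zero_right, Real.norm_of_nonneg ht.1]; exact ht.2)
  set a : ℝ → ℝ := fun t => κ t * A t with ha
  have ha1 : ContDiff ℝ 1 a := κ.contDiff.mul hA1
  have haS : HasCompactSupport a := κ.hasCompactSupport.mul_right
  have haA : ∀ t, 0 ≤ t → a t = A t := by
    intro t ht
    rcases le_total t T with h | h
    · rw [ha]; simp only [hκ1 t ⟨ht, h⟩, one_mul]
    · rw [ha]; simp only [hAT t h, mul_zero]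
  have hda : ∀ t, 0 < t → deriv a t = b t := by
    intro t ht
    have : a =ᶠ[𝓝 t] A := by
      filter_upwards [Ioi_mem_nhds ht] with s hs using haA s (le_of_lt hs)
    rw [this.deriv_eq, (hA' t).deriv]
  have h0 := hweak a ha1 haS
  have h1 : ∫ t in Ioi (0 : ℝ), (deriv a t * v t + a t * F t)
      = ∫ t in Ioc (0 : ℝ) T, (b t * v t + A t * F t) := by
    rw [setIntegral_congr_fun (g := fun t => b t * v t + A t * F t) measurableSet_Ioi
      (fun t ht => by simp only [hda t ht, haA t (le_of_lt ht)])]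
    refine (setIntegral_eq_of_subset_of_forall_sdiff_eq_zero measurableSet_Ioi
      Ioc_subset_Ioi_self fun t ht => ?_)
    have hTt : T ≤ t := by
      by_contra h
      exact ht.2 ⟨ht.1, (not_le.1 h).le⟩
    simp [hAT t hTt, hb, max_eq_right (sub_nonpos.2 hTt)]
  have hAc : Continuous A := hA1.continuous
  have hparts := intervalIntegral.integral_mul_deriv_eq_deriv_mul (a := 0) (b := T)
    (u := A) (v := Φ) (u' := b) (v' := F) (fun t _ => hA' t) (fun t _ => hΦ' t)
    (hbc.intervalIntegrable _ _) (hF.intervalIntegrable _ _)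
  have hadd : ∫ t in (0 : ℝ)..T, (b t * v t + A t * F t)
      = (∫ t in (0 : ℝ)..T, b t * v t) + ∫ t in (0 : ℝ)..T, A t * F t :=
    intervalIntegral.integral_add ((hbc.mul hv).intervalIntegrable _ _)
      ((hAc.mul hF).intervalIntegrable _ _)
  rw [h1, ← intervalIntegral.integral_of_le hT.le, hadd, hparts,
    haA 0 le_rfl, hAT T le_rfl] at h0
  have hΦ0 : Φ 0 = v₀ := by simp [hΦ]
  have h2 : ∫ t in (0 : ℝ)..T, w t ^ 2 * max (T - t) 0 = 0 := by
    have : ∀ t, w t ^ 2 * max (T - t) 0 = b t * v t - b t * Φ t := fun t => by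
      simp only [hb, hw]; ring
    simp_rw [this]
    have hsub : ∫ t in (0 : ℝ)..T, (b t * v t - b t * Φ t)
        = (∫ t in (0 : ℝ)..T, b t * v t) - ∫ t in (0 : ℝ)..T, b t * Φ t :=
      intervalIntegral.integral_sub ((hbc.mul hv).intervalIntegrable _ _)
        ((hbc.mul hΦc).intervalIntegrable _ _)
    rw [hsub]
    rw [hΦ0] at h0
    linarith
  intro t ht
  have hc2 : Continuous fun t => w t ^ 2 * max (T - t) 0 := by fun_prop
  by_contra hne
  have hlt : 0 < ∫ t in (0 : ℝ)..T, w t ^ 2 * max (T - t) 0 := by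
    refine intervalIntegral.integral_pos hT hc2.continuousOn
      (fun s _ => by positivity) ⟨t, ⟨ht.1.le, ht.2.le⟩, ?_⟩
    have : 0 < max (T - t) 0 := lt_max_of_lt_left (sub_pos.2 ht.2)
    positivity
  exact hlt.ne' h2

/-! ### Characters carried along the characteristics, as test functions -/

theorem norm_angleExp (l : ℤ) (θ : Torus) : ‖angleExp l θ‖ = 1 := by
  rw [angleExp, fourier_apply]
  exact Circle.norm_coe _

theorem continuous_angleExp (l : ℤ) : Continuous (angleExp l) := (fourier l).continuous

theorem angleExp_mul (l m : ℤ) (θ : Torus) :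
    angleExp l θ * angleExp m θ = angleExp (l + m) θ := by
  rw [angleExp, angleExp, angleExp, fourier_add]

theorem angleExp_add_coe (l : ℤ) (θ : Torus) (s : ℝ) :
    angleExp l (θ + (s : Torus)) = angleExp l θ * Complex.exp (Complex.I * l * s) := by
  rw [← angleExp_coe]
  simp [angleExp, fourier_apply, smul_add, AddCircle.toCircle_add]

theorem conj_angleExp (l : ℤ) (θ : Torus) :
    (starRingEnd ℂ) (angleExp l θ) = angleExp (-l) θ := by
  rw [angleExp, angleExp, fourier_neg]

/-- The character `e^{ilθ} e^{iξω}` with frequency `ξ = ζ - l t` moving along a characteristic. -/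
def wave (l : ℤ) (ζ t : ℝ) (P : Phase) : ℂ :=
  angleExp l P.1 * Complex.exp (Complex.I * ((ζ - l * t : ℝ) : ℂ) * P.2)

theorem norm_wave (l : ℤ) (ζ t : ℝ) (P : Phase) : ‖wave l ζ t P‖ = 1 := by
  rw [wave, norm_mul, norm_angleExp, one_mul, mul_assoc, mul_comm, ← Complex.ofReal_mul,
    Complex.norm_exp_ofReal_mul_I]

theorem continuous_wave (l : ℤ) (ζ : ℝ) :
    Continuous fun p : ℝ × Phase => wave l ζ p.1 p.2 := by
  have := continuous_angleExp l
  unfold wave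
  fun_prop

theorem hasDerivAt_wave_time (l : ℤ) (ζ t : ℝ) (P : Phase) :
    HasDerivAt (fun s => wave l ζ s P) (-(Complex.I * l * P.2) * wave l ζ t P) t := by
  have h1 : HasDerivAt (fun s : ℝ => ((ζ - l * s : ℝ) : ℂ)) (-(l : ℂ)) t := by
    have h := (((hasDerivAt_id t).const_mul (l : ℝ)).const_sub ζ).ofReal_comp
    simpa using h
  have h2 := (((h1.const_mul Complex.I).mul_const (P.2 : ℂ)).cexp).const_mul (angleExp l P.1)
  refine h2.congr_deriv ?_
  rw [wave]
  ring

theorem hasDerivAt_wave_angle (l : ℤ) (ζ t : ℝ) (P : Phase) :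
    HasDerivAt (fun s : ℝ => wave l ζ t (P.1 + (s : Torus), P.2))
      (Complex.I * l * wave l ζ t P) 0 := by
  have h1 : HasDerivAt (fun s : ℝ => Complex.exp (Complex.I * l * s)) (Complex.I * l) 0 := by
    have h := ((Complex.ofRealCLM.hasDerivAt (x := (0 : ℝ))).const_mul (Complex.I * l)).cexp
    simpa using h
  have h2 := ((h1.const_mul (angleExp l P.1)).mul_const
    (Complex.exp (Complex.I * ((ζ - l * t : ℝ) : ℂ) * P.2)))
  simp only [wave, angleExp_add_coe]
  refine h2.congr_deriv ?_
  ring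

/-- The test function `a(t) Re (z χ(ω) e^{ilθ} e^{i(ζ - lt)ω})`. -/
def waveTest (a χ : ℝ → ℝ) (z : ℂ) (l : ℤ) (ζ : ℝ) (p : ℝ × Phase) : ℝ :=
  a p.1 * (z * (χ p.2.2 * wave l ζ p.1 p.2)).re

theorem isTestFunction_waveTest {a χ : ℝ → ℝ} (ha : ContDiff ℝ 1 a) (hac : HasCompactSupport a)
    (hχ : ContDiff ℝ 1 χ) (hχc : HasCompactSupport χ) (z : ℂ) (l : ℤ) (ζ : ℝ) :
    IsTestFunction (waveTest a χ z l ζ) where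
  contDiff := by
    have hre : ContDiff ℝ 1 Complex.re := Complex.reCLM.contDiff
    have hof : ContDiff ℝ 1 Complex.ofReal := Complex.ofRealCLM.contDiff
    simp only [waveTest, wave, angleExp_coe]
    refine (ha.comp contDiff_fst).mul (hre.comp (contDiff_const.mul
      ((hof.comp (hχ.comp (contDiff_snd.comp contDiff_snd))).mul ?_)))
    refine ContDiff.mul ?_ ?_
    · exact (contDiff_const.mul (hof.comp (contDiff_fst.comp contDiff_snd))).cexp
    · refine ((contDiff_const.mul (hof.comp ?_)).mul
        (hof.comp (contDiff_snd.comp contDiff_snd))).cexp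
      exact contDiff_const.sub (contDiff_const.mul contDiff_fst)
  hasCompactSupport := by
    refine HasCompactSupport.intro' (K := tsupport a ×ˢ (univ ×ˢ tsupport χ))
      (IsCompact.prod hac (isCompact_univ.prod hχc))
      ((isClosed_tsupport a).prod (isClosed_univ.prod (isClosed_tsupport χ))) ?_
    rintro ⟨t, θ, ω⟩ hp
    simp only [mem_prod, mem_univ, true_and, not_and_or] at hp
    rcases hp with h | h
    · simp [waveTest, image_eq_zero_of_notMem_tsupport h]
    · simp [waveTest, image_eq_zero_of_notMem_tsupport h]

theorem timeDeriv_waveTest {a χ : ℝ → ℝ} (ha : ContDiff ℝ 1 a) (z : ℂ) (l : ℤ) (ζ t : ℝ)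
    (P : Phase) : timeDeriv (waveTest a χ z l ζ) t P =
      deriv a t * (z * (χ P.2 * wave l ζ t P)).re
        + a t * (z * (χ P.2 * (-(Complex.I * l * P.2) * wave l ζ t P))).re := by
  have h1 := ((hasDerivAt_wave_time l ζ t P).const_mul (χ P.2 : ℂ)).const_mul z
  have h2 : HasDerivAt (fun s => (z * (χ P.2 * wave l ζ s P)).re) _ t :=
    Complex.reCLM.hasFDerivAt.comp_hasDerivAt t h1
  have h3 := ((ha.differentiable one_ne_zero) t).hasDerivAt.mul h2
  exact h3.deriv

theorem angleDeriv_waveTest {a χ : ℝ → ℝ} (z : ℂ) (l : ℤ) (ζ t : ℝ)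
    (P : Phase) : angleDeriv (waveTest a χ z l ζ) t P =
      a t * (z * (χ P.2 * (Complex.I * l * wave l ζ t P))).re := by
  have h1 := ((hasDerivAt_wave_angle l ζ t P).const_mul (χ P.2 : ℂ)).const_mul z
  have h2 : HasDerivAt (fun s : ℝ => (z * (χ P.2 * wave l ζ t (P.1 + (s : Torus), P.2))).re) _ 0 :=
    Complex.reCLM.hasFDerivAt.comp_hasDerivAt 0 h1
  exact (h2.const_mul (a t)).deriv

/-- The effect of the mean field on the character `wave l ζ t`. -/
def waveForce (K : ℝ) (η : ℂ) (l : ℤ) (ζ t : ℝ) (P : Phase) : ℂ :=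
  wave l ζ t P * (Complex.I * l * (K * (η * angleExp (-1) P.1).im : ℝ))

/-- The moving frequency `ζ - l t` is chosen so that the time derivative of the wave cancels `ω
∂_θ`. The unbounded factor `ω` thus disappears, and what remains is bounded by a constant multiple
of `K |l|`, which allows removing the cutoff `χ` later. -/
theorem velocity_mul_angleDeriv_add_timeDeriv {a χ : ℝ → ℝ} (ha : ContDiff ℝ 1 a) (z : ℂ) (l : ℤ)
    (ζ t : ℝ) (K : ℝ) (η : ℂ) (P : Phase) :
    velocity K η P * angleDeriv (waveTest a χ z l ζ) t P + timeDeriv (waveTest a χ z l ζ) t P =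
      deriv a t * (z * (χ P.2 * wave l ζ t P)).re
        + a t * (z * (χ P.2 * waveForce K η l ζ t P)).re := by
  rw [timeDeriv_waveTest ha, angleDeriv_waveTest]
  have h : velocity K η P * (z * (χ P.2 * (Complex.I * l * wave l ζ t P))).re
      + (z * (χ P.2 * (-(Complex.I * l * P.2) * wave l ζ t P))).re
      = (z * (χ P.2 * waveForce K η l ζ t P)).re := by
    rw [← Complex.re_ofReal_mul, ← Complex.add_re]
    congr 1
    rw [velocity, waveForce]
    push_cast
    ring
  rw [← h]
  ring

theorem norm_waveForce_le {K : ℝ} (hK : 0 ≤ K) {η : ℂ} (hη : ‖η‖ ≤ 1) (l : ℤ) (ζ t : ℝ)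
    (P : Phase) : ‖waveForce K η l ζ t P‖ ≤ K * |(l : ℝ)| := by
  have h1 : |(η * angleExp (-1) P.1).im| ≤ 1 :=
    (Complex.abs_im_le_norm _).trans (by rw [norm_mul, norm_angleExp, mul_one]; exact hη)
  rw [waveForce, norm_mul, norm_wave, one_mul, norm_mul, norm_mul, Complex.norm_I, one_mul,
    Complex.norm_real, Real.norm_eq_abs, abs_mul, abs_of_nonneg hK, Complex.norm_intCast]
  have := abs_nonneg (l : ℝ)
  calc |(l : ℝ)| * (K * _) ≤ |(l : ℝ)| * (K * 1) := by gcongr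
    _ = _ := by ring

theorem norm_orderParam_le (ρ : Measure Phase) [IsProbabilityMeasure ρ] : ‖orderParam ρ‖ ≤ 1 := by
  have := norm_integral_le_of_norm_le_const (μ := ρ) (f := fun P : Phase => angleExp 1 P.1)
    (ae_of_all _ fun P => (norm_angleExp 1 P.1).le)
  simpa [orderParam] using this

theorem continuous_orderParam {ρ : ℝ → ProbabilityMeasure Phase} (hρ : Continuous ρ) :
    Continuous fun t => orderParam (ρ t) := by
  rw [continuous_iff_continuousAt]
  intro t
  exact (ProbabilityMeasure.tendsto_iff_forall_integral_rclike_tendsto ℂ).1 (hρ.tendsto t)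
    (BoundedContinuousFunction.ofNormedAddCommGroup (fun P : Phase => angleExp 1 P.1)
      ((continuous_angleExp 1).comp continuous_fst) 1 fun P => (norm_angleExp 1 P.1).le)

theorem continuous_waveForce (K : ℝ) {η : ℝ → ℂ} (hη : Continuous η) (l : ℤ) (ζ : ℝ) :
    Continuous fun p : ℝ × Phase => waveForce K (η p.1) l ζ p.1 p.2 := by
  have h1 := continuous_wave l ζ
  have h2 := continuous_angleExp (-1)
  unfold waveForce
  fun_prop

/-! ### From the weak equation to the mode equations along characteristics -/

/-- The truncated Fourier modes of a solution satisfy the integrated equation along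
characteristics. -/
theorem IsSolution.truncated_mode_eq {K : ℝ} (hK : 0 ≤ K) {ρin : ProbabilityMeasure Phase}
    {ρ : ℝ → ProbabilityMeasure Phase} (h : IsSolution K ρin ρ) (hρ : Continuous ρ)
    {χ : ℝ → ℝ} (hχ : ContDiff ℝ 1 χ) (hχc : HasCompactSupport χ) (l : ℤ) (ζ : ℝ) :
    (Continuous fun s => ∫ P, χ P.2 * waveForce K (orderParam (ρ s)) l ζ s P
        ∂(ρ s : Measure Phase)) ∧ ∀ t : ℝ, 0 ≤ t →
    ∫ P, χ P.2 * wave l ζ t P ∂(ρ t : Measure Phase) =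
      (∫ P, χ P.2 * wave l ζ 0 P ∂(ρin : Measure Phase)) +
        ∫ s in (0 : ℝ)..t, ∫ P, χ P.2 * waveForce K (orderParam (ρ s)) l ζ s P
          ∂(ρ s : Measure Phase) := by
  have hη := continuous_orderParam hρ
  have hwv := continuous_wave l ζ
  have hfc := continuous_waveForce K hη l ζ
  have hχ' := hχ.continuous
  set v : ℝ → ℂ := fun t => ∫ P, χ P.2 * wave l ζ t P ∂(ρ t : Measure Phase) with hv
  set F : ℝ → ℂ := fun s => ∫ P, χ P.2 * waveForce K (orderParam (ρ s)) l ζ s P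
    ∂(ρ s : Measure Phase) with hF
  set v₀ : ℂ := ∫ P, χ P.2 * wave l ζ 0 P ∂(ρin : Measure Phase) with hv₀
  have hk : IsCompact ((univ : Set Torus) ×ˢ tsupport χ) := isCompact_univ.prod hχc
  have hχ0 : ∀ P : Phase, P ∉ (univ : Set Torus) ×ˢ tsupport χ → χ P.2 = 0 := fun P hP =>
    image_eq_zero_of_notMem_tsupport fun h' => hP ⟨mem_univ _, h'⟩
  have hvc : Continuous v := by
    refine continuous_integral_of_weakly_continuous hρ ?_ hk fun t P hP => ?_
    · simp only [Function.uncurry_def]; fun_prop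
    · simp [hχ0 P hP]
  have hFc : Continuous F := by
    refine continuous_integral_of_weakly_continuous hρ ?_ hk fun t P hP => ?_
    · simp only [Function.uncurry_def]; fun_prop
    · simp [hχ0 P hP]
  obtain ⟨C, hC⟩ := hχ'.bounded_above_of_compact_support hχc
  have hint1 : ∀ (μ : ProbabilityMeasure Phase) t,
      Integrable (fun P => χ P.2 * wave l ζ t P) (μ : Measure Phase) := fun μ t =>
    Integrable.of_bound (Continuous.aestronglyMeasurable (by fun_prop)) C (ae_of_all _ fun P => by
      rw [norm_mul, norm_wave, mul_one, Complex.norm_real]; exact hC _)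
  have hint2 : ∀ (μ : ProbabilityMeasure Phase) t,
      Integrable (fun P => χ P.2 * waveForce K (orderParam (ρ t)) l ζ t P)
        (μ : Measure Phase) := fun μ t =>
    Integrable.of_bound (((Complex.continuous_ofReal.comp (hχ'.comp continuous_snd)).mul
      (hfc.comp (Continuous.prodMk_right t))).aestronglyMeasurable) (C * (K * |(l : ℝ)|))
      (ae_of_all _ fun P => by
        rw [norm_mul, Complex.norm_real]
        exact mul_le_mul (hC _) (norm_waveForce_le hK (norm_orderParam_le _) l ζ t P)
          (norm_nonneg _) ((norm_nonneg _).trans (hC 0)))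
  have hre : ∀ (z : ℂ) {μ : Measure Phase} {f : Phase → ℂ}, Integrable f μ →
      ∫ P, (z * f P).re ∂μ = (z * ∫ P, f P ∂μ).re := by
    intro z μ f hf
    rw [← integral_const_mul]
    exact integral_re (𝕜 := ℂ) (hf.const_mul z)
  have hrei : ∀ (z : ℂ) {μ : Measure Phase} {f : Phase → ℂ}, Integrable f μ →
      Integrable (fun P => (z * f P).re) μ := fun z μ f hf => (hf.const_mul z).re
  have hweak : ∀ z : ℂ, ∀ t, 0 ≤ t →
      (z * v t).re = (z * v₀).re + ∫ s in (0 : ℝ)..t, (z * F s).re := by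
    intro z t ht
    refine eq_add_integral_of_weak (v := fun t => (z * v t).re) (F := fun t => (z * F t).re)
      (by fun_prop) (by fun_prop) (fun a ha hac => ?_) ht
    have h0 := h.weak _ (isTestFunction_waveTest ha hac hχ hχc z l ζ)
    refine h0.trans ?_
    congr 1
    · simp only [waveTest]
      rw [integral_const_mul, hre z (hint1 _ _)]
    · refine setIntegral_congr_fun measurableSet_Ioi fun t ht => ?_
      simp only [velocity_mul_angleDeriv_add_timeDeriv ha]
      rw [integral_add ((hrei z (hint1 _ _)).const_mul _) ((hrei z (hint2 _ _)).const_mul _),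
        integral_const_mul, integral_const_mul, hre z (hint1 _ _), hre z (hint2 _ _)]
  refine ⟨hFc, fun t ht => ?_⟩
  have hFi : IntervalIntegrable F volume 0 t := hFc.intervalIntegrable _ _
  have hcomm : ∀ z : ℂ, ∫ s in (0 : ℝ)..t, (z * F s).re = (z * ∫ s in (0 : ℝ)..t, F s).re := by
    intro z
    rw [← intervalIntegral.integral_const_mul, intervalIntegral.integral_of_le ht,
      intervalIntegral.integral_of_le ht]
    exact integral_re (𝕜 := ℂ) (((intervalIntegrable_iff_integrableOn_Ioc_of_le ht).1 hFi).const_mul z)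
  -- Test functions are real valued, so the factor `z` recovers complex information: `z = 1` gives
  -- the real part and `z = -i` the imaginary part.
  apply Complex.ext
  · have := hweak 1 t ht
    rw [hcomm] at this
    simpa using this
  · have := hweak (-Complex.I) t ht
    rw [hcomm] at this
    simpa using this

theorem integral_wave (ρ : Measure Phase) (l : ℤ) (ζ t : ℝ) :
    ∫ P, wave l ζ t P ∂ρ = fourierTransform ρ l (ζ - l * t) := rfl

theorem norm_fourierTransform_le (ρ : Measure Phase) [IsProbabilityMeasure ρ] (l : ℤ) (ξ : ℝ) :
    ‖fourierTransform ρ l ξ‖ ≤ 1 := by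
  have := norm_integral_le_of_norm_le_const (μ := ρ) (f := fun P : Phase => wave l ξ 0 P)
    (ae_of_all _ fun P => (norm_wave l ξ 0 P).le)
  rw [integral_wave] at this
  simpa using this

theorem continuous_fourierTransform (ρ : Measure Phase) [IsProbabilityMeasure ρ] (l : ℤ) :
    Continuous (fourierTransform ρ l) := by
  have h1 := continuous_angleExp l
  unfold fourierTransform
  refine continuous_of_dominated (bound := fun _ => 1) (fun ξ => ?_) (fun ξ => ?_)
    (integrable_const _) ?_
  · exact Continuous.aestronglyMeasurable (by fun_prop)
  · refine ae_of_all _ fun P => ?_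
    rw [norm_mul, norm_angleExp, one_mul, mul_assoc, mul_comm, ← Complex.ofReal_mul,
      Complex.norm_exp_ofReal_mul_I]
  · exact ae_of_all _ fun P => by fun_prop

theorem fourierTransform_one_zero (ρ : Measure Phase) :
    fourierTransform ρ 1 0 = orderParam ρ := by
  simp [fourierTransform, orderParam]

theorem fourierTransform_zero {ρ : Measure Phase} {g : Measure ℝ} (h : ρ.map Prod.snd = g)
    (ξ : ℝ) : fourierTransform ρ 0 ξ = charFun g ξ := by
  rw [← h, charFun_apply, integral_map measurable_snd.aemeasurable
    (Continuous.aestronglyMeasurable (by fun_prop))]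
  refine integral_congr_ae (ae_of_all _ fun P => ?_)
  simp only [angleExp, fourier_zero, one_mul, RCLike.inner_apply, conj_trivial]
  congr 1
  push_cast
  ring

/-- The mean-field coupling of neighbouring Fourier modes. -/
def modeForce (K : ℝ) (u : ℤ → ℝ → ℂ) (l : ℤ) (ξ : ℝ) : ℂ :=
  K * l / 2 * (u 1 0 * u (l - 1) ξ - (starRingEnd ℂ) (u 1 0) * u (l + 1) ξ)

/-- Since `i Im y = (y - ȳ)/2` with `y = η e^{-iθ}`, the mean field multiplies `e^{ilθ}` by
`e^{∓iθ}` and so couples `l` to `l ∓ 1`. The labels `ζ ∓ t` keep the frequency in `ω` at `ζ - l t`.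
-/
theorem integral_waveForce (K : ℝ) (ρ : Measure Phase) [IsProbabilityMeasure ρ] (l : ℤ)
    (ζ t : ℝ) : ∫ P, waveForce K (orderParam ρ) l ζ t P ∂ρ =
      modeForce K (fourierTransform ρ) l (ζ - l * t) := by
  have hpt : ∀ P : Phase, waveForce K (orderParam ρ) l ζ t P =
      K * l / 2 * (orderParam ρ * wave (l - 1) (ζ - t) t P
        - (starRingEnd ℂ) (orderParam ρ) * wave (l + 1) (ζ + t) t P) := by
    intro P
    set y : ℂ := orderParam ρ * angleExp (-1) P.1 with hy
    have him : Complex.I * ((y.im : ℝ) : ℂ) = (y - (starRingEnd ℂ) y) / 2 := by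
      rw [Complex.sub_conj]; push_cast; ring
    have hconj : (starRingEnd ℂ) y = (starRingEnd ℂ) (orderParam ρ) * angleExp 1 P.1 := by
      rw [hy, map_mul, conj_angleExp, neg_neg]
    have e1 : ζ - t - ((l - 1 : ℤ) : ℝ) * t = ζ - l * t := by push_cast; ring
    have e2 : ζ + t - ((l + 1 : ℤ) : ℝ) * t = ζ - l * t := by push_cast; ring
    rw [waveForce, wave, wave, wave, e1, e2, sub_eq_add_neg l 1, ← angleExp_mul, ← angleExp_mul]
    calc _ = angleExp l P.1 * Complex.exp (Complex.I * ((ζ - l * t : ℝ) : ℂ) * P.2)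
          * (K * l * (Complex.I * (y.im : ℝ))) := by push_cast; ring
      _ = _ := by rw [him, hconj, hy]; ring
  have hint : ∀ m ζ', Integrable (wave m ζ' t) ρ := fun m ζ' =>
    Integrable.of_bound ((continuous_wave m ζ').comp
      (Continuous.prodMk_right t)).aestronglyMeasurable 1 (ae_of_all _ fun P => (norm_wave _ _ _ P).le)
  simp_rw [hpt]
  rw [integral_const_mul, integral_sub ((hint _ _).const_mul _) ((hint _ _).const_mul _),
    integral_const_mul, integral_const_mul, integral_wave, integral_wave, modeForce,
    fourierTransform_one_zero]
  congr 4 <;> (push_cast; ring)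

/-- A family of Fourier modes `u t l ξ` evolving by the Kuramoto equation along characteristics. -/
structure IsMildFamily (K : ℝ) (G : ℝ → ℂ) (u : ℝ → ℤ → ℝ → ℂ) : Prop where
  continuous : ∀ l, Continuous fun p : ℝ × ℝ => u p.1 l p.2
  norm_le_one : ∀ t l ξ, ‖u t l ξ‖ ≤ 1
  zero_mode : ∀ t ξ, u t 0 ξ = G ξ
  hasDerivAt : ∀ l ζ, ∀ t > 0,
    HasDerivAt (fun s => u s l (ζ - l * s)) (modeForce K (u t) l (ζ - l * t)) t

/-- The mode equation is autonomous. This yields monotonicity of the energy between arbitrary times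
without restarting the weak formulation at a positive time. -/
theorem IsMildFamily.shift {K : ℝ} {G : ℝ → ℂ} {u : ℝ → ℤ → ℝ → ℂ} (h : IsMildFamily K G u)
    {r : ℝ} (hr : 0 ≤ r) : IsMildFamily K G fun t => u (t + r) where
  continuous l := (h.continuous l).comp
    (((continuous_fst).add continuous_const).prodMk continuous_snd)
  norm_le_one t := h.norm_le_one _
  zero_mode t := h.zero_mode _
  hasDerivAt l ζ t ht := by
    have h1 := (h.hasDerivAt l (ζ + l * r) (t + r) (by linarith)).comp_add_const t r
    have e : ∀ s, ζ + l * r - l * (s + r) = ζ - l * s := fun s => by ring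
    simpa only [e] using h1

theorem exists_contDiff_cutoffs : ∃ χ : ℕ → ℝ → ℝ, (∀ n, ContDiff ℝ 1 (χ n)) ∧
    (∀ n, HasCompactSupport (χ n)) ∧ (∀ n x, ‖χ n x‖ ≤ 1) ∧
      ∀ x, ∀ᶠ n in atTop, χ n x = 1 := by
  let χ : ℕ → ContDiffBump (0 : ℝ) := fun n => ⟨n + 1, n + 2, by positivity, by linarith⟩
  refine ⟨fun n => χ n, fun n => (χ n).contDiff, fun n => (χ n).hasCompactSupport, fun n x => ?_,
    fun x => ?_⟩
  · rw [Real.norm_of_nonneg (χ n).nonneg]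
    exact (χ n).le_one
  · obtain ⟨N, hN⟩ := exists_nat_ge |x|
    filter_upwards [eventually_ge_atTop N] with n hn
    refine (χ n).one_of_mem_closedBall ?_
    rw [Metric.mem_closedBall, dist_zero_right, Real.norm_eq_abs]
    have : (N : ℝ) ≤ n := by exact_mod_cast hn
    change |x| ≤ n + 1
    linarith

/-- The Fourier modes of a solution satisfy the integrated equation along characteristics. -/
theorem IsSolution.mode_eq {K : ℝ} (hK : 0 ≤ K) {ρin : ProbabilityMeasure Phase}
    {ρ : ℝ → ProbabilityMeasure Phase} (h : IsSolution K ρin ρ) (hρ : Continuous ρ)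
    (l : ℤ) (ζ : ℝ) :
    Measurable (fun s => modeForce K (fourierTransform (ρ s)) l (ζ - l * s)) ∧ ∀ t : ℝ, 0 ≤ t →
    fourierTransform (ρ t) l (ζ - l * t) = fourierTransform ρin l ζ +
      ∫ s in (0 : ℝ)..t, modeForce K (fourierTransform (ρ s)) l (ζ - l * s) := by
  obtain ⟨χ, hχ1, hχc, hχb, hχe⟩ := exists_contDiff_cutoffs
  have hχle : ∀ n x, ‖((χ n x : ℝ) : ℂ)‖ ≤ 1 := fun n x => by
    rw [Complex.norm_real]; exact hχb n x
  have hχlim : ∀ (P : Phase) (w : ℂ), Tendsto (fun n => ((χ n P.2 : ℝ) : ℂ) * w) atTop (𝓝 w) := by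
    intro P w
    refine tendsto_const_nhds.congr' ?_
    filter_upwards [hχe P.2] with n hn
    rw [hn, Complex.ofReal_one, one_mul]
  have hη := continuous_orderParam hρ
  have hlim : ∀ (μ : ProbabilityMeasure Phase) (f : Phase → ℂ) (C : ℝ), Continuous f →
      (∀ P, ‖f P‖ ≤ C) → Tendsto (fun n => ∫ P, ((χ n P.2 : ℝ) : ℂ) * f P ∂(μ : Measure Phase))
        atTop (𝓝 (∫ P, f P ∂(μ : Measure Phase))) := by
    intro μ f C hf hC
    refine tendsto_integral_of_dominated_convergence (fun _ => C) (fun n => ?_)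
      (integrable_const _) (fun n => ae_of_all _ fun P => ?_) (ae_of_all _ fun P => hχlim P _)
    · have := (hχ1 n).continuous
      exact Continuous.aestronglyMeasurable (by fun_prop)
    · rw [norm_mul]
      calc _ ≤ 1 * ‖f P‖ := by gcongr; exact hχle n _
        _ ≤ C := by rw [one_mul]; exact hC P
  have hwc : ∀ t, Continuous (wave l ζ t) := fun t =>
    (continuous_wave l ζ).comp (Continuous.prodMk_right t)
  have hfc : ∀ t, Continuous fun P => waveForce K (orderParam (ρ t)) l ζ t P := by
    intro t
    have h1 := continuous_waveForce K (η := fun t => orderParam (ρ t)) hη l ζ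
    simpa only [Function.comp_def] using h1.comp (Continuous.prodMk_right t)
  have hfb : ∀ t P, ‖waveForce K (orderParam (ρ t)) l ζ t P‖ ≤ K * |(l : ℝ)| := fun t P =>
    norm_waveForce_le hK (norm_orderParam_le _) l ζ t P
  have htr := fun n => h.truncated_mode_eq hK hρ (hχ1 n) (hχc n) l ζ
  have hflim : ∀ s, Tendsto (fun n => ∫ P, ((χ n P.2 : ℝ) : ℂ)
      * waveForce K (orderParam (ρ s)) l ζ s P ∂(ρ s : Measure Phase)) atTop
      (𝓝 (modeForce K (fourierTransform (ρ s)) l (ζ - l * s))) := by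
    intro s
    rw [← integral_waveForce]
    exact hlim (ρ s) _ _ (hfc s) (hfb s)
  -- Continuity in `s` does not pass to the pointwise limit of the cutoffs, so only measurability is
  -- claimed here; continuity is recovered afterwards from the integrated equation.
  refine ⟨measurable_of_tendsto_metrizable (fun n => (htr n).1.measurable)
    (tendsto_pi_nhds.2 hflim), fun t ht => ?_⟩
  have h1 := hlim (ρ t) _ 1 (hwc t) fun P => (norm_wave _ _ _ P).le
  have h2 := hlim ρin _ 1 (hwc 0) fun P => (norm_wave _ _ _ P).le
  have h3 : Tendsto (fun n => ∫ s in (0 : ℝ)..t, ∫ P, ((χ n P.2 : ℝ) : ℂ)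
      * waveForce K (orderParam (ρ s)) l ζ s P ∂(ρ s : Measure Phase)) atTop
      (𝓝 (∫ s in (0 : ℝ)..t, modeForce K (fourierTransform (ρ s)) l (ζ - l * s))) := by
    refine intervalIntegral.tendsto_integral_filter_of_dominated_convergence
      (fun _ => K * |(l : ℝ)|) (Eventually.of_forall fun n => (htr n).1.aestronglyMeasurable)
      (Eventually.of_forall fun n => ae_of_all _ fun s _ => ?_)
      intervalIntegrable_const (ae_of_all _ fun s _ => hflim s)
    have := norm_integral_le_of_norm_le_const (μ := (ρ s : Measure Phase))
      (f := fun P : Phase => ((χ n P.2 : ℝ) : ℂ) * waveForce K (orderParam (ρ s)) l ζ s P)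
      (C := K * |(l : ℝ)|) (ae_of_all _ fun P => by
        rw [norm_mul]
        calc _ ≤ 1 * ‖waveForce K (orderParam (ρ s)) l ζ s P‖ := by gcongr; exact hχle n _
          _ ≤ _ := by rw [one_mul]; exact hfb s P)
    simpa using this
  have h4 := h2.add h3
  have h5 := tendsto_nhds_unique (h1.congr fun n => (htr n).2 t ht) h4
  rw [integral_wave, integral_wave, mul_zero, sub_zero] at h5
  exact h5

theorem norm_modeForce_le {K : ℝ} (hK : 0 ≤ K) {u : ℤ → ℝ → ℂ} (hu : ∀ l ξ, ‖u l ξ‖ ≤ 1) (l : ℤ)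
    (ξ : ℝ) : ‖modeForce K u l ξ‖ ≤ K * |(l : ℝ)| := by
  have h1 : ‖u 1 0 * u (l - 1) ξ - (starRingEnd ℂ) (u 1 0) * u (l + 1) ξ‖ ≤ 2 := by
    refine (norm_sub_le _ _).trans ?_
    rw [norm_mul, norm_mul, RCLike.norm_conj]
    have := mul_le_one₀ (hu 1 0) (norm_nonneg _) (hu (l - 1) ξ)
    have := mul_le_one₀ (hu 1 0) (norm_nonneg _) (hu (l + 1) ξ)
    linarith
  rw [modeForce, norm_mul, norm_div, norm_mul, Complex.norm_real, Complex.norm_intCast,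
    Real.norm_of_nonneg hK, RCLike.norm_ofNat]
  calc _ ≤ K * |(l : ℝ)| / 2 * 2 := by gcongr
    _ = _ := by ring

/-- Negative times do not enter the equation, so freezing the solution there makes it continuous on
all of `ℝ` at no cost. -/
theorem IsSolution.clamp {K : ℝ} {ρin : ProbabilityMeasure Phase}
    {ρ : ℝ → ProbabilityMeasure Phase} (h : IsSolution K ρin ρ) :
    Continuous (fun t => ρ (max t 0)) ∧ IsSolution K ρin fun t => ρ (max t 0) := by
  have hc : Continuous (fun t => ρ (max t 0)) :=
    h.continuousOn.comp_continuous (by fun_prop) fun t => le_max_right t 0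
  refine ⟨hc, hc.continuousOn, fun a ha => (h.weak a ha).trans ?_⟩
  congr 1
  refine setIntegral_congr_fun measurableSet_Ioi fun t (ht : 0 < t) => ?_
  simp only [max_eq_left ht.le]

/-- The Fourier modes of a weak solution form a mild family, with the right initial modes. -/
theorem IsSolution.isMildFamily {K : ℝ} (hK : 0 ≤ K) {ρin : ProbabilityMeasure Phase}
    {ρ : ℝ → ProbabilityMeasure Phase} (h : IsSolution K ρin ρ) {g : Measure ℝ}
    (hg : (ρin : Measure Phase).map Prod.snd = g) :
    IsMildFamily K (charFun g) (fun t => fourierTransform (ρ (max t 0))) ∧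
      fourierTransform (ρ 0) = fourierTransform ρin := by
  obtain ⟨hc, hs⟩ := h.clamp
  set u : ℝ → ℤ → ℝ → ℂ := fun t => fourierTransform (ρ (max t 0)) with hu
  have heq : ∀ l ζ, Measurable (fun s => modeForce K (u s) l (ζ - l * s)) ∧ ∀ t : ℝ, 0 ≤ t →
      u t l (ζ - l * t) = fourierTransform ρin l ζ +
        ∫ s in (0 : ℝ)..t, modeForce K (u s) l (ζ - l * s) := hs.mode_eq hK hc
  have hu1 : ∀ t l ξ, ‖u t l ξ‖ ≤ 1 := fun t l ξ => norm_fourierTransform_le _ _ _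
  have hinit : ∀ l ξ, u 0 l ξ = fourierTransform ρin l ξ := by
    intro l ξ
    simpa using (heq l ξ).2 0 le_rfl
  have hint : ∀ l ζ a b, IntervalIntegrable (fun s => modeForce K (u s) l (ζ - l * s))
      volume a b := fun l ζ a b =>
    intervalIntegrable_const (c := K * |(l : ℝ)|) |>.mono_fun' (heq l ζ).1.aestronglyMeasurable
      (ae_of_all _ fun s => norm_modeForce_le hK (hu1 s) l _)
  have hlip : ∀ l ζ s t, 0 ≤ s → 0 ≤ t →
      ‖u t l (ζ - l * t) - u s l (ζ - l * s)‖ ≤ K * |(l : ℝ)| * |t - s| := by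
    intro l ζ s t h0s h0t
    rw [(heq l ζ).2 t h0t, (heq l ζ).2 s h0s, add_sub_add_left_eq_sub,
      intervalIntegral.integral_interval_sub_left (hint l ζ 0 t) (hint l ζ 0 s)]
    exact intervalIntegral.norm_integral_le_of_norm_le_const fun r _ =>
      norm_modeForce_le hK (hu1 r) l _
  have hclamp : ∀ t, u t = u (max t 0) := fun t => by simp [hu]
  have hcont : ∀ l, Continuous fun p : ℝ × ℝ => u p.1 l p.2 := by
    intro l
    rw [continuous_iff_continuousAt]
    rintro ⟨s, ξ₀⟩
    -- The comparison point lies on the same characteristic as `p`, at the clamped time of `s`. The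
    -- mode is Lipschitz in time along a characteristic, and at fixed time it is continuous in `ξ`.
    have hb : Tendsto (fun p : ℝ × ℝ => u s l (p.2 + l * (max p.1 0 - max s 0)))
        (𝓝 (s, ξ₀)) (𝓝 (u s l ξ₀)) := by
      have h1 : Continuous fun p : ℝ × ℝ => u s l (p.2 + l * (max p.1 0 - max s 0)) :=
        (continuous_fourierTransform _ l).comp (by fun_prop)
      simpa using h1.tendsto (s, ξ₀)
    have ha : Tendsto (fun p : ℝ × ℝ => u p.1 l p.2 - u s l (p.2 + l * (max p.1 0 - max s 0)))
        (𝓝 (s, ξ₀)) (𝓝 0) := by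
      have h1 : Continuous fun p : ℝ × ℝ => K * |(l : ℝ)| * |max p.1 0 - max s 0| := by fun_prop
      have h2 := h1.tendsto (s, ξ₀)
      simp only [sub_self, abs_zero, mul_zero] at h2
      refine squeeze_zero_norm (fun p => ?_) h2
      have h3 := hlip l (p.2 + l * max p.1 0) (max s 0) (max p.1 0) (le_max_right _ _)
        (le_max_right _ _)
      rw [← hclamp, ← hclamp] at h3
      convert h3 using 3 <;> congr 1 <;> ring
    have := ha.add hb
    simp only [sub_add_cancel, zero_add] at this
    exact this
  -- The force carries the factor `l`, so the zeroth mode is conserved.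
  have h0 : ∀ t ξ, u t 0 ξ = charFun g ξ := by
    intro t ξ
    rw [hclamp, ← fourierTransform_zero hg]
    have h1 := (heq 0 ξ).2 (max t 0) (le_max_right _ _)
    simpa [modeForce] using h1
  refine ⟨⟨hcont, hu1, h0, fun l ζ t ht => ?_⟩, ?_⟩
  · have hFc : Continuous fun s => modeForce K (u s) l (ζ - l * s) := by
      have hη : Continuous fun s => u s 1 0 := (hcont 1).comp (Continuous.prodMk_left 0)
      have hm : ∀ m, Continuous fun s => u s m (ζ - l * s) := fun m =>
        (hcont m).comp (by fun_prop : Continuous fun s : ℝ => (s, ζ - l * s))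
      have h1 := hm (l - 1)
      have h2 := hm (l + 1)
      unfold modeForce
      exact continuous_const.mul ((hη.mul h1).sub ((Complex.continuous_conj.comp hη).mul h2))
    have h1 := (intervalIntegral.integral_hasDerivAt_right (hint l ζ 0 t)
      hFc.aestronglyMeasurable.stronglyMeasurableAtFilter hFc.continuousAt).const_add
      (fourierTransform ρin l ζ)
    refine h1.congr_of_eventuallyEq ?_
    filter_upwards [Ioi_mem_nhds ht] with s hs
    exact (heq l ζ).2 s (le_of_lt hs)
  · funext l ξ
    have := hinit l ξ
    simpa [hu] using this

/-! ### Transport balance on the half-line -/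

theorem indicator_Ioi_sub (f : ℝ → ℝ) (a ζ : ℝ) :
    (Ioi (0 : ℝ)).indicator f (ζ - a) = (Ioi a).indicator (fun x => f (x - a)) ζ := by
  by_cases h : a < ζ
  · rw [indicator_of_mem (show ζ - a ∈ Ioi 0 from sub_pos.2 h), indicator_of_mem (mem_Ioi.2 h)]
  · rw [indicator_of_notMem (show ζ - a ∉ Ioi 0 from fun h' => h (sub_pos.1 h')),
      indicator_of_notMem (show ζ ∉ Ioi a from h)]

theorem setIntegral_Ioi_comp_sub (f : ℝ → ℝ) (a : ℝ) :
    ∫ ζ in Ioi a, f (ζ - a) = ∫ ξ in Ioi (0 : ℝ), f ξ := by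
  rw [← integral_indicator measurableSet_Ioi, ← integral_indicator measurableSet_Ioi,
    ← integral_sub_right_eq_self ((Ioi (0 : ℝ)).indicator f) a]
  simp_rw [indicator_Ioi_sub]

theorem integrableOn_Ioi_comp_sub {f : ℝ → ℝ} (hf : IntegrableOn f (Ioi 0)) (a : ℝ) :
    IntegrableOn (fun ζ => f (ζ - a)) (Ioi a) := by
  rw [← integrable_indicator_iff measurableSet_Ioi] at hf ⊢
  have := hf.comp_sub_right a
  simpa only [indicator_Ioi_sub] using this

/-- Balance law for a quantity transported to the left on the half-line with speed `m`. -/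
theorem transport_identity {q D : ℝ → ℝ → ℝ} {b : ℝ → ℝ} {m t : ℝ} (hm : 0 < m) (ht : 0 ≤ t)
    (hq : Continuous (Function.uncurry q)) (hD : Continuous (Function.uncurry D))
    (hb : IntegrableOn b (Ioi 0)) (hqb : ∀ s, 0 ≤ s → ∀ ξ > 0, ‖q s ξ‖ ≤ b ξ)
    (hDb : ∀ s, 0 ≤ s → ∀ ξ > 0, ‖D s ξ‖ ≤ b ξ)
    (hderiv : ∀ ζ, ∀ s > 0, 0 < ζ - m * s →
      HasDerivAt (fun r => q r (ζ - m * r)) (D s (ζ - m * s)) s) :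
    (∫ ξ in Ioi (0 : ℝ), q t ξ) + m * ∫ s in (0 : ℝ)..t, q s 0 =
      (∫ ξ in Ioi (0 : ℝ), q 0 ξ) + ∫ s in (0 : ℝ)..t, ∫ ξ in Ioi (0 : ℝ), D s ξ := by
  have hqs : ∀ s, Continuous (q s) := fun s => hq.comp (Continuous.prodMk_right s)
  have hDs : ∀ s, Continuous (D s) := fun s => hD.comp (Continuous.prodMk_right s)
  have hqi : ∀ s, 0 ≤ s → IntegrableOn (q s) (Ioi 0) := fun s hs =>
    Integrable.mono' hb (hqs s).aestronglyMeasurable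
      ((ae_restrict_iff' measurableSet_Ioi).2 (ae_of_all _ fun ξ hξ => hqb s hs ξ hξ))
  -- The balance is computed in the label `ζ` of the characteristic, since `q` is differentiable
  -- along characteristics only, not in `ξ`. The indicator switches the source off once the
  -- characteristic has left the half-line.
  set H : ℝ → ℝ → ℝ := fun s ζ => (Ioi (0 : ℝ)).indicator (D s) (ζ - m * s) with hH
  have hqc : Continuous fun p : ℝ × ℝ => q (min t (p.1 / m)) (p.2 - m * min t (p.1 / m)) :=
    hq.comp (by fun_prop : Continuous fun p : ℝ × ℝ =>
      (min t (p.1 / m), p.2 - m * min t (p.1 / m)))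
  -- `Q ζ` is the value reached from `ζ` at time `t`, or at the exit time `ζ / m` if that comes
  -- first. Labels below `m t` produce the boundary flux at `ξ = 0`, the others the integral at time
  -- `t`.
  set Q : ℝ → ℝ := fun ζ => q (min t (ζ / m)) (ζ - m * min t (ζ / m)) with hQ
  have hQc : Continuous Q := hqc.comp (by fun_prop : Continuous fun ζ : ℝ => (ζ, ζ))
  have hchar : ∀ ζ > 0, Q ζ - q 0 ζ = ∫ s in Ioc 0 t, H s ζ := by
    intro ζ hζ
    set T := min t (ζ / m) with hT
    have hT0 : 0 ≤ T := le_min ht (by positivity)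
    have hmT : ∀ s < T, 0 < ζ - m * s := by
      intro s hs
      have := lt_of_lt_of_le hs (min_le_right _ _)
      rw [lt_div_iff₀ hm] at this
      linarith
    have hcD : Continuous fun s => D s (ζ - m * s) :=
      hD.comp (by fun_prop : Continuous fun s : ℝ => (s, ζ - m * s))
    have hcq : Continuous fun s => q s (ζ - m * s) :=
      hq.comp (by fun_prop : Continuous fun s : ℝ => (s, ζ - m * s))
    have h1 := intervalIntegral.integral_eq_sub_of_hasDerivAt_of_le hT0 hcq.continuousOn
      (fun s hs => hderiv ζ s hs.1 (hmT s hs.2)) (hcD.intervalIntegrable _ _)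
    simp only [mul_zero, sub_zero] at h1
    rw [← h1, intervalIntegral.integral_of_le hT0, integral_Ioc_eq_integral_Ioo]
    have h2 : ∫ s in Ioo 0 T, D s (ζ - m * s) = ∫ s in Ioo 0 T, H s ζ :=
      setIntegral_congr_fun measurableSet_Ioo fun s hs => by
        simp only [hH]
        rw [indicator_of_mem (show ζ - m * s ∈ Ioi 0 from hmT s hs.2)]
    rw [h2, integral_Ioc_eq_integral_Ioo]
    symm
    refine setIntegral_eq_of_subset_of_forall_sdiff_eq_zero measurableSet_Ioo
      (fun s hs => ⟨hs.1, hs.2.trans_le (min_le_left _ _)⟩) fun s hs => ?_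
    have h3 : T ≤ s := not_lt.1 fun h => hs.2 ⟨hs.1.1, h⟩
    have h4 : ζ / m ≤ s := (min_le_iff.1 h3).resolve_left (not_le.2 hs.1.2)
    rw [div_le_iff₀ hm] at h4
    refine indicator_of_notMem (fun h => ?_) _
    have h5 : 0 < ζ - m * s := h
    linarith
  have hneg : ∀ ζ ∉ Ioi (0 : ℝ), ∫ s in Ioc 0 t, H s ζ = 0 := by
    intro ζ hζ
    refine setIntegral_eq_zero_of_forall_eq_zero fun s hs => ?_
    refine indicator_of_notMem (fun h => ?_) _
    have h1 : 0 < ζ - m * s := h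
    have h2 := mul_pos hm hs.1
    exact hζ (show (0 : ℝ) < ζ by linarith)
  have hHi : Integrable (Function.uncurry H) ((volume.restrict (Ioc 0 t)).prod volume) := by
    have hmeas : AEStronglyMeasurable (Function.uncurry H)
        ((volume.restrict (Ioc 0 t)).prod volume) := by
      have h1 : Measurable (((fun p : ℝ × ℝ => p.2 - m * p.1) ⁻¹' Ioi 0).indicator
          fun p : ℝ × ℝ => D p.1 (p.2 - m * p.1)) :=
        Measurable.indicator (hD.comp (by fun_prop : Continuous fun p : ℝ × ℝ =>
          (p.1, p.2 - m * p.1))).measurable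
          ((by fun_prop : Measurable fun p : ℝ × ℝ => p.2 - m * p.1) measurableSet_Ioi)
      exact h1.aestronglyMeasurable
    have hDi : ∀ s, 0 ≤ s → IntegrableOn (D s) (Ioi 0) := fun s hs =>
      Integrable.mono' hb (hDs s).aestronglyMeasurable
        ((ae_restrict_iff' measurableSet_Ioi).2 (ae_of_all _ fun ξ hξ => hDb s hs ξ hξ))
    rw [integrable_prod_iff hmeas]
    constructor
    · refine (ae_restrict_iff' measurableSet_Ioc).2 (ae_of_all _ fun s hs => ?_)
      exact ((integrable_indicator_iff measurableSet_Ioi).2 (hDi s hs.1.le)).comp_sub_right (m * s)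
    · refine Integrable.mono' (integrable_const (∫ ξ in Ioi (0 : ℝ), b ξ))
        hmeas.norm.integral_prod_right'
        ((ae_restrict_iff' measurableSet_Ioc).2 (ae_of_all _ fun s hs => ?_))
      rw [Real.norm_of_nonneg (integral_nonneg fun _ => norm_nonneg _)]
      calc ∫ ζ, ‖H s ζ‖ = ∫ ζ, ‖(Ioi (0 : ℝ)).indicator (D s) ζ‖ :=
            integral_sub_right_eq_self (fun ζ => ‖(Ioi (0 : ℝ)).indicator (D s) ζ‖) (m * s)
        _ = ∫ ξ in Ioi (0 : ℝ), ‖D s ξ‖ := by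
            simp_rw [norm_indicator_eq_indicator_norm]
            exact integral_indicator measurableSet_Ioi
        _ ≤ _ := setIntegral_mono_on (hDi s hs.1.le).norm hb measurableSet_Ioi
            fun ξ hξ => hDb s hs.1.le ξ hξ
  have hswap : ∫ ζ in Ioi (0 : ℝ), ∫ s in Ioc 0 t, H s ζ
      = ∫ s in (0 : ℝ)..t, ∫ ξ in Ioi (0 : ℝ), D s ξ := by
    rw [setIntegral_eq_integral_of_forall_compl_eq_zero hneg, ← integral_integral_swap hHi,
      intervalIntegral.integral_of_le ht]
    refine setIntegral_congr_fun measurableSet_Ioc fun s _ => ?_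
    simp only [hH]
    rw [integral_sub_right_eq_self (fun ζ => (Ioi (0 : ℝ)).indicator (D s) ζ) (m * s),
      integral_indicator measurableSet_Ioi]
  have hmt : 0 ≤ m * t := by positivity
  have hQ1 : EqOn Q (fun ζ => q (ζ / m) 0) (Ioc 0 (m * t)) := by
    intro ζ hζ
    have : ζ / m ≤ t := by rw [div_le_iff₀ hm]; linarith [hζ.2]
    simp only [hQ, min_eq_right this]
    rw [mul_div_cancel₀ _ hm.ne', sub_self]
  have hQ2 : EqOn Q (fun ζ => q t (ζ - m * t)) (Ioi (m * t)) := by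
    intro ζ hζ
    have : t ≤ ζ / m := by rw [le_div_iff₀ hm]; linarith [mem_Ioi.1 hζ]
    simp only [hQ, min_eq_left this]
  have hQi2 : IntegrableOn Q (Ioi (m * t)) :=
    (integrableOn_congr_fun hQ2 measurableSet_Ioi).2 (integrableOn_Ioi_comp_sub (hqi t ht) _)
  have hQi1 : IntegrableOn Q (Ioc 0 (m * t)) :=
    (hQc.integrableOn_Icc).mono_set Ioc_subset_Icc_self
  have hQint : ∫ ζ in Ioi (0 : ℝ), Q ζ
      = m * (∫ s in (0 : ℝ)..t, q s 0) + ∫ ξ in Ioi (0 : ℝ), q t ξ := by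
    rw [← Ioc_union_Ioi_eq_Ioi hmt, setIntegral_union Ioc_disjoint_Ioi_same measurableSet_Ioi
      hQi1 hQi2, setIntegral_congr_fun measurableSet_Ioc hQ1,
      setIntegral_congr_fun measurableSet_Ioi hQ2, Ioc_union_Ioi_eq_Ioi hmt,
      setIntegral_Ioi_comp_sub, ← intervalIntegral.integral_of_le hmt,
      intervalIntegral.integral_comp_div (fun s => q s 0) hm.ne', zero_div,
      mul_div_cancel_left₀ _ hm.ne', smul_eq_mul]
  have hQi : IntegrableOn Q (Ioi 0) := by
    rw [← Ioc_union_Ioi_eq_Ioi hmt]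
    exact hQi1.union hQi2
  have hfin : (∫ ζ in Ioi (0 : ℝ), Q ζ) - ∫ ζ in Ioi (0 : ℝ), q 0 ζ
      = ∫ s in (0 : ℝ)..t, ∫ ξ in Ioi (0 : ℝ), D s ξ := by
    rw [← integral_sub hQi (hqi 0 le_rfl), ← hswap]
    exact setIntegral_congr_fun measurableSet_Ioi fun ζ hζ => hchar ζ hζ
  rw [hQint] at hfin
  linarith

/-! ### Cutoff weights and Abel summation -/

/-- The base of the cutoff in frequency space: the mode `l = k + 1` gets the weight
`(cutoffBase δ k ξ)⁻²`. -/
def cutoffBase (δ : ℝ) (k : ℕ) (ξ : ℝ) : ℝ := 1 + δ * (max ξ 0 + k)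

theorem one_le_cutoffBase {δ : ℝ} (hδ : 0 ≤ δ) (k : ℕ) (ξ : ℝ) : 1 ≤ cutoffBase δ k ξ := by
  have : 0 ≤ max ξ 0 + k := add_nonneg (le_max_right _ _) (Nat.cast_nonneg _)
  have := mul_nonneg hδ this
  rw [cutoffBase]
  linarith

theorem cutoffBase_pos {δ : ℝ} (hδ : 0 ≤ δ) (k : ℕ) (ξ : ℝ) : 0 < cutoffBase δ k ξ :=
  zero_lt_one.trans_le (one_le_cutoffBase hδ k ξ)

theorem cutoffBase_succ (δ : ℝ) (k : ℕ) (ξ : ℝ) :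
    cutoffBase δ (k + 1) ξ = cutoffBase δ k ξ + δ := by
  simp only [cutoffBase]
  push_cast
  ring

@[fun_prop]
theorem continuous_cutoffBase (δ : ℝ) (k : ℕ) : Continuous (cutoffBase δ k) := by
  unfold cutoffBase
  fun_prop

theorem hasDerivAt_cutoffBase (δ : ℝ) (k : ℕ) {ξ : ℝ} (hξ : 0 < ξ) :
    HasDerivAt (cutoffBase δ k) δ ξ := by
  have h1 : HasDerivAt (fun x : ℝ => 1 + δ * (x + k)) δ ξ := by
    simpa using (((hasDerivAt_id ξ).add_const (k : ℝ)).const_mul δ).const_add 1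
  refine h1.congr_of_eventuallyEq ?_
  filter_upwards [Ioi_mem_nhds hξ] with x hx
  rw [cutoffBase, max_eq_left (le_of_lt hx)]

theorem hasDerivAt_inv_cutoffBase_sq {δ : ℝ} (hδ : 0 ≤ δ) (k : ℕ) {ξ : ℝ} (hξ : 0 < ξ) :
    HasDerivAt (fun x => (cutoffBase δ k x ^ 2)⁻¹) (-(2 * δ * (cutoffBase δ k ξ ^ 3)⁻¹)) ξ := by
  have hX := (cutoffBase_pos hδ k ξ).ne'
  have h := ((hasDerivAt_cutoffBase δ k hξ).pow 2).inv (pow_ne_zero 2 hX)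
  refine h.congr_deriv ?_
  simp only [Nat.cast_ofNat, Pi.pow_apply]
  field_simp
  ring

/-- Exponent two makes the weight integrable in `ξ`, which supplies all dominating functions below.
The exact integral measures the remainder left by the last retained mode and decays in `k`. -/
theorem integral_inv_cutoffBase_sq {δ : ℝ} (hδ : 0 < δ) (k : ℕ) :
    IntegrableOn (fun ξ => (cutoffBase δ k ξ ^ 2)⁻¹) (Ioi 0) ∧
      ∫ ξ in Ioi (0 : ℝ), (cutoffBase δ k ξ ^ 2)⁻¹ = (δ * (1 + δ * k))⁻¹ := by
  set A : ℝ → ℝ := fun ξ => -(δ * cutoffBase δ k ξ)⁻¹ with hA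
  have hXc := continuous_cutoffBase δ k
  have hne : ∀ ξ, δ * cutoffBase δ k ξ ≠ 0 := fun ξ =>
    (mul_pos hδ (cutoffBase_pos hδ.le k ξ)).ne'
  have hAc : Continuous A := ((continuous_const.mul hXc).inv₀ hne).neg
  have hderiv : ∀ ξ ∈ Ioi (0 : ℝ), HasDerivAt A ((cutoffBase δ k ξ ^ 2)⁻¹) ξ := by
    intro ξ hξ
    have h := (((hasDerivAt_cutoffBase δ k hξ).const_mul δ).inv (hne ξ)).neg
    refine h.congr_deriv ?_
    have := (cutoffBase_pos hδ.le k ξ).ne'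
    field_simp
  have hlim : Tendsto A atTop (𝓝 0) := by
    have h1 : Tendsto (fun ξ => δ * cutoffBase δ k ξ) atTop atTop := by
      refine Tendsto.const_mul_atTop hδ (tendsto_atTop_mono (f := fun ξ => δ * ξ) (fun ξ => ?_)
        (tendsto_id.const_mul_atTop hδ))
      have h2 := le_max_left ξ 0
      have h3 : 0 ≤ δ * (max ξ 0 - ξ) := mul_nonneg hδ.le (sub_nonneg.2 h2)
      have h4 : 0 ≤ δ * (k : ℝ) := by positivity
      rw [cutoffBase]
      linarith
    have h2 := (tendsto_inv_atTop_zero.comp h1).neg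
    rw [neg_zero] at h2
    exact h2
  have hnn : ∀ ξ ∈ Ioi (0 : ℝ), 0 ≤ (cutoffBase δ k ξ ^ 2)⁻¹ := fun ξ _ => by positivity
  refine ⟨integrableOn_Ioi_deriv_of_nonneg hAc.continuousWithinAt hderiv hnn hlim, ?_⟩
  rw [integral_Ioi_of_hasDerivAt_of_nonneg hAc.continuousWithinAt hderiv hnn hlim]
  simp [hA, cutoffBase]

/-- Abel summation of the telescoping coupling terms against decreasing weights `w`, whose
increments are controlled by `e`. -/
theorem sum_coupling_le {c w e a : ℕ → ℝ}
    (hc : ∀ k, |c (k + 1)| ≤ a k * a (k + 1)) (hw : ∀ k, w (k + 1) ≤ w k)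
    (h1 : ∀ k, w k - w (k + 1) ≤ 2 * e k) (h2 : ∀ k, w k - w (k + 1) ≤ 6 * e (k + 1))
    (he : ∀ k, 0 ≤ e k) (n : ℕ) :
    ∑ k ∈ Finset.range (n + 1), (c k - c (k + 1)) * w k ≤
      c 0 * w 0 - c (n + 1) * w n + 4 * ∑ k ∈ Finset.range (n + 1), e k * a k ^ 2 := by
  -- In the induction the increment `w n - w (n + 1)` is charged half to `a n ^ 2`, costing `e n`,
  -- and half to `a (n + 1) ^ 2`, costing `3 * e (n + 1)`. Each index pays `1 + 3 = 4`, and the last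
  -- one must keep one unit in reserve for the next step.
  suffices H : ∑ k ∈ Finset.range (n + 1), (c k - c (k + 1)) * w k ≤
      c 0 * w 0 - c (n + 1) * w n + 4 * ∑ k ∈ Finset.range (n + 1), e k * a k ^ 2
        - e n * a n ^ 2 by
    have := mul_nonneg (he n) (sq_nonneg (a n))
    linarith
  induction n with
  | zero =>
    simp only [zero_add, Finset.sum_range_one]
    have := mul_nonneg (he 0) (sq_nonneg (a 0))
    linarith
  | succ n ih =>
    rw [Finset.sum_range_succ _ (n + 1), Finset.sum_range_succ (fun k => e k * a k ^ 2) (n + 1)]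
    have hd : 0 ≤ w n - w (n + 1) := sub_nonneg.2 (hw n)
    have h3 : -c (n + 1) * (w n - w (n + 1))
        ≤ (a n ^ 2 + a (n + 1) ^ 2) / 2 * (w n - w (n + 1)) := by
      refine mul_le_mul_of_nonneg_right ?_ hd
      have := (neg_le_abs (c (n + 1))).trans (hc n)
      nlinarith [sq_nonneg (a n - a (n + 1))]
    have h4 := mul_le_mul_of_nonneg_left (h1 n) (sq_nonneg (a n))
    have h5 := mul_le_mul_of_nonneg_left (h2 n) (sq_nonneg (a (n + 1)))
    linarith

/-- The difference is about `2 δ x⁻³`. The second form refers to the right endpoint; since `δ ≤ 1 ≤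
x`, one has `2 x + δ ≤ 3 x` and `x + δ ≤ 2 x`, whence the constant 6. -/
theorem inv_sq_sub_inv_sq_le {x δ : ℝ} (hx : 1 ≤ x) (hδ : 0 ≤ δ) (hδ1 : δ ≤ 1) :
    (x ^ 2)⁻¹ - ((x + δ) ^ 2)⁻¹ ≤ 2 * (δ * (x ^ 3)⁻¹) ∧
      (x ^ 2)⁻¹ - ((x + δ) ^ 2)⁻¹ ≤ 6 * (δ * ((x + δ) ^ 3)⁻¹) := by
  have hx0 : 0 < x := by linarith
  have hy0 : 0 < x + δ := by linarith
  have e : (x ^ 2)⁻¹ - ((x + δ) ^ 2)⁻¹ = δ * (2 * x + δ) / (x ^ 2 * (x + δ) ^ 2) := by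
    field_simp
    ring
  rw [e]
  constructor
  · rw [show 2 * (δ * (x ^ 3)⁻¹) = δ * 2 / x ^ 3 by ring, div_le_div_iff₀ (by positivity)
      (by positivity)]
    have : (2 * x + δ) * x ≤ 2 * (x + δ) ^ 2 := by nlinarith
    calc δ * (2 * x + δ) * x ^ 3 = δ * x ^ 2 * ((2 * x + δ) * x) := by ring
      _ ≤ δ * x ^ 2 * (2 * (x + δ) ^ 2) := by gcongr
      _ = _ := by ring
  · rw [show 6 * (δ * ((x + δ) ^ 3)⁻¹) = δ * 6 / (x + δ) ^ 3 by ring, div_le_div_iff₀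
      (by positivity) (by positivity)]
    have : (2 * x + δ) * (x + δ) ≤ 6 * x ^ 2 := by nlinarith
    calc δ * (2 * x + δ) * (x + δ) ^ 3 = δ * (x + δ) ^ 2 * ((2 * x + δ) * (x + δ)) := by ring
      _ ≤ δ * (x + δ) ^ 2 * (6 * x ^ 2) := by gcongr
      _ = _ := by ring

/-! ### Pointwise estimate of the energy production -/

/-- A bounded weight `φ` with derivative `φ'` on the half-line, which increases fast enough where
`G` is large. -/
structure IsEnergyWeight (lam B B' : ℝ) (G : ℝ → ℂ) (φ φ' : ℝ → ℝ) : Prop where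
  continuous_deriv : Continuous φ'
  hasDerivAt : ∀ ξ, HasDerivAt φ (φ' ξ) ξ
  pos : ∀ ξ, 0 ≤ ξ → 0 < φ ξ
  le : ∀ ξ, 0 ≤ ξ → φ ξ ≤ B
  deriv_le : ∀ ξ, 0 ≤ ξ → φ' ξ ≤ B'
  le_deriv : ∀ ξ, 0 ≤ ξ → lam * ‖G ξ‖ * φ ξ ^ 2 ≤ φ' ξ
  apply_zero : φ 0 = 1

theorem IsEnergyWeight.continuous {lam B B' : ℝ} {G : ℝ → ℂ} {φ φ' : ℝ → ℝ}
    (h : IsEnergyWeight lam B B' G φ φ') : Continuous φ :=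
  continuous_iff_continuousAt.2 fun ξ => (h.hasDerivAt ξ).continuousAt

/-- The energy density produced by the mode `k + 1`, divided by `k + 1`. -/
def modeRate (K C δ : ℝ) (φ φ' : ℝ → ℝ) (u : ℤ → ℝ → ℂ) (k : ℕ) (ξ : ℝ) : ℝ :=
  2 * inner ℝ (u (k + 1) ξ) (modeForce K u (k + 1) ξ) / (k + 1) * (φ ξ * (cutoffBase δ k ξ ^ 2)⁻¹)
    - (φ' ξ * (cutoffBase δ k ξ ^ 2)⁻¹ - φ ξ * (2 * δ * (cutoffBase δ k ξ ^ 3)⁻¹))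
      * ‖u (k + 1) ξ‖ ^ 2
    - C / (k + 1) * (φ ξ * (cutoffBase δ k ξ ^ 2)⁻¹) * ‖u (k + 1) ξ‖ ^ 2

/-- The part of the energy production of the mode `k + 1` which is due to the cutoff. -/
def modeCutoffError (K C δ : ℝ) (φ : ℝ → ℝ) (u : ℤ → ℝ → ℂ) (k : ℕ) (ξ : ℝ) : ℝ :=
  ((2 + 4 * K) * (φ ξ * (δ * (cutoffBase δ k ξ ^ 3)⁻¹))
    - C / (k + 1) * (φ ξ * (cutoffBase δ k ξ ^ 2)⁻¹)) * ‖u (k + 1) ξ‖ ^ 2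

/-- The part of the energy production of the first `n + 1` modes which is due to the cutoff. -/
def cutoffError (K C δ : ℝ) (φ : ℝ → ℝ) (u : ℤ → ℝ → ℂ) (n : ℕ) (ξ : ℝ) : ℝ :=
  ∑ k ∈ Finset.range (n + 1), modeCutoffError K C δ φ u k ξ

/-- The factor `l` of the force cancels against the `1/l` of the energy, and `Re⟨u_l, η̄ u_{l+1}⟩ =
Re⟨u_{l+1}, η u_l⟩`. So the production is a difference of consecutive terms of one sequence and
telescopes in `k`. -/
theorem inner_modeForce (K : ℝ) (u : ℤ → ℝ → ℂ) (k : ℕ) (ξ : ℝ) :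
    2 * inner ℝ (u (k + 1) ξ) (modeForce K u (k + 1) ξ) / (k + 1) =
      K * (inner ℝ (u (k + 1) ξ) (u 1 0 * u k ξ)
        - inner ℝ (u ((k + 1 : ℕ) + 1) ξ) (u 1 0 * u ((k + 1 : ℕ) : ℤ) ξ)) := by
  have hk : ((k : ℝ) + 1) ≠ 0 := by positivity
  have e : (K : ℂ) * (((k : ℤ) + 1 : ℤ) : ℂ) / 2 = ((K * (k + 1) / 2 : ℝ) : ℂ) := by push_cast; ring
  rw [modeForce, e, add_sub_cancel_right, ← Complex.real_smul, real_inner_smul_right,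
    inner_sub_right]
  have h2 : inner ℝ (u (k + 1) ξ) ((starRingEnd ℂ) (u 1 0) * u ((k : ℤ) + 1 + 1) ξ)
      = inner ℝ (u ((k + 1 : ℕ) + 1) ξ) (u 1 0 * u ((k + 1 : ℕ) : ℤ) ξ) := by
    push_cast
    simp only [Complex.inner, Complex.mul_re, Complex.mul_im, Complex.conj_re, Complex.conj_im]
    ring
  rw [h2]
  field_simp

/-- This is where the subcritical mechanism acts. After Abel summation only the coupling of mode 1
to `u 0 = G` and a term from the last mode remain. The former is absorbed by the damping `φ'` up to
a multiple of `‖u 1 0‖ ^ 2 * ‖G ξ‖`. In the error, 2 comes from differentiating the cutoff and `4 K`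
from its variation in `k`. -/
theorem sum_modeRate_le {K C lam B B' δ : ℝ} (hK : 0 ≤ K) (hlam : 0 < lam) (hδ : 0 ≤ δ)
    (hδ1 : δ ≤ 1) {G : ℝ → ℂ} {φ φ' : ℝ → ℝ} (hφ : IsEnergyWeight lam B B' G φ φ')
    {u : ℤ → ℝ → ℂ} (hu : ∀ l ξ, ‖u l ξ‖ ≤ 1) {ξ : ℝ} (hξ : 0 ≤ ξ) (h0 : u 0 ξ = G ξ) (n : ℕ) :
    ∑ k ∈ Finset.range (n + 1), modeRate K C δ φ φ' u k ξ ≤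
      K ^ 2 / (4 * lam) * ‖u 1 0‖ ^ 2 * ‖G ξ‖ + K * B * (cutoffBase δ n ξ ^ 2)⁻¹
        + cutoffError K C δ φ u n ξ := by
  set X := fun k => cutoffBase δ k ξ with hX
  have hX1 : ∀ k, 1 ≤ X k := fun k => one_le_cutoffBase hδ k ξ
  have hX0 : ∀ k, 0 < X k := fun k => cutoffBase_pos hδ k ξ
  have hφ0 := hφ.pos ξ hξ
  set c : ℕ → ℝ := fun k => inner ℝ (u (k + 1) ξ) (u 1 0 * u k ξ) with hc
  set a : ℕ → ℝ := fun k => ‖u (k + 1) ξ‖ with ha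
  have ha0 : ∀ k, 0 ≤ a k := fun k => norm_nonneg _
  have hcb : ∀ k, |c (k + 1)| ≤ a k * a (k + 1) := by
    intro k
    refine (abs_real_inner_le_norm _ _).trans ?_
    rw [norm_mul]
    simp only [ha]
    push_cast
    calc _ ≤ ‖u ((k : ℤ) + 1 + 1) ξ‖ * (1 * ‖u ((k : ℤ) + 1) ξ‖) := by gcongr; exact hu _ _
      _ = _ := by ring
  have hsum := sum_coupling_le (c := c) (w := fun k => φ ξ * (X k ^ 2)⁻¹)
    (e := fun k => φ ξ * (δ * (X k ^ 3)⁻¹)) (a := a) hcb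
    (fun k => by
      have : X (k + 1) = X k + δ := cutoffBase_succ δ k ξ
      rw [this]
      have := hX0 k
      gcongr
      linarith)
    (fun k => by
      have : X (k + 1) = X k + δ := cutoffBase_succ δ k ξ
      rw [this]
      have h := mul_le_mul_of_nonneg_left (inv_sq_sub_inv_sq_le (hX1 k) hδ hδ1).1 hφ0.le
      linarith)
    (fun k => by
      have : X (k + 1) = X k + δ := cutoffBase_succ δ k ξ
      rw [this]
      have h := mul_le_mul_of_nonneg_left (inv_sq_sub_inv_sq_le (hX1 k) hδ hδ1).2 hφ0.le
      linarith)
    (fun k => by have := hX0 k; positivity) n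
  have hterm : ∀ k, modeRate K C δ φ φ' u k ξ = K * ((c k - c (k + 1)) * (φ ξ * (X k ^ 2)⁻¹))
      - φ' ξ * ((X k ^ 2)⁻¹ * a k ^ 2)
      + 2 * (φ ξ * (δ * (X k ^ 3)⁻¹) * a k ^ 2)
      - C / (k + 1) * (φ ξ * (X k ^ 2)⁻¹) * a k ^ 2 := by
    intro k
    rw [modeRate, inner_modeForce]
    simp only [hc, ha, hX]
    ring
  have herr : cutoffError K C δ φ u n ξ
      = (2 + 4 * K) * (∑ k ∈ Finset.range (n + 1), φ ξ * (δ * (X k ^ 3)⁻¹) * a k ^ 2)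
        - ∑ k ∈ Finset.range (n + 1), C / (k + 1) * (φ ξ * (X k ^ 2)⁻¹) * a k ^ 2 := by
    rw [cutoffError, Finset.mul_sum, ← Finset.sum_sub_distrib]
    refine Finset.sum_congr rfl fun k _ => ?_
    simp only [hX, ha, modeCutoffError]
    ring
  simp_rw [hterm]
  rw [Finset.sum_sub_distrib, Finset.sum_add_distrib, Finset.sum_sub_distrib, ← Finset.mul_sum,
    ← Finset.mul_sum, ← Finset.mul_sum, herr]
  have hφ'0 : 0 ≤ φ' ξ := le_trans (by positivity) (hφ.le_deriv ξ hξ)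
  -- Of the damping of all modes, only that of the first is needed.
  have hfirst : φ' ξ * ((X 0 ^ 2)⁻¹ * a 0 ^ 2)
      ≤ φ' ξ * ∑ k ∈ Finset.range (n + 1), (X k ^ 2)⁻¹ * a k ^ 2 := by
    gcongr
    refine Finset.single_le_sum (f := fun k => (X k ^ 2)⁻¹ * a k ^ 2) (fun k _ => ?_) (by simp)
    have := hX0 k
    positivity
  have hlast : -(K * (c (n + 1) * (φ ξ * (X n ^ 2)⁻¹))) ≤ K * B * (X n ^ 2)⁻¹ := by
    have h1 : -c (n + 1) ≤ 1 := ((neg_le_abs _).trans (hcb n)).trans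
      (mul_le_one₀ (hu _ _) (ha0 _) (hu _ _))
    have h2 : φ ξ * (X n ^ 2)⁻¹ ≤ B * (X n ^ 2)⁻¹ := by gcongr; exact hφ.le ξ hξ
    have h3 : 0 ≤ φ ξ * (X n ^ 2)⁻¹ := by have := hX0 n; positivity
    calc _ = K * (-c (n + 1) * (φ ξ * (X n ^ 2)⁻¹)) := by ring
      _ ≤ K * (1 * (φ ξ * (X n ^ 2)⁻¹)) := by gcongr
      _ ≤ K * (1 * (B * (X n ^ 2)⁻¹)) := by gcongr
      _ = _ := by ring
  have hzero : K * (c 0 * (φ ξ * (X 0 ^ 2)⁻¹)) ≤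
      φ' ξ * ((X 0 ^ 2)⁻¹ * a 0 ^ 2) + K ^ 2 / (4 * lam) * ‖u 1 0‖ ^ 2 * ‖G ξ‖ := by
    have h1 : c 0 ≤ a 0 * (‖u 1 0‖ * ‖G ξ‖) := by
      have := real_inner_le_norm (u ((0 : ℕ) + 1) ξ) (u 1 0 * u ((0 : ℕ) : ℤ) ξ)
      rw [norm_mul, Nat.cast_zero, h0] at this
      simpa [hc, ha, h0] using this
    have h2 : (X 0 ^ 2)⁻¹ ≤ 1 := inv_le_one_of_one_le₀ (one_le_pow₀ (hX1 0))
    -- Young's inequality, balanced so that the quadratic term in `a 0` is multiplied by `lam * φ ξ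
    -- ^ 2`, the factor controlled by the Riccati condition on `φ`.
    have h3 : K * (a 0 * ‖u 1 0‖ * φ ξ) ≤
        lam * φ ξ ^ 2 * a 0 ^ 2 + K ^ 2 / (4 * lam) * ‖u 1 0‖ ^ 2 := by
      have : 0 ≤ (2 * lam * (φ ξ * a 0) - K * ‖u 1 0‖) ^ 2 / (4 * lam) := by positivity
      have e : (2 * lam * (φ ξ * a 0) - K * ‖u 1 0‖) ^ 2 / (4 * lam)
          = lam * φ ξ ^ 2 * a 0 ^ 2 + K ^ 2 / (4 * lam) * ‖u 1 0‖ ^ 2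
            - K * (a 0 * ‖u 1 0‖ * φ ξ) := by
        field_simp
        ring
      linarith
    have hX00 := hX0 0
    calc K * (c 0 * (φ ξ * (X 0 ^ 2)⁻¹))
        ≤ K * (a 0 * (‖u 1 0‖ * ‖G ξ‖) * (φ ξ * (X 0 ^ 2)⁻¹)) := by gcongr
      _ = (X 0 ^ 2)⁻¹ * ‖G ξ‖ * (K * (a 0 * ‖u 1 0‖ * φ ξ)) := by ring
      _ ≤ (X 0 ^ 2)⁻¹ * ‖G ξ‖ *
          (lam * φ ξ ^ 2 * a 0 ^ 2 + K ^ 2 / (4 * lam) * ‖u 1 0‖ ^ 2) := by gcongr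
      _ = (lam * ‖G ξ‖ * φ ξ ^ 2) * ((X 0 ^ 2)⁻¹ * a 0 ^ 2)
          + (X 0 ^ 2)⁻¹ * (K ^ 2 / (4 * lam) * ‖u 1 0‖ ^ 2 * ‖G ξ‖) := by ring
      _ ≤ φ' ξ * ((X 0 ^ 2)⁻¹ * a 0 ^ 2)
          + 1 * (K ^ 2 / (4 * lam) * ‖u 1 0‖ ^ 2 * ‖G ξ‖) := by
        gcongr
        exact hφ.le_deriv ξ hξ
      _ = _ := by ring
  have hsum' := mul_le_mul_of_nonneg_left hsum hK
  simp only [hX] at *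
  linarith

/-! ### Integrated balance for the cut off energy -/

/-- The energy of the mode `k + 1` for the cut off weight. -/
def modeEnergy (δ : ℝ) (φ : ℝ → ℝ) (u : ℤ → ℝ → ℂ) (k : ℕ) : ℝ :=
  ∫ ξ in Ioi (0 : ℝ), ‖u (k + 1) ξ‖ ^ 2 * (φ ξ * (cutoffBase δ k ξ ^ 2)⁻¹)

theorem IsMildFamily.continuous_modeForce {K : ℝ} {G : ℝ → ℂ} {u : ℝ → ℤ → ℝ → ℂ}
    (h : IsMildFamily K G u) (l : ℤ) : Continuous fun p : ℝ × ℝ => modeForce K (u p.1) l p.2 := by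
  have hη : Continuous fun p : ℝ × ℝ => u p.1 1 0 :=
    (h.continuous 1).comp (continuous_fst.prodMk continuous_const)
  have h1 := h.continuous (l - 1)
  have h2 := h.continuous (l + 1)
  unfold modeForce
  exact continuous_const.mul ((hη.mul h1).sub ((Complex.continuous_conj.comp hη).mul h2))

theorem IsMildFamily.continuous_modeRate {K lam B B' : ℝ} {G : ℝ → ℂ} {u : ℝ → ℤ → ℝ → ℂ}
    (h : IsMildFamily K G u) {φ φ' : ℝ → ℝ} (hφ : IsEnergyWeight lam B B' G φ φ') (C : ℝ) {δ : ℝ}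
    (hδ : 0 ≤ δ) (k : ℕ) : Continuous fun p : ℝ × ℝ => modeRate K C δ φ φ' (u p.1) k p.2 := by
  have h1 := h.continuous_modeForce (k + 1)
  have h2 := h.continuous (k + 1)
  have h3 := hφ.continuous
  have h4 := hφ.continuous_deriv
  have h5 : Continuous fun p : ℝ × ℝ => (cutoffBase δ k p.2 ^ 2)⁻¹ :=
    Continuous.inv₀ (by fun_prop) fun p => (pow_pos (cutoffBase_pos hδ k _) 2).ne'
  have h6 : Continuous fun p : ℝ × ℝ => (cutoffBase δ k p.2 ^ 3)⁻¹ :=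
    Continuous.inv₀ (by fun_prop) fun p => (pow_pos (cutoffBase_pos hδ k _) 3).ne'
  unfold modeRate
  fun_prop

theorem inv_cutoffBase_pow_three_le {δ : ℝ} (hδ : 0 ≤ δ) (k : ℕ) (ξ : ℝ) :
    (cutoffBase δ k ξ ^ 3)⁻¹ ≤ (cutoffBase δ k ξ ^ 2)⁻¹ := by
  have h1 := one_le_cutoffBase hδ k ξ
  have h0 := cutoffBase_pos hδ k ξ
  gcongr
  norm_num

/-- The force grows like `K (k + 1)`, but its share of the rate is divided by `k + 1`. The resulting
bound is uniform in time and integrable in `ξ`, which justifies the transport identity and the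
continuity in time of the integrated rate. -/
theorem abs_modeRate_le {K C lam B B' δ : ℝ} (hK : 0 ≤ K) (hC : 0 ≤ C) (hlam : 0 ≤ lam)
    (hδ : 0 ≤ δ) {G : ℝ → ℂ} {φ φ' : ℝ → ℝ} (hφ : IsEnergyWeight lam B B' G φ φ') {u : ℤ → ℝ → ℂ}
    (hu : ∀ l ξ, ‖u l ξ‖ ≤ 1) {ξ : ℝ} (hξ : 0 ≤ ξ) (k : ℕ) :
    |modeRate K C δ φ φ' u k ξ| ≤
      (2 * K * B + (B' + B * (2 * δ)) + C * B) * (cutoffBase δ k ξ ^ 2)⁻¹ := by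
  have hX0 := cutoffBase_pos hδ k ξ
  have hX3 := inv_cutoffBase_pow_three_le hδ k ξ
  set W := (cutoffBase δ k ξ ^ 2)⁻¹ with hW
  have hW0 : 0 ≤ W := by positivity
  have hφ0 := hφ.pos ξ hξ
  have hφ'0 : 0 ≤ φ' ξ := le_trans (by positivity) (hφ.le_deriv ξ hξ)
  have hB := hφ.le ξ hξ
  have hB' := hφ.deriv_le ξ hξ
  have hB'0 : 0 ≤ B' := hφ'0.trans hB'
  have hB0 : 0 ≤ B := hφ0.le.trans hB
  have ha : ‖u (k + 1) ξ‖ ^ 2 ≤ 1 := pow_le_one₀ (norm_nonneg _) (hu _ _)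
  have hk : 0 < (k : ℝ) + 1 := by positivity
  have h1 : |2 * inner ℝ (u (k + 1) ξ) (modeForce K u (k + 1) ξ) / (k + 1)| ≤ 2 * K := by
    rw [abs_div, abs_mul, abs_of_pos hk, div_le_iff₀ hk, abs_two]
    have h2 := norm_modeForce_le hK hu (k + 1) ξ
    push_cast at h2
    rw [abs_of_pos hk] at h2
    have h3 := abs_real_inner_le_norm (u (k + 1) ξ) (modeForce K u (k + 1) ξ)
    have h4 : ‖u (k + 1) ξ‖ * ‖modeForce K u (k + 1) ξ‖ ≤ 1 * (K * (k + 1)) := by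
      gcongr
      exact hu _ _
    linarith
  have hCk : C / (k + 1) ≤ C := div_le_self hC (by linarith [(Nat.cast_nonneg k : (0 : ℝ) ≤ k)])
  have hCk0 : 0 ≤ C / (k + 1) := by positivity
  have t1 : |2 * inner ℝ (u (k + 1) ξ) (modeForce K u (k + 1) ξ) / (k + 1) * (φ ξ * W)|
      ≤ 2 * K * (B * W) := by
    rw [abs_mul, abs_of_nonneg (a := φ ξ * W) (by positivity)]
    gcongr
  have t2 : |(φ' ξ * W - φ ξ * (2 * δ * (cutoffBase δ k ξ ^ 3)⁻¹)) * ‖u (k + 1) ξ‖ ^ 2|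
      ≤ (B' * W + B * (2 * δ * W)) * 1 := by
    rw [abs_mul, abs_of_nonneg (a := ‖u (k + 1) ξ‖ ^ 2) (by positivity)]
    refine mul_le_mul ?_ ha (by positivity) (by positivity)
    rw [← Real.norm_eq_abs]
    refine (norm_sub_le _ _).trans ?_
    rw [Real.norm_of_nonneg (by positivity), Real.norm_of_nonneg (by positivity)]
    gcongr
  have t3 : |C / (k + 1) * (φ ξ * W) * ‖u (k + 1) ξ‖ ^ 2| ≤ C * (B * W) * 1 := by
    rw [abs_of_nonneg (by positivity)]
    gcongr
  rw [modeRate, ← Real.norm_eq_abs]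
  refine (norm_sub_le (_ - _) _).trans ((add_le_add (norm_sub_le _ _) le_rfl).trans ?_)
  simp only [Real.norm_eq_abs]
  linarith

/-- Energy balance for a single mode. -/
theorem modeEnergy_identity {K C lam B B' δ t : ℝ} (hK : 0 ≤ K) (hC : 0 ≤ C) (hlam : 0 ≤ lam)
    (hδ : 0 < δ) (ht : 0 ≤ t) {G : ℝ → ℂ} {φ φ' : ℝ → ℝ} (hφ : IsEnergyWeight lam B B' G φ φ')
    {u : ℝ → ℤ → ℝ → ℂ} (hu : IsMildFamily K G u) (k : ℕ) :
    Real.exp (-C * t) * (1 / (k + 1) * modeEnergy δ φ (u t) k)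
      + ∫ s in (0 : ℝ)..t, Real.exp (-C * s) * (‖u s (k + 1) 0‖ ^ 2 * ((1 + δ * k) ^ 2)⁻¹) =
    1 / (k + 1) * modeEnergy δ φ (u 0) k
      + ∫ s in (0 : ℝ)..t, Real.exp (-C * s) *
        ∫ ξ in Ioi (0 : ℝ), modeRate K C δ φ φ' (u s) k ξ := by
  set W : ℝ → ℝ := fun ξ => (cutoffBase δ k ξ ^ 2)⁻¹ with hW
  have hk : 0 < (k : ℝ) + 1 := by positivity
  have hWc : Continuous W :=
    Continuous.inv₀ (by fun_prop) fun p => (pow_pos (cutoffBase_pos hδ.le k _) 2).ne'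
  have hWi : IntegrableOn W (Ioi 0) := (integral_inv_cutoffBase_sq hδ k).1
  have hφc := hφ.continuous
  have huc := hu.continuous (k + 1)
  have hrc := hu.continuous_modeRate hφ C hδ.le k
  set q : ℝ → ℝ → ℝ := fun s ξ => Real.exp (-C * s) * (‖u s (k + 1) ξ‖ ^ 2 * (φ ξ * W ξ)) with hq
  set D : ℝ → ℝ → ℝ := fun s ξ =>
    Real.exp (-C * s) * (((k : ℝ) + 1) * modeRate K C δ φ φ' (u s) k ξ) with hD
  set A := 2 * K * B + (B' + B * (2 * δ)) + C * B with hA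
  have hB0 : 0 ≤ B := (hφ.pos 0 le_rfl).le.trans (hφ.le 0 le_rfl)
  have hB'0 : 0 ≤ B' := by
    have h1 := hφ.pos 0 le_rfl
    exact (le_trans (by positivity) (hφ.le_deriv 0 le_rfl)).trans (hφ.deriv_le 0 le_rfl)
  have hA0 : 0 ≤ A := by positivity
  have hexp : ∀ s, 0 ≤ s → Real.exp (-C * s) ≤ 1 := fun s hs =>
    Real.exp_le_one_iff.2 (by have := mul_nonneg hC hs; linarith)
  -- The speed is `k + 1`, and `q` omits the weight `1/(k + 1)` of the energy. Hence the source has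
  -- a factor `k + 1`, and the final division leaves the boundary flux with coefficient 1.
  have key := transport_identity (q := q) (D := D) (b := fun ξ => (B + ((k : ℝ) + 1) * A) * W ξ)
    hk ht (by simp only [Function.uncurry_def, hq]; fun_prop)
    (by simp only [Function.uncurry_def, hD]; fun_prop) (hWi.const_mul _)
    (fun s hs ξ hξ => by
      have h1 := hφ.pos ξ (le_of_lt hξ)
      have h2 := hφ.le ξ (le_of_lt hξ)
      have h3 : 0 ≤ W ξ := by have := cutoffBase_pos hδ.le k ξ; positivity
      have h4 : ‖u s (k + 1) ξ‖ ^ 2 ≤ 1 := pow_le_one₀ (norm_nonneg _) (hu.norm_le_one _ _ _)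
      simp only [hq]
      rw [Real.norm_of_nonneg (by positivity)]
      calc _ ≤ 1 * (1 * (B * W ξ)) := by gcongr; exact hexp s hs
        _ ≤ B * W ξ + ((k : ℝ) + 1) * A * W ξ := by
          rw [one_mul, one_mul]
          exact le_add_of_nonneg_right (by positivity)
        _ = _ := by ring)
    (fun s hs ξ hξ => by
      have h1 := abs_modeRate_le hK hC hlam hδ.le hφ (hu.norm_le_one s) (le_of_lt hξ) k
      have h3 : 0 ≤ W ξ := by have := cutoffBase_pos hδ.le k ξ; positivity
      rw [norm_mul, norm_mul, Real.norm_of_nonneg (Real.exp_pos _).le, Real.norm_of_nonneg hk.le,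
        Real.norm_eq_abs]
      calc _ ≤ 1 * (((k : ℝ) + 1) * (A * W ξ)) := by gcongr; exact hexp s hs
        _ ≤ B * W ξ + ((k : ℝ) + 1) * A * W ξ := by
          rw [one_mul, ← mul_assoc]
          exact le_add_of_nonneg_left (by positivity)
        _ = _ := by ring)
    (fun ζ s hs hpos => by
      have hline : HasDerivAt (fun r : ℝ => ζ - ((k : ℝ) + 1) * r) (-((k : ℝ) + 1)) s := by
        simpa using ((hasDerivAt_id s).const_mul ((k : ℝ) + 1)).const_sub ζ
      have d1 := hu.hasDerivAt (k + 1) ζ s hs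
      push_cast at d1
      have d2 := d1.norm_sq
      have d3 : HasDerivAt (fun r => φ (ζ - ((k : ℝ) + 1) * r)) _ s :=
        HasDerivAt.comp (h₂ := φ) s (hφ.hasDerivAt (ζ - ((k : ℝ) + 1) * s)) hline
      have d4 : HasDerivAt (fun r => W (ζ - ((k : ℝ) + 1) * r)) _ s :=
        HasDerivAt.comp (h₂ := W) s (hasDerivAt_inv_cutoffBase_sq hδ.le k hpos) hline
      have d5 : HasDerivAt (fun r : ℝ => Real.exp (-C * r)) (Real.exp (-C * s) * -C) s := by
        simpa using ((hasDerivAt_id s).const_mul (-C)).exp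
      refine (d5.mul (d2.mul (d3.mul d4))).congr_deriv ?_
      have hX := (cutoffBase_pos hδ.le k (ζ - ((k : ℝ) + 1) * s)).ne'
      simp only [hD, modeRate, hW, Pi.mul_apply]
      field_simp
      ring)
  have e1 : ∀ s, ∫ ξ in Ioi (0 : ℝ), q s ξ = Real.exp (-C * s) * modeEnergy δ φ (u s) k := by
    intro s
    rw [modeEnergy, ← integral_const_mul]
  have e2 : ∀ s, ∫ ξ in Ioi (0 : ℝ), D s ξ = ((k : ℝ) + 1) * (Real.exp (-C * s) *
        ∫ ξ in Ioi (0 : ℝ), modeRate K C δ φ φ' (u s) k ξ) := by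
    intro s
    simp only [hD]
    rw [integral_const_mul, integral_const_mul]
    ring
  have e3 : ∀ s, q s 0 = Real.exp (-C * s) * (‖u s (k + 1) 0‖ ^ 2 * ((1 + δ * k) ^ 2)⁻¹) := by
    intro s
    simp [hq, hW, hφ.apply_zero, cutoffBase]
  simp_rw [e1, e2, e3] at key
  rw [intervalIntegral.integral_const_mul] at key
  simp only [mul_zero, Real.exp_zero, one_mul] at key
  generalize (∫ s in (0 : ℝ)..t,
    Real.exp (-C * s) * (‖u s (k + 1) 0‖ ^ 2 * ((1 + δ * k) ^ 2)⁻¹)) = I₁ at key ⊢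
  generalize (∫ s in (0 : ℝ)..t, Real.exp (-C * s) *
    ∫ ξ in Ioi (0 : ℝ), modeRate K C δ φ φ' (u s) k ξ) = I₂ at key ⊢
  generalize Real.exp (-C * t) = E at key ⊢
  field_simp
  linarith

theorem continuous_setIntegral_of_dominated {f : ℝ → ℝ → ℝ} (hf : Continuous (Function.uncurry f))
    {b : ℝ → ℝ} (hb : IntegrableOn b (Ioi 0)) (h : ∀ s, ∀ ξ > 0, ‖f s ξ‖ ≤ b ξ) :
    Continuous (fun s => ∫ ξ in Ioi (0 : ℝ), f s ξ) ∧ ∀ s, IntegrableOn (f s) (Ioi 0) := by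
  have hm : ∀ s, AEStronglyMeasurable (f s) (volume.restrict (Ioi 0)) := fun s =>
    (hf.comp (Continuous.prodMk_right s)).aestronglyMeasurable
  have hae : ∀ s, ∀ᵐ ξ ∂volume.restrict (Ioi 0), ‖f s ξ‖ ≤ b ξ := fun s =>
    (ae_restrict_iff' measurableSet_Ioi).2 (ae_of_all _ fun ξ hξ => h s ξ hξ)
  exact ⟨continuous_of_dominated hm hae hb
    (ae_of_all _ fun ξ => hf.comp (Continuous.prodMk_left ξ)),
    fun s => Integrable.mono' hb (hm s) (hae s)⟩

theorem IsMildFamily.continuous_modeCutoffError {K lam B B' : ℝ} {G : ℝ → ℂ}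
    {u : ℝ → ℤ → ℝ → ℂ} (h : IsMildFamily K G u) {φ φ' : ℝ → ℝ}
    (hφ : IsEnergyWeight lam B B' G φ φ') (C : ℝ) {δ : ℝ} (hδ : 0 ≤ δ) (k : ℕ) :
    Continuous fun p : ℝ × ℝ => modeCutoffError K C δ φ (u p.1) k p.2 := by
  have h2 := h.continuous (k + 1)
  have h3 := hφ.continuous
  have h5 : Continuous fun p : ℝ × ℝ => (cutoffBase δ k p.2 ^ 2)⁻¹ :=
    Continuous.inv₀ (by fun_prop) fun p => (pow_pos (cutoffBase_pos hδ k _) 2).ne'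
  have h6 : Continuous fun p : ℝ × ℝ => (cutoffBase δ k p.2 ^ 3)⁻¹ :=
    Continuous.inv₀ (by fun_prop) fun p => (pow_pos (cutoffBase_pos hδ k _) 3).ne'
  unfold modeCutoffError
  fun_prop

theorem abs_modeCutoffError_le {K C lam B B' δ : ℝ} (hK : 0 ≤ K) (hC : 0 ≤ C) (hδ : 0 ≤ δ)
    {G : ℝ → ℂ} {φ φ' : ℝ → ℝ} (hφ : IsEnergyWeight lam B B' G φ φ') {u : ℤ → ℝ → ℂ}
    (hu : ∀ l ξ, ‖u l ξ‖ ≤ 1) {ξ : ℝ} (hξ : 0 ≤ ξ) (k : ℕ) :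
    |modeCutoffError K C δ φ u k ξ| ≤
      ((2 + 4 * K) * (B * δ) + C * B) * (cutoffBase δ k ξ ^ 2)⁻¹ := by
  have hX0 := cutoffBase_pos hδ k ξ
  have hX3 := inv_cutoffBase_pow_three_le hδ k ξ
  set W := (cutoffBase δ k ξ ^ 2)⁻¹ with hW
  have hW0 : 0 ≤ W := by positivity
  have hφ0 := hφ.pos ξ hξ
  have hB := hφ.le ξ hξ
  have hB0 : 0 ≤ B := hφ0.le.trans hB
  have ha : ‖u (k + 1) ξ‖ ^ 2 ≤ 1 := pow_le_one₀ (norm_nonneg _) (hu _ _)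
  have hk : 0 < (k : ℝ) + 1 := by positivity
  have hCk : C / (k + 1) ≤ C := div_le_self hC (by linarith [(Nat.cast_nonneg k : (0 : ℝ) ≤ k)])
  have hCk0 : 0 ≤ C / (k + 1) := by positivity
  rw [modeCutoffError, abs_mul, abs_of_nonneg (a := ‖u (k + 1) ξ‖ ^ 2) (by positivity)]
  calc _ ≤ ((2 + 4 * K) * (B * (δ * W)) + C * (B * W)) * 1 := by
        refine mul_le_mul ?_ ha (by positivity) (by positivity)
        rw [← Real.norm_eq_abs]
        refine (norm_sub_le _ _).trans ?_
        rw [Real.norm_of_nonneg (by positivity), Real.norm_of_nonneg (by positivity)]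
        gcongr
    _ = _ := by ring

theorem IsMildFamily.integral_cutoffError {K C lam B B' δ : ℝ} (hK : 0 ≤ K) (hC : 0 ≤ C)
    (hδ : 0 < δ) {G : ℝ → ℂ} {φ φ' : ℝ → ℝ}
    (hφ : IsEnergyWeight lam B B' G φ φ') {u : ℝ → ℤ → ℝ → ℂ} (hu : IsMildFamily K G u) (n : ℕ) :
    Continuous (fun s => ∫ ξ in Ioi (0 : ℝ), cutoffError K C δ φ (u s) n ξ) ∧
      ∀ s, IntegrableOn (cutoffError K C δ φ (u s) n) (Ioi 0) := by
  refine continuous_setIntegral_of_dominated (f := fun s => cutoffError K C δ φ (u s) n)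
    (b := fun ξ => ∑ k ∈ Finset.range (n + 1),
      ((2 + 4 * K) * (B * δ) + C * B) * (cutoffBase δ k ξ ^ 2)⁻¹) ?_ ?_ fun s ξ hξ => ?_
  · simp only [Function.uncurry_def, cutoffError]
    exact continuous_finsetSum _ fun k _ => hu.continuous_modeCutoffError hφ C hδ.le k
  · exact integrable_finsetSum _ fun k _ => (integral_inv_cutoffBase_sq hδ k).1.const_mul _
  · exact (norm_sum_le _ _).trans (Finset.sum_le_sum fun k _ =>
      abs_modeCutoffError_le hK hC hδ.le hφ (hu.norm_le_one s) (le_of_lt hξ) k)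

theorem IsMildFamily.integral_modeRate_continuous {K C lam B B' δ : ℝ} (hK : 0 ≤ K) (hC : 0 ≤ C)
    (hlam : 0 ≤ lam) (hδ : 0 < δ) {G : ℝ → ℂ} {φ φ' : ℝ → ℝ}
    (hφ : IsEnergyWeight lam B B' G φ φ') {u : ℝ → ℤ → ℝ → ℂ} (hu : IsMildFamily K G u) (k : ℕ) :
    Continuous (fun s => ∫ ξ in Ioi (0 : ℝ), modeRate K C δ φ φ' (u s) k ξ) ∧
      ∀ s, IntegrableOn (modeRate K C δ φ φ' (u s) k) (Ioi 0) :=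
  continuous_setIntegral_of_dominated (f := fun s => modeRate K C δ φ φ' (u s) k)
    (hu.continuous_modeRate hφ C hδ.le k) ((integral_inv_cutoffBase_sq hδ k).1.const_mul _)
    fun s _ hξ => abs_modeRate_le hK hC hlam hδ.le hφ (hu.norm_le_one s) (le_of_lt hξ) k

/-- The energy inequality for finitely many modes and a cut off weight. -/
theorem truncated_energy_le {K C lam B B' δ t : ℝ} (hK : 0 ≤ K) (hC : 0 ≤ C) (hlam : 0 < lam)
    (hδ : 0 < δ) (hδ1 : δ ≤ 1) (ht : 0 ≤ t) {G : ℝ → ℂ} (hG : IntegrableOn G (Ioi 0))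
    {φ φ' : ℝ → ℝ} (hφ : IsEnergyWeight lam B B' G φ φ')
    {u : ℝ → ℤ → ℝ → ℂ} (hu : IsMildFamily K G u) (n : ℕ) :
    Real.exp (-C * t) * ∑ k ∈ Finset.range (n + 1), 1 / ((k : ℝ) + 1) * modeEnergy δ φ (u t) k
      + (1 - K ^ 2 / (4 * lam) * ∫ ξ in Ioi (0 : ℝ), ‖G ξ‖)
        * ∫ s in (0 : ℝ)..t, Real.exp (-C * s) * ‖u s 1 0‖ ^ 2 ≤
    ∑ k ∈ Finset.range (n + 1), 1 / ((k : ℝ) + 1) * modeEnergy δ φ (u 0) k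
      + K * B * (δ * (1 + δ * n))⁻¹ * t
      + ∫ s in (0 : ℝ)..t, Real.exp (-C * s) *
        ∫ ξ in Ioi (0 : ℝ), cutoffError K C δ φ (u s) n ξ := by
  set M := ∫ ξ in Ioi (0 : ℝ), ‖G ξ‖ with hM
  set A := K * B * (δ * (1 + δ * n))⁻¹ with hA
  have hB0 : 0 ≤ B := (hφ.pos 0 le_rfl).le.trans (hφ.le 0 le_rfl)
  have hA0 : 0 ≤ A := by positivity
  have hexpc : Continuous fun s => Real.exp (-C * s) := by fun_prop
  have hηc : Continuous fun s => u s 1 0 := (hu.continuous 1).comp (Continuous.prodMk_left 0)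
  obtain ⟨hEc, hEi⟩ := hu.integral_cutoffError hK hC hδ hφ n
  have hR := fun k => hu.integral_modeRate_continuous hK hC hlam.le hδ hφ k
  have hid := Finset.sum_congr (rfl : Finset.range (n + 1) = _)
    fun k _ => modeEnergy_identity hK hC hlam.le hδ ht hφ hu k
  rw [Finset.sum_add_distrib, Finset.sum_add_distrib, ← Finset.mul_sum,
    ← intervalIntegral.integral_finsetSum
      (f := fun k s => Real.exp (-C * s) * ∫ ξ in Ioi (0 : ℝ), modeRate K C δ φ φ' (u s) k ξ)
      (fun k _ => (hexpc.mul (hR k).1).intervalIntegrable _ _)] at hid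
  -- Only the flux of the mode `k = 0` is kept. Its cutoff factor at `ξ = 0` is exactly 1, and for a
  -- solution its value there is `η`.
  have hbdry : ∫ s in (0 : ℝ)..t, Real.exp (-C * s) * ‖u s 1 0‖ ^ 2 ≤
      ∑ k ∈ Finset.range (n + 1), ∫ s in (0 : ℝ)..t,
        Real.exp (-C * s) * (‖u s (k + 1) 0‖ ^ 2 * ((1 + δ * k) ^ 2)⁻¹) := by
    have h := Finset.single_le_sum (s := Finset.range (n + 1)) (a := 0)
      (f := fun k : ℕ => ∫ s in (0 : ℝ)..t,
        Real.exp (-C * s) * (‖u s (k + 1) 0‖ ^ 2 * ((1 + δ * k) ^ 2)⁻¹))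
      (fun k _ => intervalIntegral.integral_nonneg ht fun s _ => by positivity) (by simp)
    simpa using h
  have hpt : ∀ s, 0 ≤ s → ∑ k ∈ Finset.range (n + 1), Real.exp (-C * s) *
      ∫ ξ in Ioi (0 : ℝ), modeRate K C δ φ φ' (u s) k ξ ≤
      K ^ 2 / (4 * lam) * M * (Real.exp (-C * s) * ‖u s 1 0‖ ^ 2) + A
        + Real.exp (-C * s) * ∫ ξ in Ioi (0 : ℝ), cutoffError K C δ φ (u s) n ξ := by
    intro s hs
    obtain ⟨hWi, hWint⟩ := integral_inv_cutoffBase_sq hδ n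
    have hGi : IntegrableOn (fun ξ => K ^ 2 / (4 * lam) * ‖u s 1 0‖ ^ 2 * ‖G ξ‖) (Ioi 0) :=
      hG.norm.const_mul _
    have hWi' : IntegrableOn (fun ξ => K * B * (cutoffBase δ n ξ ^ 2)⁻¹) (Ioi 0) :=
      hWi.const_mul _
    have h1 : ∑ k ∈ Finset.range (n + 1), ∫ ξ in Ioi (0 : ℝ), modeRate K C δ φ φ' (u s) k ξ ≤
        K ^ 2 / (4 * lam) * ‖u s 1 0‖ ^ 2 * M + A
          + ∫ ξ in Ioi (0 : ℝ), cutoffError K C δ φ (u s) n ξ := by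
      rw [← integral_finsetSum _ fun k _ => (hR k).2 s]
      calc _ ≤ ∫ ξ in Ioi (0 : ℝ), (K ^ 2 / (4 * lam) * ‖u s 1 0‖ ^ 2 * ‖G ξ‖
              + K * B * (cutoffBase δ n ξ ^ 2)⁻¹ + cutoffError K C δ φ (u s) n ξ) :=
            setIntegral_mono_on (integrable_finsetSum _ fun k _ => (hR k).2 s)
              ((hGi.add hWi').add (hEi s)) measurableSet_Ioi fun ξ hξ =>
              sum_modeRate_le hK hlam hδ.le hδ1 hφ (hu.norm_le_one s) (le_of_lt hξ)
                (hu.zero_mode s ξ) n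
        _ = _ := by
            have e1 := integral_add (hGi.add hWi') (hEi s)
            have e2 := integral_add hGi hWi'
            simp only [Pi.add_apply] at e1 e2
            rw [e1, e2, integral_const_mul, integral_const_mul, hWint]
    have hexp : Real.exp (-C * s) ≤ 1 :=
      Real.exp_le_one_iff.2 (by have := mul_nonneg hC hs; linarith)
    have h2 := mul_le_mul_of_nonneg_left h1 (Real.exp_pos (-C * s)).le
    have h3 : Real.exp (-C * s) * A ≤ 1 * A := mul_le_mul_of_nonneg_right hexp hA0
    rw [← Finset.mul_sum]
    linarith
  have hint := intervalIntegral.integral_mono_on ht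
    ((continuous_finsetSum _ fun k _ => hexpc.mul (hR k).1).intervalIntegrable _ _)
    (μ := volume) (b := t) (a := 0)
    (f := fun s => ∑ k ∈ Finset.range (n + 1), Real.exp (-C * s) *
      ∫ ξ in Ioi (0 : ℝ), modeRate K C δ φ φ' (u s) k ξ)
    (g := fun s => K ^ 2 / (4 * lam) * M * (Real.exp (-C * s) * ‖u s 1 0‖ ^ 2) + A
        + Real.exp (-C * s) * ∫ ξ in Ioi (0 : ℝ), cutoffError K C δ φ (u s) n ξ)
    (Continuous.intervalIntegrable (by fun_prop) _ _)
    fun s hs => hpt s hs.1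
  have hsplit : ∫ s in (0 : ℝ)..t, (K ^ 2 / (4 * lam) * M * (Real.exp (-C * s) * ‖u s 1 0‖ ^ 2) + A
        + Real.exp (-C * s) * ∫ ξ in Ioi (0 : ℝ), cutoffError K C δ φ (u s) n ξ) =
      K ^ 2 / (4 * lam) * M * (∫ s in (0 : ℝ)..t, Real.exp (-C * s) * ‖u s 1 0‖ ^ 2) + A * t
        + ∫ s in (0 : ℝ)..t, Real.exp (-C * s) *
          ∫ ξ in Ioi (0 : ℝ), cutoffError K C δ φ (u s) n ξ := by
    rw [intervalIntegral.integral_add (Continuous.intervalIntegrable (by fun_prop) _ _)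
      (Continuous.intervalIntegrable (by fun_prop) _ _),
      intervalIntegral.integral_add (Continuous.intervalIntegrable (by fun_prop) _ _)
      (Continuous.intervalIntegrable (by fun_prop) _ _), intervalIntegral.integral_const_mul,
      intervalIntegral.integral_const, sub_zero, smul_eq_mul, mul_comm t A]
  rw [hsplit] at hint
  linarith

/-! ### Removing the cutoff: the energy with values in `[0, ∞]` -/

/-- The energy density of the mode `k + 1`. -/
def modeDensity (φ : ℝ → ℝ) (u : ℤ → ℝ → ℂ) (k : ℕ) (ξ : ℝ) : ℝ≥0∞ :=
  ENNReal.ofReal (1 / ((k : ℝ) + 1) * ‖u ((k : ℤ) + 1) ξ‖ ^ 2 * φ ξ)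

/-- The energy of a family of modes. -/
def modesEnergy (φ : ℝ → ℝ) (u : ℤ → ℝ → ℂ) : ℝ≥0∞ :=
  ∫⁻ ξ in Ioi (0 : ℝ), ∑' k : ℕ, modeDensity φ u k ξ

theorem continuous_modeDensity {φ : ℝ → ℝ} (hφ : Continuous φ) {u : ℤ → ℝ → ℂ} {k : ℕ}
    (hu : Continuous (u (k + 1))) : Continuous (modeDensity φ u k) := by
  unfold modeDensity
  exact ENNReal.continuous_ofReal.comp (by fun_prop)

theorem modesEnergy_eq_tsum {φ : ℝ → ℝ} (hφ : Continuous φ) {u : ℤ → ℝ → ℂ}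
    (hu : ∀ l, Continuous (u l)) :
    modesEnergy φ u = ∑' k : ℕ, ∫⁻ ξ in Ioi (0 : ℝ), modeDensity φ u k ξ :=
  lintegral_tsum fun _ => (continuous_modeDensity hφ (hu _)).aemeasurable

/-- The cutoff scales. -/
def cutoffScale (m : ℕ) : ℝ := 1 / ((m : ℝ) + 1)

theorem cutoffScale_pos (m : ℕ) : 0 < cutoffScale m := by unfold cutoffScale; positivity

theorem cutoffScale_le_one (m : ℕ) : cutoffScale m ≤ 1 := by
  unfold cutoffScale
  rw [div_le_one (by positivity)]
  linarith [(Nat.cast_nonneg m : (0 : ℝ) ≤ m)]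

theorem tendsto_cutoffScale : Tendsto cutoffScale atTop (𝓝 0) :=
  tendsto_one_div_add_atTop_nhds_zero_nat

theorem cutoffScale_antitone : Antitone cutoffScale := fun m n h => by
  unfold cutoffScale
  gcongr

theorem integrableOn_modeEnergy {lam B B' δ : ℝ} (hδ : 0 < δ) {G : ℝ → ℂ} {φ φ' : ℝ → ℝ}
    (hφ : IsEnergyWeight lam B B' G φ φ') {u : ℤ → ℝ → ℂ} (hu : ∀ l, Continuous (u l))
    (hu1 : ∀ l ξ, ‖u l ξ‖ ≤ 1) (k : ℕ) :
    IntegrableOn (fun ξ => ‖u (k + 1) ξ‖ ^ 2 * (φ ξ * (cutoffBase δ k ξ ^ 2)⁻¹)) (Ioi 0) := by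
  have hW : Continuous fun ξ => (cutoffBase δ k ξ ^ 2)⁻¹ :=
    Continuous.inv₀ (by fun_prop) fun p => (pow_pos (cutoffBase_pos hδ.le k _) 2).ne'
  have h1 := hu (k + 1)
  have h2 := hφ.continuous
  refine Integrable.mono' ((integral_inv_cutoffBase_sq hδ k).1.const_mul B)
    (Continuous.aestronglyMeasurable (by fun_prop))
    ((ae_restrict_iff' measurableSet_Ioi).2 (ae_of_all _ fun ξ hξ => ?_))
  have h3 := hφ.pos ξ (le_of_lt hξ)
  have h4 := hφ.le ξ (le_of_lt hξ)
  have h5 : ‖u (k + 1) ξ‖ ^ 2 ≤ 1 := pow_le_one₀ (norm_nonneg _) (hu1 _ _)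
  have h6 := cutoffBase_pos hδ.le k ξ
  rw [Real.norm_of_nonneg (by positivity)]
  calc _ ≤ 1 * (B * (cutoffBase δ k ξ ^ 2)⁻¹) := by gcongr
    _ = _ := one_mul _

theorem ofReal_modeEnergy {lam B B' δ : ℝ} (hδ : 0 < δ) {G : ℝ → ℂ} {φ φ' : ℝ → ℝ}
    (hφ : IsEnergyWeight lam B B' G φ φ') {u : ℤ → ℝ → ℂ} (hu : ∀ l, Continuous (u l))
    (hu1 : ∀ l ξ, ‖u l ξ‖ ≤ 1) (k : ℕ) :
    ENNReal.ofReal (1 / ((k : ℝ) + 1) * modeEnergy δ φ u k) =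
      ∫⁻ ξ in Ioi (0 : ℝ), ENNReal.ofReal ((cutoffBase δ k ξ ^ 2)⁻¹) * modeDensity φ u k ξ := by
  rw [modeEnergy, ← integral_const_mul, ofReal_integral_eq_lintegral_ofReal
    ((integrableOn_modeEnergy hδ hφ hu hu1 k).const_mul _)
    ((ae_restrict_iff' measurableSet_Ioi).2 (ae_of_all _ fun ξ hξ => ?_))]
  · refine lintegral_congr fun ξ => ?_
    have h6 := cutoffBase_pos hδ.le k ξ
    rw [modeDensity, ← ENNReal.ofReal_mul (by positivity)]
    congr 1
    ring
  · have h3 := hφ.pos ξ (le_of_lt hξ)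
    have h6 := cutoffBase_pos hδ.le k ξ
    simp only [Pi.zero_apply]
    positivity

theorem ofReal_modeEnergy_le {lam B B' δ : ℝ} (hδ : 0 < δ) {G : ℝ → ℂ} {φ φ' : ℝ → ℝ}
    (hφ : IsEnergyWeight lam B B' G φ φ') {u : ℤ → ℝ → ℂ} (hu : ∀ l, Continuous (u l))
    (hu1 : ∀ l ξ, ‖u l ξ‖ ≤ 1) (k : ℕ) :
    ENNReal.ofReal (1 / ((k : ℝ) + 1) * modeEnergy δ φ u k) ≤
      ∫⁻ ξ in Ioi (0 : ℝ), modeDensity φ u k ξ := by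
  rw [ofReal_modeEnergy hδ hφ hu hu1]
  refine lintegral_mono fun ξ => ?_
  have h : (cutoffBase δ k ξ ^ 2)⁻¹ ≤ 1 :=
    inv_le_one_of_one_le₀ (one_le_pow₀ (one_le_cutoffBase hδ.le k ξ))
  calc _ ≤ 1 * modeDensity φ u k ξ := by
        gcongr
        exact ENNReal.ofReal_le_one.2 h
    _ = _ := one_mul _

/-- The cutoff factors increase to 1 as the scale decreases, so this is monotone convergence, valid
also when the limit is infinite. -/
theorem tendsto_ofReal_modeEnergy {lam B B' : ℝ} {G : ℝ → ℂ} {φ φ' : ℝ → ℝ}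
    (hφ : IsEnergyWeight lam B B' G φ φ') {u : ℤ → ℝ → ℂ} (hu : ∀ l, Continuous (u l))
    (hu1 : ∀ l ξ, ‖u l ξ‖ ≤ 1) (k : ℕ) :
    Tendsto (fun m => ENNReal.ofReal (1 / ((k : ℝ) + 1) * modeEnergy (cutoffScale m) φ u k)) atTop
      (𝓝 (∫⁻ ξ in Ioi (0 : ℝ), modeDensity φ u k ξ)) := by
  simp_rw [ofReal_modeEnergy (cutoffScale_pos _) hφ hu hu1]
  have hWc : ∀ m, Continuous fun ξ => ENNReal.ofReal ((cutoffBase (cutoffScale m) k ξ ^ 2)⁻¹) :=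
    fun m => ENNReal.continuous_ofReal.comp (Continuous.inv₀ (by fun_prop) fun p =>
      (pow_pos (cutoffBase_pos (cutoffScale_pos m).le k _) 2).ne')
  have hd := continuous_modeDensity hφ.continuous (k := k) (hu (k + 1))
  refine lintegral_tendsto_of_tendsto_of_monotone
    (fun m => ((hWc m).measurable.mul hd.measurable).aemeasurable)
    (ae_of_all _ fun ξ m n hmn => ?_) (ae_of_all _ fun ξ => ?_)
  · have h1 := cutoffScale_antitone hmn
    have h2 := cutoffBase_pos (cutoffScale_pos n).le k ξ
    have h3 : 0 ≤ max ξ 0 + k := add_nonneg (le_max_right _ _) (Nat.cast_nonneg _)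
    have h4 : cutoffBase (cutoffScale n) k ξ ≤ cutoffBase (cutoffScale m) k ξ := by
      unfold cutoffBase
      gcongr
    dsimp only
    gcongr
  · have h1 : Tendsto (fun m => (cutoffBase (cutoffScale m) k ξ ^ 2)⁻¹) atTop (𝓝 1) := by
      have h2 : Tendsto (fun m => cutoffBase (cutoffScale m) k ξ) atTop (𝓝 1) := by
        have := (tendsto_cutoffScale.mul_const (max ξ 0 + (k : ℝ))).const_add 1
        simpa [cutoffBase] using this
      simpa using (h2.pow 2).inv₀ (by norm_num)
    have h3 := ENNReal.Tendsto.mul_const (b := modeDensity φ u k ξ)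
      ((ENNReal.continuous_ofReal.tendsto 1).comp h1) (Or.inr ENNReal.ofReal_ne_top)
    simpa using h3

/-- The number of retained modes varies with the cutoff. Keeping only a fixed number `N` of them,
one lets `δ → 0` mode by mode and sends `N` to infinity last. -/
theorem modesEnergy_add_le_of_truncated {lam B B' : ℝ} {G : ℝ → ℂ} {φ φ' : ℝ → ℝ}
    (hφ : IsEnergyWeight lam B B' G φ φ') {u : ℤ → ℝ → ℂ} (hu : ∀ l, Continuous (u l))
    (hu1 : ∀ l ξ, ‖u l ξ‖ ≤ 1) {n : ℕ → ℕ} (hn : Tendsto n atTop atTop) {r : ℕ → ℝ≥0∞}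
    {R D : ℝ≥0∞} (hr : Tendsto r atTop (𝓝 R))
    (h : ∀ m, (∑ k ∈ Finset.range (n m + 1),
      ENNReal.ofReal (1 / ((k : ℝ) + 1) * modeEnergy (cutoffScale m) φ u k)) + D ≤ r m) :
    modesEnergy φ u + D ≤ R := by
  rw [modesEnergy_eq_tsum hφ.continuous hu]
  have h1 : ∀ N, (∑ k ∈ Finset.range N, ∫⁻ ξ in Ioi (0 : ℝ), modeDensity φ u k ξ) + D ≤ R := by
    intro N
    have h2 := (tendsto_finsetSum (Finset.range N)
      fun k _ => tendsto_ofReal_modeEnergy hφ hu hu1 k).add_const D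
    refine le_of_tendsto_of_tendsto h2 hr ?_
    filter_upwards [hn.eventually_ge_atTop N] with m hm
    refine le_trans ?_ (h m)
    gcongr
    omega
  exact le_of_tendsto' ((ENNReal.tendsto_nat_tsum _).add_const D) h1

theorem sum_ofReal_modeEnergy_le {lam B B' δ : ℝ} (hδ : 0 < δ) {G : ℝ → ℂ} {φ φ' : ℝ → ℝ}
    (hφ : IsEnergyWeight lam B B' G φ φ') {u : ℤ → ℝ → ℂ} (hu : ∀ l, Continuous (u l))
    (hu1 : ∀ l ξ, ‖u l ξ‖ ≤ 1) (n : ℕ) :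
    ∑ k ∈ Finset.range n, ENNReal.ofReal (1 / ((k : ℝ) + 1) * modeEnergy δ φ u k) ≤
      modesEnergy φ u := by
  rw [modesEnergy_eq_tsum hφ.continuous hu]
  exact (Finset.sum_le_sum fun k _ => ofReal_modeEnergy_le hδ hφ hu hu1 k).trans
    (ENNReal.sum_le_tsum _)

theorem modeEnergy_nonneg {lam B B' δ : ℝ} {G : ℝ → ℂ} {φ φ' : ℝ → ℝ}
    (hφ : IsEnergyWeight lam B B' G φ φ') (u : ℤ → ℝ → ℂ) (k : ℕ) : 0 ≤ modeEnergy δ φ u k :=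
  setIntegral_nonneg measurableSet_Ioi fun ξ hξ => by
    have := hφ.pos ξ (le_of_lt hξ)
    positivity

/-- With `δ = 1/(m + 1)` and `n = (m + 1)^3`, the quantity `δ (1 + δ n)` equals `δ + (m + 1)`, which
diverges. Three is the smallest integer exponent for which it does. -/
theorem tendsto_truncation_error (A t : ℝ) :
    Tendsto (fun m => ENNReal.ofReal
      (A * (cutoffScale m * (1 + cutoffScale m * ((m + 1) ^ 3 : ℕ)))⁻¹ * t)) atTop (𝓝 0) := by
  have h1 : ∀ m : ℕ, (cutoffScale m * (1 + cutoffScale m * ((m + 1) ^ 3 : ℕ)))⁻¹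
      ≤ cutoffScale m := by
    intro m
    have hm : 0 < (m : ℝ) + 1 := by positivity
    have e : cutoffScale m * (1 + cutoffScale m * ((m + 1) ^ 3 : ℕ))
        = cutoffScale m + ((m : ℝ) + 1) := by
      unfold cutoffScale
      push_cast
      field_simp
    rw [e]
    calc _ ≤ ((m : ℝ) + 1)⁻¹ := inv_anti₀ hm (le_add_of_nonneg_left (cutoffScale_pos m).le)
      _ = _ := by rw [cutoffScale, one_div]
  have h0 : ∀ m : ℕ, 0 ≤ (cutoffScale m * (1 + cutoffScale m * ((m + 1) ^ 3 : ℕ)))⁻¹ := by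
    intro m
    have := cutoffScale_pos m
    positivity
  have h2 := squeeze_zero h0 h1 tendsto_cutoffScale
  have h3 := (h2.const_mul A).mul_const t
  simp only [mul_zero, zero_mul] at h3
  have h4 := (ENNReal.continuous_ofReal.tendsto 0).comp h3
  rw [ENNReal.ofReal_zero] at h4
  exact h4

theorem ofReal_sum_modeEnergy {lam B B' δ : ℝ} {G : ℝ → ℂ} {φ φ' : ℝ → ℝ}
    (hφ : IsEnergyWeight lam B B' G φ φ') (u : ℤ → ℝ → ℂ) (n : ℕ) :
    ENNReal.ofReal (∑ k ∈ Finset.range n, 1 / ((k : ℝ) + 1) * modeEnergy δ φ u k) =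
      ∑ k ∈ Finset.range n, ENNReal.ofReal (1 / ((k : ℝ) + 1) * modeEnergy δ φ u k) :=
  ENNReal.ofReal_sum_of_nonneg fun k _ => mul_nonneg (by positivity) (modeEnergy_nonneg hφ u k)

theorem tendsto_nat_pow_three : Tendsto (fun m : ℕ => (m + 1) ^ 3) atTop atTop :=
  tendsto_atTop_mono (fun m => (Nat.le_succ m).trans (Nat.le_self_pow (by norm_num) _)) tendsto_id

/-! ### A priori bound and energy inequality -/

/-- A priori bound: the energy grows at most exponentially. -/
theorem modesEnergy_le_exp_mul {K lam B B' t : ℝ} (hK : 0 ≤ K) (hlam : 0 < lam) (ht : 0 ≤ t)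
    {G : ℝ → ℂ} (hG : IntegrableOn G (Ioi 0))
    (hc : 0 ≤ 1 - K ^ 2 / (4 * lam) * ∫ ξ in Ioi (0 : ℝ), ‖G ξ‖)
    {φ φ' : ℝ → ℝ} (hφ : IsEnergyWeight lam B B' G φ φ')
    {u : ℝ → ℤ → ℝ → ℂ} (hu : IsMildFamily K G u) :
    modesEnergy φ (u t) ≤ ENNReal.ofReal (Real.exp ((2 + 4 * K) * t)) * modesEnergy φ (u 0) := by
  have huc : ∀ s l, Continuous (u s l) := fun s l =>
    (hu.continuous l).comp (Continuous.prodMk_right s)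
  set E := ENNReal.ofReal (Real.exp ((2 + 4 * K) * t)) with hE
  set ε : ℕ → ℝ := fun m =>
    K * B * (cutoffScale m * (1 + cutoffScale m * ((m + 1) ^ 3 : ℕ)))⁻¹ * t with hε
  have hlim : Tendsto (fun m => E * (modesEnergy φ (u 0) + ENNReal.ofReal (ε m))) atTop
      (𝓝 (E * modesEnergy φ (u 0))) := by
    have h1 := (tendsto_truncation_error (K * B) t).const_add (modesEnergy φ (u 0))
    rw [add_zero] at h1
    exact ENNReal.Tendsto.const_mul h1 (Or.inr ENNReal.ofReal_ne_top)
  rw [← add_zero (modesEnergy φ (u t))]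
  refine modesEnergy_add_le_of_truncated hφ (huc t) (hu.norm_le_one t) tendsto_nat_pow_three hlim
    fun m => ?_
  have hδ := cutoffScale_pos m
  have hδ1 := cutoffScale_le_one m
  have h1 := truncated_energy_le hK (C := 2 + 4 * K) (by positivity) hlam hδ hδ1 ht hG hφ hu
    ((m + 1) ^ 3)
  -- Since `δ (k + 1) ≤ cutoffBase δ k ξ`, the error density is at most `2 + 4K` times the cut off
  -- energy density itself, so this choice of `C` makes the net error nonpositive.
  have h2 : ∫ s in (0 : ℝ)..t, Real.exp (-(2 + 4 * K) * s) * ∫ ξ in Ioi (0 : ℝ),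
      cutoffError K (2 + 4 * K) (cutoffScale m) φ (u s) ((m + 1) ^ 3) ξ ≤ 0 := by
    rw [intervalIntegral.integral_of_le ht]
    refine integral_nonpos fun s => mul_nonpos_of_nonneg_of_nonpos (Real.exp_pos _).le
      (setIntegral_nonpos measurableSet_Ioi fun ξ hξ => Finset.sum_nonpos fun k _ => ?_)
    refine mul_nonpos_of_nonpos_of_nonneg ?_ (by positivity)
    have hφ0 := hφ.pos ξ (le_of_lt hξ)
    have hX := cutoffBase_pos hδ.le k ξ
    have hX1 : cutoffScale m * (k + 1) ≤ cutoffBase (cutoffScale m) k ξ := by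
      have h3 : 0 ≤ cutoffScale m * max ξ 0 := mul_nonneg hδ.le (le_max_right _ _)
      rw [cutoffBase]
      linarith
    have h4 : cutoffScale m * (cutoffBase (cutoffScale m) k ξ ^ 3)⁻¹
        ≤ 1 / (k + 1) * (cutoffBase (cutoffScale m) k ξ ^ 2)⁻¹ := by
      rw [← one_div, ← one_div, mul_one_div, one_div_mul_one_div, div_le_div_iff₀ (by positivity)
        (by positivity)]
      calc _ = cutoffScale m * (k + 1) * cutoffBase (cutoffScale m) k ξ ^ 2 := by ring
        _ ≤ cutoffBase (cutoffScale m) k ξ * cutoffBase (cutoffScale m) k ξ ^ 2 := by gcongr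
        _ = _ := by ring
    have h5 := mul_le_mul_of_nonneg_left h4 (mul_nonneg (by positivity : 0 ≤ 2 + 4 * K) hφ0.le)
    rw [sub_nonpos]
    calc _ = _ := by ring
      _ ≤ _ := h5
      _ = _ := by ring
  have h3 : 0 ≤ ∫ s in (0 : ℝ)..t, Real.exp (-(2 + 4 * K) * s) * ‖u s 1 0‖ ^ 2 :=
    intervalIntegral.integral_nonneg ht fun s _ => by positivity
  have h4 := mul_nonneg hc h3
  have h5 : ∑ k ∈ Finset.range ((m + 1) ^ 3 + 1),
      1 / ((k : ℝ) + 1) * modeEnergy (cutoffScale m) φ (u t) k ≤ Real.exp ((2 + 4 * K) * t) *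
      (∑ k ∈ Finset.range ((m + 1) ^ 3 + 1),
        1 / ((k : ℝ) + 1) * modeEnergy (cutoffScale m) φ (u 0) k + ε m) := by
    have h6 : Real.exp ((2 + 4 * K) * t) * Real.exp (-(2 + 4 * K) * t) = 1 := by
      rw [← Real.exp_add, neg_mul, add_neg_cancel, Real.exp_zero]
    have h7 := mul_le_mul_of_nonneg_left (le_of_add_le_of_nonneg_left
      (h1.trans (add_le_of_nonpos_right h2)) h4) (Real.exp_pos ((2 + 4 * K) * t)).le
    rwa [← mul_assoc, h6, one_mul] at h7
  rw [add_zero, ← ofReal_sum_modeEnergy hφ]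
  refine (ENNReal.ofReal_le_ofReal h5).trans ?_
  rw [ENNReal.ofReal_mul (Real.exp_pos _).le]
  gcongr
  refine ENNReal.ofReal_add_le.trans ?_
  rw [ofReal_sum_modeEnergy hφ]
  gcongr
  exact sum_ofReal_modeEnergy_le hδ hφ (huc 0) (hu.norm_le_one 0) _

/-- The energy density produced by the cutoff is a small multiple of the energy density. -/
theorem ofReal_modeCutoffError_le {K lam B B' δ : ℝ} (hK : 0 ≤ K) (hδ : 0 ≤ δ) (hδ1 : δ ≤ 1)
    {G : ℝ → ℂ} {φ φ' : ℝ → ℝ} (hφ : IsEnergyWeight lam B B' G φ φ') (u : ℤ → ℝ → ℂ) (k : ℕ) {ξ : ℝ}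
    (hξ : 0 ≤ ξ) :
    ENNReal.ofReal (modeCutoffError K 0 δ φ u k ξ) ≤
      ENNReal.ofReal ((2 + 4 * K) * min (δ * (k + 1)) 1) * modeDensity φ u k ξ := by
  have hφ0 := hφ.pos ξ hξ
  have hX := one_le_cutoffBase hδ k ξ
  have hX0 := cutoffBase_pos hδ k ξ
  have hk : 0 < (k : ℝ) + 1 := by positivity
  have hmin : 0 ≤ min (δ * ((k : ℝ) + 1)) 1 := le_min (by positivity) zero_le_one
  rw [modeDensity, ← ENNReal.ofReal_mul (by positivity)]
  refine ENNReal.ofReal_le_ofReal ?_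
  -- Two bounds are combined: `δ` gives smallness for each fixed mode, and `1/(k + 1)` gives a bound
  -- by the energy density uniformly in `δ`.
  have h1 : δ * (cutoffBase δ k ξ ^ 3)⁻¹ ≤ δ :=
    mul_le_of_le_one_right hδ (inv_le_one_of_one_le₀ (one_le_pow₀ hX))
  have h2 : δ * (cutoffBase δ k ξ ^ 3)⁻¹ ≤ 1 / (k + 1) := by
    have h3 : 0 ≤ δ * max ξ 0 := mul_nonneg hδ (le_max_right _ _)
    have h4 : δ * (k + 1) ≤ cutoffBase δ k ξ := by
      rw [cutoffBase]
      linarith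
    rw [← div_eq_mul_inv, div_le_div_iff₀ (by positivity) hk, one_mul]
    exact h4.trans (le_self_pow₀ hX (by norm_num))
  have h5 : δ * (cutoffBase δ k ξ ^ 3)⁻¹ ≤ min (δ * (k + 1)) 1 * (1 / (k + 1)) := by
    rw [min_mul_of_nonneg _ _ (by positivity), one_mul]
    refine le_min ?_ h2
    rwa [mul_assoc, mul_one_div_cancel hk.ne', mul_one]
  rw [modeCutoffError, zero_div, zero_mul, sub_zero]
  calc _ = (2 + 4 * K) * (φ ξ * ‖u (k + 1) ξ‖ ^ 2) * (δ * (cutoffBase δ k ξ ^ 3)⁻¹) := by ring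
    _ ≤ (2 + 4 * K) * (φ ξ * ‖u (k + 1) ξ‖ ^ 2) * (min (δ * (k + 1)) 1 * (1 / (k + 1))) := by
      gcongr
    _ = _ := by ring

/-- Dominated convergence for series with coefficients that tend to zero. -/
theorem tendsto_tsum_min_mul {b : ℕ → ℝ≥0∞} (hb : ∑' k, b k ≠ ⊤) {A : ℝ} (hA : 0 ≤ A) :
    Tendsto (fun m => ∑' k : ℕ, ENNReal.ofReal (A * min (cutoffScale m * (k + 1)) 1) * b k) atTop
      (𝓝 0) := by
  have h := tendsto_lintegral_of_dominated_convergence (μ := Measure.count)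
    (F := fun m (k : ℕ) => ENNReal.ofReal (A * min (cutoffScale m * (k + 1)) 1) * b k)
    (f := fun _ => 0) (fun k => ENNReal.ofReal A * b k) (fun m => measurable_of_countable _)
    (fun m => ae_of_all _ fun k => ?_) ?_ (ae_of_all _ fun k => ?_)
  · simpa only [lintegral_count, lintegral_zero] using h
  · dsimp only
    gcongr
    exact mul_le_of_le_one_right hA (min_le_right _ _)
  · rw [lintegral_count, ENNReal.tsum_mul_left]
    exact ENNReal.mul_ne_top ENNReal.ofReal_ne_top hb
  · have h1 : Tendsto (fun m => A * min (cutoffScale m * ((k : ℝ) + 1)) 1) atTop (𝓝 0) := by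
      have h2 := ((tendsto_cutoffScale.mul_const ((k : ℝ) + 1)).min
        (tendsto_const_nhds (x := (1 : ℝ)))).const_mul A
      simpa using h2
    have h3 := ENNReal.Tendsto.mul_const (b := b k)
      ((ENNReal.continuous_ofReal.tendsto 0).comp h1) (Or.inr (ENNReal.ne_top_of_tsum_ne_top hb k))
    simpa using h3

theorem IsMildFamily.measurable_lintegral_modeDensity {K : ℝ} {G : ℝ → ℂ} {u : ℝ → ℤ → ℝ → ℂ}
    (hu : IsMildFamily K G u) {φ : ℝ → ℝ} (hφ : Continuous φ) (k : ℕ) :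
    Measurable fun s => ∫⁻ ξ in Ioi (0 : ℝ), modeDensity φ (u s) k ξ := by
  have h1 := hu.continuous (k + 1)
  have h2 : Continuous fun p : ℝ × ℝ => modeDensity φ (u p.1) k p.2 := by
    unfold modeDensity
    exact ENNReal.continuous_ofReal.comp (by fun_prop)
  exact h2.measurable.lintegral_prod_right'

theorem IsMildFamily.tsum_lintegral_modeDensity {K : ℝ} {G : ℝ → ℂ} {u : ℝ → ℤ → ℝ → ℂ}
    (hu : IsMildFamily K G u) {φ : ℝ → ℝ} (hφ : Continuous φ) (t : ℝ) :
    ∑' k, ∫⁻ s in Ioc 0 t, ∫⁻ ξ in Ioi (0 : ℝ), modeDensity φ (u s) k ξ =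
      ∫⁻ s in Ioc 0 t, modesEnergy φ (u s) := by
  rw [← lintegral_tsum fun k => (hu.measurable_lintegral_modeDensity hφ k).aemeasurable]
  exact lintegral_congr fun s => (modesEnergy_eq_tsum hφ fun l =>
    (hu.continuous l).comp (Continuous.prodMk_right s)).symm

theorem ofReal_integral_le_lintegral_ofReal {α : Type*} [MeasurableSpace α] {μ : Measure α}
    {f : α → ℝ} (hf : Integrable f μ) (h0 : 0 ≤ᵐ[μ] f) {F : α → ℝ≥0∞}
    (h : ∀ᵐ x ∂μ, ENNReal.ofReal (f x) ≤ F x) :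
    ENNReal.ofReal (∫ x, f x ∂μ) ≤ ∫⁻ x, F x ∂μ := by
  rw [ofReal_integral_eq_lintegral_ofReal hf h0]
  exact lintegral_mono_ae h

theorem cutoffError_zero_nonneg {K lam B B' δ : ℝ} (hK : 0 ≤ K) (hδ : 0 ≤ δ) {G : ℝ → ℂ}
    {φ φ' : ℝ → ℝ} (hφ : IsEnergyWeight lam B B' G φ φ') (u : ℤ → ℝ → ℂ) (k : ℕ) {ξ : ℝ}
    (hξ : 0 ≤ ξ) : 0 ≤ modeCutoffError K 0 δ φ u k ξ := by
  have hφ0 := hφ.pos ξ hξ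
  have hX0 := cutoffBase_pos hδ k ξ
  rw [modeCutoffError, zero_div, zero_mul, sub_zero]
  positivity

/-- The energy produced by the cutoff up to time `t`. -/
theorem ofReal_integral_cutoffError_le {K lam B B' δ t : ℝ} (hK : 0 ≤ K) (hδ : 0 < δ)
    (hδ1 : δ ≤ 1) (ht : 0 ≤ t) {G : ℝ → ℂ} {φ φ' : ℝ → ℝ} (hφ : IsEnergyWeight lam B B' G φ φ')
    {u : ℝ → ℤ → ℝ → ℂ} (hu : IsMildFamily K G u) (n : ℕ) :
    ENNReal.ofReal (∫ s in (0 : ℝ)..t, ∫ ξ in Ioi (0 : ℝ), cutoffError K 0 δ φ (u s) n ξ) ≤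
      ∑' k : ℕ, ENNReal.ofReal ((2 + 4 * K) * min (δ * (k + 1)) 1) *
        ∫⁻ s in Ioc 0 t, ∫⁻ ξ in Ioi (0 : ℝ), modeDensity φ (u s) k ξ := by
  obtain ⟨hc, hi⟩ := hu.integral_cutoffError hK le_rfl hδ hφ n
  have hnn : ∀ s, ∀ ξ > 0, 0 ≤ cutoffError K 0 δ φ (u s) n ξ := fun s ξ hξ =>
    Finset.sum_nonneg fun k _ => cutoffError_zero_nonneg hK hδ.le hφ (u s) k (le_of_lt hξ)
  have hmeas : ∀ k s, Measurable (modeDensity φ (u s) k) := fun k s =>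
    (continuous_modeDensity hφ.continuous
      ((hu.continuous (k + 1)).comp (Continuous.prodMk_right s))).measurable
  set c : ℕ → ℝ≥0∞ := fun k => ENNReal.ofReal ((2 + 4 * K) * min (δ * (k + 1)) 1) with hcdef
  have hinner : ∀ s, ENNReal.ofReal (∫ ξ in Ioi (0 : ℝ), cutoffError K 0 δ φ (u s) n ξ) ≤
      ∑ k ∈ Finset.range (n + 1), c k * ∫⁻ ξ in Ioi (0 : ℝ), modeDensity φ (u s) k ξ := by
    intro s
    have h1 : ∑ k ∈ Finset.range (n + 1), c k * ∫⁻ ξ in Ioi (0 : ℝ), modeDensity φ (u s) k ξ =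
        ∫⁻ ξ in Ioi (0 : ℝ), ∑ k ∈ Finset.range (n + 1), c k * modeDensity φ (u s) k ξ := by
      rw [lintegral_finsetSum _ fun k _ => (hmeas k s).const_mul _]
      exact Finset.sum_congr rfl fun k _ => (lintegral_const_mul _ (hmeas k s)).symm
    rw [h1]
    refine ofReal_integral_le_lintegral_ofReal (hi s)
      ((ae_restrict_iff' measurableSet_Ioi).2 (ae_of_all _ fun ξ hξ => hnn s ξ hξ))
      ((ae_restrict_iff' measurableSet_Ioi).2 (ae_of_all _ fun ξ hξ => ?_))
    rw [cutoffError, ENNReal.ofReal_sum_of_nonneg fun k _ =>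
      cutoffError_zero_nonneg hK hδ.le hφ (u s) k (le_of_lt hξ)]
    exact Finset.sum_le_sum fun k _ =>
      ofReal_modeCutoffError_le hK hδ.le hδ1 hφ (u s) k (le_of_lt hξ)
  rw [intervalIntegral.integral_of_le ht]
  refine (ofReal_integral_le_lintegral_ofReal
    ((intervalIntegrable_iff_integrableOn_Ioc_of_le ht).1 (hc.intervalIntegrable 0 t))
    (ae_of_all _ fun s => setIntegral_nonneg measurableSet_Ioi fun ξ hξ => hnn s ξ hξ)
    (ae_of_all _ hinner)).trans ?_
  have hm2 := fun k => hu.measurable_lintegral_modeDensity hφ.continuous k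
  rw [lintegral_finsetSum _ fun k _ => (hm2 k).const_mul _]
  simp_rw [fun k => lintegral_const_mul (μ := volume.restrict (Ioc 0 t)) (c k) (hm2 k)]
  exact ENNReal.sum_le_tsum _

/-- The energy inequality. -/
theorem modesEnergy_add_le {K lam B B' t : ℝ} (hK : 0 ≤ K) (hlam : 0 < lam) (ht : 0 ≤ t)
    {G : ℝ → ℂ} (hG : IntegrableOn G (Ioi 0))
    (hc : 0 ≤ 1 - K ^ 2 / (4 * lam) * ∫ ξ in Ioi (0 : ℝ), ‖G ξ‖)
    {φ φ' : ℝ → ℝ} (hφ : IsEnergyWeight lam B B' G φ φ')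
    {u : ℝ → ℤ → ℝ → ℂ} (hu : IsMildFamily K G u) :
    modesEnergy φ (u t) + ENNReal.ofReal (1 - K ^ 2 / (4 * lam) * ∫ ξ in Ioi (0 : ℝ), ‖G ξ‖)
      * (∫⁻ s in Ioc 0 t, ‖u s 1 0‖ₑ ^ 2) ≤ modesEnergy φ (u 0) := by
  -- Infinite initial energy makes the claim trivial; otherwise the a priori bound provides a finite
  -- time integral of the energy for dominated convergence.
  rcases eq_or_ne (modesEnergy φ (u 0)) ⊤ with htop | hfin
  · rw [htop]
    exact le_top
  have huc : ∀ s l, Continuous (u s l) := fun s l =>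
    (hu.continuous l).comp (Continuous.prodMk_right s)
  have hηc : Continuous fun s => u s 1 0 := (hu.continuous 1).comp (Continuous.prodMk_left 0)
  have hsum : ∑' k, ∫⁻ s in Ioc 0 t, ∫⁻ ξ in Ioi (0 : ℝ), modeDensity φ (u s) k ξ ≠ ⊤ := by
    rw [hu.tsum_lintegral_modeDensity hφ.continuous]
    refine ne_top_of_le_ne_top (b := ∫⁻ s in Ioc 0 t,
      ENNReal.ofReal (Real.exp ((2 + 4 * K) * t)) * modesEnergy φ (u 0)) ?_
      (setLIntegral_mono measurable_const fun s hs => ?_)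
    · rw [setLIntegral_const, Real.volume_Ioc]
      exact ENNReal.mul_ne_top (ENNReal.mul_ne_top ENNReal.ofReal_ne_top hfin)
        ENNReal.ofReal_ne_top
    · refine (modesEnergy_le_exp_mul hK hlam hs.1.le hG hc hφ hu).trans ?_
      gcongr
      exact hs.2
  set c := 1 - K ^ 2 / (4 * lam) * ∫ ξ in Ioi (0 : ℝ), ‖G ξ‖ with hcdef
  have hlim := ((tendsto_truncation_error (K * B) t).const_add (modesEnergy φ (u 0))).add
    (tendsto_tsum_min_mul hsum (by positivity : 0 ≤ 2 + 4 * K))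
  rw [add_zero, add_zero] at hlim
  refine modesEnergy_add_le_of_truncated hφ (huc t) (hu.norm_le_one t) tendsto_nat_pow_three hlim
    fun m => ?_
  have hδ := cutoffScale_pos m
  have hδ1 := cutoffScale_le_one m
  -- No exponential factor this time: the cutoff error is now sent to zero instead of being
  -- absorbed.
  have h1 := truncated_energy_le hK (C := 0) le_rfl hlam hδ hδ1 ht hG hφ hu ((m + 1) ^ 3)
  simp only [neg_zero, zero_mul, Real.exp_zero, one_mul] at h1
  have h2 : ENNReal.ofReal c * (∫⁻ s in Ioc 0 t, ‖u s 1 0‖ₑ ^ 2)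
      = ENNReal.ofReal (c * ∫ s in (0 : ℝ)..t, ‖u s 1 0‖ ^ 2) := by
    rw [ENNReal.ofReal_mul hc, intervalIntegral.integral_of_le ht,
      ofReal_integral_eq_lintegral_ofReal (f := fun s => ‖u s 1 0‖ ^ 2)
      ((intervalIntegrable_iff_integrableOn_Ioc_of_le ht).1
        ((hηc.norm.pow 2).intervalIntegrable 0 t)) (ae_of_all _ fun s => sq_nonneg _)]
    congr 1
    refine lintegral_congr fun s => ?_
    rw [ENNReal.ofReal_pow (norm_nonneg _), ofReal_norm]
  have hη0 : 0 ≤ ∫ s in (0 : ℝ)..t, ‖u s 1 0‖ ^ 2 :=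
    intervalIntegral.integral_nonneg ht fun s _ => by positivity
  rw [← ofReal_sum_modeEnergy hφ, h2, ← ENNReal.ofReal_add
    (Finset.sum_nonneg fun k _ => mul_nonneg (by positivity) (modeEnergy_nonneg hφ _ k))
    (mul_nonneg hc hη0)]
  refine (ENNReal.ofReal_le_ofReal h1).trans ?_
  refine ENNReal.ofReal_add_le.trans (add_le_add (ENNReal.ofReal_add_le.trans ?_)
    (ofReal_integral_cutoffError_le hK hδ hδ1 ht hφ hu _))
  rw [ofReal_sum_modeEnergy hφ]
  gcongr
  exact sum_ofReal_modeEnergy_le hδ hφ (huc 0) (hu.norm_le_one 0) _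

/-! ### Plancherel, Bessel and the energy of an `L²` density -/

open scoped FourierTransform SchwartzMap ContDiff in
/-- Plancherel's theorem for the Fourier integral of a function in `L¹ ∩ L²`. -/
theorem lintegral_enorm_fourier_sq {F : ℝ → ℂ} (h1 : Integrable F) (h2 : MemLp F 2) :
    ∫⁻ x, ‖𝓕 F x‖ₑ ^ 2 = ∫⁻ x, ‖F x‖ₑ ^ 2 := by
  have hc : Continuous (𝓕 F) :=
    VectorFourier.fourierIntegral_continuous Real.continuous_fourierChar
      (by exact continuous_inner) h1
  have hL : LocallyIntegrable (𝓕 (h2.toLp F) : Lp ℂ 2 (volume : Measure ℝ)) volume :=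
    (Lp.memLp _).locallyIntegrable one_le_two
  -- The `L²` transform and the Fourier integral have to be identified almost everywhere. Both move
  -- onto a smooth compactly supported test function, the first through tempered distributions
  -- (`e1`), the second by Fubini (`e3`).
  have hae : ∀ᵐ x, (𝓕 (h2.toLp F) : Lp ℂ 2 (volume : Measure ℝ)) x = 𝓕 F x := by
    refine ae_eq_of_integral_contDiff_smul_eq hL hc.locallyIntegrable fun g hg hgc => ?_
    have hgc' : HasCompactSupport fun x => (g x : ℂ) := hgc.comp_left Complex.ofReal_zero
    let γ : 𝓢(ℝ, ℂ) := hgc'.toSchwartzMap (Complex.ofRealCLM.contDiff.comp hg)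
    have hγ : ∀ x, γ x = (g x : ℂ) := fun x => rfl
    have e1 : ∫ x, g x • (𝓕 (h2.toLp F) : Lp ℂ 2 (volume : Measure ℝ)) x
        = ∫ x, (𝓕 γ) x • (h2.toLp F : Lp ℂ 2 (volume : Measure ℝ)) x := by
      have h3 := congrArg (fun T : 𝓢'(ℝ, ℂ) => T γ)
        (Lp.fourier_toTemperedDistribution_eq (h2.toLp F))
      simp only [TemperedDistribution.fourier_apply, Lp.toTemperedDistribution_apply] at h3
      rw [h3]
      refine integral_congr_ae (ae_of_all _ fun x => ?_)
      simp [hγ]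
    have e2 : ∫ x, (𝓕 γ) x • (h2.toLp F : Lp ℂ 2 (volume : Measure ℝ)) x
        = ∫ x, (𝓕 γ) x • F x := by
      refine integral_congr_ae ?_
      filter_upwards [h2.coeFn_toLp] with x hx
      rw [hx]
    have e3 : ∫ x, 𝓕 F x • γ x = ∫ x, F x • (𝓕 γ) x := by
      rw [SchwartzMap.fourier_coe]
      simpa using! VectorFourier.integral_fourierIntegral_smul_eq_flip (L := innerₗ ℝ)
        Real.continuous_fourierChar continuous_inner h1 γ.integrable
    rw [e1, e2]
    simp only [smul_eq_mul, mul_comm (F _)] at e3 ⊢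
    rw [← e3]
    refine integral_congr_ae (ae_of_all _ fun x => ?_)
    simp [hγ, mul_comm]
  have key : ∀ G : Lp ℂ 2 (volume : Measure ℝ), ∫⁻ x, ‖G x‖ₑ ^ 2 = ‖G‖ₑ ^ 2 := by
    intro G
    rw [Lp.enorm_def]
    have := eLpNorm_nnreal_pow_eq_lintegral (f := G) (μ := (volume : Measure ℝ)) (p := 2)
      (by norm_num)
    simpa using this.symm
  calc ∫⁻ x, ‖𝓕 F x‖ₑ ^ 2
      = ∫⁻ x, ‖(𝓕 (h2.toLp F) : Lp ℂ 2 (volume : Measure ℝ)) x‖ₑ ^ 2 := by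
        refine lintegral_congr_ae ?_
        filter_upwards [hae] with x hx
        rw [hx]
    _ = ∫⁻ x, ‖(h2.toLp F : Lp ℂ 2 (volume : Measure ℝ)) x‖ₑ ^ 2 := by
        rw [key, key, enorm_eq_iff_norm_eq.2 (Lp.norm_fourier_eq (h2.toLp F))]
    _ = ∫⁻ x, ‖F x‖ₑ ^ 2 := by
        refine lintegral_congr_ae ?_
        filter_upwards [h2.coeFn_toLp] with x hx
        rw [hx]

open scoped FourierTransform in
/-- Plancherel's theorem with the convention `∫ e^{iξω} F(ω) dω` for the Fourier transform. -/
theorem lintegral_enorm_integral_exp_sq {F : ℝ → ℂ} (h1 : Integrable F) (h2 : MemLp F 2) :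
    ∫⁻ ξ : ℝ, ‖∫ ω : ℝ, Complex.exp (Complex.I * ξ * ω) * F ω‖ₑ ^ 2 =
      ENNReal.ofReal (2 * Real.pi) * ∫⁻ ω, ‖F ω‖ₑ ^ 2 := by
  -- `𝓕` uses the kernel `e^{-2πi xω}`, so `e^{iξω}` corresponds to `x = -ξ/(2π)`; the change of
  -- variables produces the factor `2π`.
  set a : ℝ := -(2 * Real.pi)⁻¹ with ha
  have hpi := Real.two_pi_pos
  have ha0 : a ≠ 0 := neg_ne_zero.2 (inv_ne_zero hpi.ne')
  have e : ∀ ξ : ℝ, ∫ ω : ℝ, Complex.exp (Complex.I * ξ * ω) * F ω = 𝓕 F (a * ξ) := by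
    intro ξ
    rw [Real.fourier_real_eq_integral_exp_smul]
    refine integral_congr_ae (ae_of_all _ fun ω => ?_)
    simp only [smul_eq_mul]
    congr 2
    have h3 : -2 * Real.pi * ω * (a * ξ) = ω * ξ := by
      rw [ha]
      field_simp
    rw [h3]
    push_cast
    ring
  simp_rw [e]
  have hc : Continuous (𝓕 F) :=
    VectorFourier.fourierIntegral_continuous Real.continuous_fourierChar
      (by exact continuous_inner) h1
  have hm : Measurable fun x => ‖𝓕 F x‖ₑ ^ 2 := hc.measurable.enorm.pow_const 2
  rw [← lintegral_enorm_fourier_sq h1 h2,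
    ← lintegral_map (f := fun x => ‖𝓕 F x‖ₑ ^ 2) hm (measurable_const_mul a),
    Real.map_volume_mul_left ha0, lintegral_smul_measure]
  congr 2
  rw [ha, inv_neg, inv_inv, abs_neg, abs_of_pos hpi]

/-- Bessel's inequality for the Fourier coefficients on the torus. -/
theorem tsum_enorm_integral_angleExp_sq_le {h : Torus → ℂ} (hh : MemLp h 2) :
    ∑' k : ℕ, ‖∫ θ, angleExp ((k : ℤ) + 1) θ * h θ‖ₑ ^ 2 ≤
      ENNReal.ofReal (2 * Real.pi) * ∫⁻ θ, ‖h θ‖ₑ ^ 2 := by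
  have hpi := Real.two_pi_pos
  have hh' : MemLp h 2 AddCircle.haarAddCircle := hh.haarAddCircle
  set H := hh'.toLp h with hH
  -- `fourierCoeff` integrates the conjugate character against Haar measure of mass one, hence the
  -- index `-n` and the factor `2π`. Squaring gives `(2π)²`, one factor of which turns Haar measure
  -- back into `dθ`.
  have hcoef : ∀ n : ℤ, ∫ θ, angleExp n θ * h θ = (2 * Real.pi : ℝ) * fourierCoeff H (-n) := by
    intro n
    rw [fourierCoeff_congr_ae hh'.coeFn_toLp, fourierCoeff, AddCircle.volume_eq_smul_haarAddCircle,
      integral_smul_measure, ENNReal.toReal_ofReal hpi.le, neg_neg, Complex.real_smul]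
    rfl
  have hsum := (hasSum_sq_fourierCoeff H)
  have hinj : Function.Injective fun k : ℕ => -((k : ℤ) + 1) := by
    intro a b hab
    simpa using hab
  have h1 : ∑' k : ℕ, ‖fourierCoeff H (-((k : ℤ) + 1))‖ₑ ^ 2
      ≤ ENNReal.ofReal (∫ θ, ‖H θ‖ ^ 2 ∂AddCircle.haarAddCircle) := by
    rw [← hsum.tsum_eq, ENNReal.ofReal_tsum_of_nonneg (fun _ => by positivity) hsum.summable]
    refine le_trans (le_of_eq ?_) (ENNReal.tsum_comp_le_tsum_of_injective hinj _)
    refine tsum_congr fun k => ?_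
    rw [ENNReal.ofReal_pow (norm_nonneg _), ofReal_norm]
  have h2 : ENNReal.ofReal (∫ θ, ‖H θ‖ ^ 2 ∂AddCircle.haarAddCircle)
      = ∫⁻ θ, ‖h θ‖ₑ ^ 2 ∂AddCircle.haarAddCircle := by
    rw [ofReal_integral_eq_lintegral_ofReal (Lp.memLp H).norm.integrable_sq
      (ae_of_all _ fun θ => sq_nonneg _)]
    refine lintegral_congr_ae ?_
    filter_upwards [hh'.coeFn_toLp] with θ hθ
    rw [ENNReal.ofReal_pow (norm_nonneg _), ofReal_norm, hθ]
  have h3 : ∫⁻ θ, ‖h θ‖ₑ ^ 2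
      = ENNReal.ofReal (2 * Real.pi) * ∫⁻ θ, ‖h θ‖ₑ ^ 2 ∂AddCircle.haarAddCircle := by
    rw [AddCircle.volume_eq_smul_haarAddCircle, lintegral_smul_measure, smul_eq_mul]
  simp_rw [hcoef, enorm_mul, mul_pow, ENNReal.tsum_mul_left]
  rw [h3, ← mul_assoc, ← sq, ← h2]
  gcongr
  rw [← ofReal_norm, Complex.norm_real, Real.norm_of_nonneg hpi.le]

/-- The angular Fourier coefficient of a density. -/
def angleCoeff (f : Phase → ℝ) (l : ℤ) (ω : ℝ) : ℂ := ∫ θ, angleExp l θ * (f (θ, ω) : ℂ)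

theorem fourierTransform_withDensity {f : Phase → ℝ} (hf0 : ∀ P, 0 ≤ f P) (hf : Integrable f)
    (l : ℤ) (ξ : ℝ) :
    fourierTransform (volume.withDensity fun P => ENNReal.ofReal (f P)) l ξ =
      ∫ ω : ℝ, Complex.exp (Complex.I * ξ * ω) * angleCoeff f l ω := by
  have hc := continuous_angleExp l
  have hbd : ∀ P : Phase, ‖angleExp l P.1 * Complex.exp (Complex.I * ξ * P.2)‖ ≤ 1 := fun P => by
    rw [norm_mul, norm_angleExp, one_mul, mul_assoc, mul_comm, ← Complex.ofReal_mul,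
      Complex.norm_exp_ofReal_mul_I]
  have hint : Integrable fun P : Phase =>
      (f P : ℂ) * (angleExp l P.1 * Complex.exp (Complex.I * ξ * P.2)) :=
    hf.ofReal.mul_bdd (c := 1) (Continuous.aestronglyMeasurable (by fun_prop)) (ae_of_all _ hbd)
  rw [fourierTransform, integral_withDensity_eq_integral_toReal_smul₀
    hf.aestronglyMeasurable.aemeasurable.ennreal_ofReal (ae_of_all _ fun P => ENNReal.ofReal_lt_top)]
  simp only [ENNReal.toReal_ofReal (hf0 _), Complex.real_smul]
  rw [Measure.volume_eq_prod, integral_prod_symm _ hint]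
  refine integral_congr_ae (ae_of_all _ fun ω => ?_)
  simp only [angleCoeff]
  rw [← integral_const_mul]
  refine integral_congr_ae (ae_of_all _ fun θ => ?_)
  simp only
  ring

theorem tsum_enorm_angleCoeff_sq_le {f : Phase → ℝ} (hf : MemLp f 2 volume) :
    ∀ᵐ ω, ∑' k : ℕ, ‖angleCoeff f ((k : ℤ) + 1) ω‖ₑ ^ 2 ≤
      ENNReal.ofReal (2 * Real.pi) * ∫⁻ θ, ‖f (θ, ω)‖ₑ ^ 2 := by
  have h1 : Integrable (fun P => f P ^ 2) ((volume : Measure Torus).prod (volume : Measure ℝ)) :=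
    hf.integrable_sq
  have hm : AEStronglyMeasurable f ((volume : Measure Torus).prod (volume : Measure ℝ)) := hf.1
  filter_upwards [h1.prod_left_ae, hm.prodMk_right] with ω h2 h3
  have h4 : MemLp (fun θ => f (θ, ω)) 2 := (memLp_two_iff_integrable_sq h3).2 h2
  have h5 := tsum_enorm_integral_angleExp_sq_le h4.ofReal
  simpa [angleCoeff, ← ofReal_norm] using h5

theorem lintegral_enorm_sq_eq_eLpNorm {f : Phase → ℝ} :
    eLpNorm f 2 volume ^ 2 = ∫⁻ P, ‖f P‖ₑ ^ 2 := by
  have := eLpNorm_nnreal_pow_eq_lintegral (f := f) (μ := (volume : Measure Phase)) (p := 2)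
    (by norm_num)
  simpa using this

/-- Plancherel in `ω` is applied to each angular coefficient and Bessel in `θ` at almost every `ω`;
each contributes a factor `2π`. The summed Bessel bound also supplies the square integrability of
each coefficient that Plancherel requires. -/
theorem tsum_lintegral_fourierTransform_le {f : Phase → ℝ} (hf0 : ∀ P, 0 ≤ f P)
    (hf1 : Integrable f) (hf2 : MemLp f 2 volume) :
    ∑' k : ℕ, ∫⁻ ξ : ℝ, ‖fourierTransform (volume.withDensity fun P => ENNReal.ofReal (f P))
      ((k : ℤ) + 1) ξ‖ₑ ^ 2 ≤ ENNReal.ofReal (4 * Real.pi ^ 2) * eLpNorm f 2 volume ^ 2 := by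
  have hpi := Real.pi_pos
  have hFi : ∀ l, Integrable (angleCoeff f l) := by
    intro l
    have hc := continuous_angleExp l
    have hint : Integrable (fun P : Phase => angleExp l P.1 * (f P : ℂ))
        ((volume : Measure Torus).prod (volume : Measure ℝ)) :=
      hf1.ofReal.bdd_mul (c := 1) (Continuous.aestronglyMeasurable (by fun_prop))
        (ae_of_all _ fun P => (norm_angleExp l P.1).le)
    exact hint.integral_prod_right
  have hsq : ∫⁻ ω : ℝ, ∫⁻ θ : Torus, ‖f (θ, ω)‖ₑ ^ 2 = eLpNorm f 2 volume ^ 2 := by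
    rw [lintegral_enorm_sq_eq_eLpNorm, Measure.volume_eq_prod, lintegral_prod_symm]
    exact hf2.1.aemeasurable.enorm.pow_const 2
  have hsum : ∑' k : ℕ, ∫⁻ ω : ℝ, ‖angleCoeff f ((k : ℤ) + 1) ω‖ₑ ^ 2 ≤
      ENNReal.ofReal (2 * Real.pi) * eLpNorm f 2 volume ^ 2 := by
    rw [← lintegral_tsum fun k => (hFi _).1.aemeasurable.enorm.pow_const 2, ← hsq,
      ← lintegral_const_mul' _ _ ENNReal.ofReal_ne_top]
    exact lintegral_mono_ae (tsum_enorm_angleCoeff_sq_le hf2)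
  have hfin : ENNReal.ofReal (2 * Real.pi) * eLpNorm f 2 volume ^ 2 < ⊤ :=
    ENNReal.mul_lt_top ENNReal.ofReal_lt_top (ENNReal.pow_lt_top hf2.2)
  have hF2 : ∀ k : ℕ, MemLp (angleCoeff f ((k : ℤ) + 1)) 2 := by
    intro k
    rw [memLp_two_iff_integrable_sq_norm (hFi _).1]
    refine ⟨(hFi _).1.norm.pow 2, ?_⟩
    have h1 := (ENNReal.le_tsum k).trans_lt (hsum.trans_lt hfin)
    simpa [HasFiniteIntegral] using h1
  calc _ = ∑' k : ℕ, ENNReal.ofReal (2 * Real.pi) *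
        ∫⁻ ω : ℝ, ‖angleCoeff f ((k : ℤ) + 1) ω‖ₑ ^ 2 := by
        refine tsum_congr fun k => ?_
        simp_rw [fourierTransform_withDensity hf0 hf1]
        exact lintegral_enorm_integral_exp_sq (hFi _) (hF2 k)
    _ ≤ ENNReal.ofReal (2 * Real.pi) *
        (ENNReal.ofReal (2 * Real.pi) * eLpNorm f 2 volume ^ 2) := by
        rw [ENNReal.tsum_mul_left]
        gcongr
    _ = _ := by
        rw [← mul_assoc, ← ENNReal.ofReal_mul (by positivity)]
        congr 2
        ring

/-- The energy of a measure with a square integrable density is finite. -/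
theorem energy_withDensity_le {f : Phase → ℝ} (hf0 : ∀ P, 0 ≤ f P)
    (hf1 : Integrable f) (hf2 : MemLp f 2 volume) {φ : ℝ → ℝ}
    (hm : ∀ l, Measurable (fourierTransform (volume.withDensity fun P => ENNReal.ofReal (f P)) l)) :
    energy φ (volume.withDensity fun P => ENNReal.ofReal (f P)) ≤
      ENNReal.ofReal (4 * Real.pi ^ 2) * eLpNorm φ ⊤ (volume.restrict (Ici 0))
        * eLpNorm f 2 volume ^ 2 := by
  set ρ := volume.withDensity fun P => ENNReal.ofReal (f P) with hρ
  set N := eLpNorm φ ⊤ (volume.restrict (Ici 0)) with hN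
  -- Besides this bound on the weight, the estimate uses only `1/l ≤ 1` and enlarges the half-line
  -- to `ℝ`.
  have hφN : ∀ᵐ ξ ∂volume.restrict (Ioi (0 : ℝ)), ‖φ ξ‖ₑ ≤ N := by
    rw [Measure.restrict_congr_set Ioi_ae_eq_Ici, hN, eLpNorm_exponent_top]
    exact ae_le_eLpNormEssSup
  calc energy φ ρ ≤ ∫⁻ ξ in Ioi (0 : ℝ), N * ∑' k : ℕ,
        ‖fourierTransform ρ ((k : ℤ) + 1) ξ‖ₑ ^ 2 := by
        refine lintegral_mono_ae ?_
        filter_upwards [hφN] with ξ hξ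
        rw [← ENNReal.tsum_mul_left]
        refine ENNReal.tsum_le_tsum fun k => ?_
        calc _ ≤ ENNReal.ofReal (‖fourierTransform ρ ((k : ℤ) + 1) ξ‖ ^ 2 * ‖φ ξ‖) := by
              refine ENNReal.ofReal_le_ofReal ?_
              have h1 : 1 / ((k : ℝ) + 1) ≤ 1 := by
                rw [div_le_one (by positivity)]
                linarith [(Nat.cast_nonneg k : (0 : ℝ) ≤ k)]
              calc _ ≤ 1 / ((k : ℝ) + 1) * ‖fourierTransform ρ ((k : ℤ) + 1) ξ‖ ^ 2 * ‖φ ξ‖ := by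
                    gcongr
                    exact le_abs_self _
                _ ≤ 1 * ‖fourierTransform ρ ((k : ℤ) + 1) ξ‖ ^ 2 * ‖φ ξ‖ := by gcongr
                _ = _ := by rw [one_mul]
          _ = ‖φ ξ‖ₑ * ‖fourierTransform ρ ((k : ℤ) + 1) ξ‖ₑ ^ 2 := by
              rw [mul_comm, ENNReal.ofReal_mul (norm_nonneg _), ENNReal.ofReal_pow (norm_nonneg _),
                ofReal_norm, ofReal_norm]
          _ ≤ _ := by gcongr
    _ ≤ ∫⁻ ξ, N * ∑' k : ℕ, ‖fourierTransform ρ ((k : ℤ) + 1) ξ‖ₑ ^ 2 :=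
        setLIntegral_le_lintegral _ _
    _ = N * ∑' k : ℕ, ∫⁻ ξ, ‖fourierTransform ρ ((k : ℤ) + 1) ξ‖ₑ ^ 2 := by
        rw [lintegral_const_mul _ (Measurable.tsum fun k => (hm _).enorm.pow_const 2),
          lintegral_tsum fun k => ((hm _).enorm.pow_const 2).aemeasurable]
    _ ≤ N * (ENNReal.ofReal (4 * Real.pi ^ 2) * eLpNorm f 2 volume ^ 2) := by
        gcongr
        exact tsum_lintegral_fourierTransform_le hf0 hf1 hf2
    _ = _ := by ring

/-! ### The weight and the choice of the rate -/

/-- The function `1 / (1 - lam ∫_0^ξ ‖G‖)` solves `φ' = lam ‖G‖ φ²` with `φ 0 = 1`, and stays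
bounded on the half-line because `lam ∫ ‖G‖ < 1`. Adding a small positive integrable function to
`‖G‖` makes it strictly increasing even where `G` vanishes. -/
theorem exists_isEnergyWeight {G : ℝ → ℂ} (hGc : Continuous G) (hGi : IntegrableOn G (Ioi 0))
    (hG1 : ∀ ξ, ‖G ξ‖ ≤ 1) {lam : ℝ} (hlam : 0 < lam)
    (hM : lam * ∫ ξ in Ioi (0 : ℝ), ‖G ξ‖ < 1) :
    ∃ (φ φ' : ℝ → ℝ) (B B' : ℝ), IsEnergyWeight lam B B' G φ φ' ∧ ContDiff ℝ 1 φ ∧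
      StrictMono φ := by
  have hpi := Real.pi_pos
  set M := ∫ ξ in Ioi (0 : ℝ), ‖G ξ‖ with hMdef
  -- With this `ε` the arctangent, at most `π/2`, uses half of the gap `1 - lam * M`, so the
  -- denominator stays above the other half.
  set ε : ℝ := (1 - lam * M) / (lam * Real.pi) with hε
  have hε0 : 0 < ε := div_pos (by linarith) (by positivity)
  set A : ℝ → ℝ := fun ξ => (∫ x in (0 : ℝ)..ξ, ‖G x‖) + ε * Real.arctan ξ with hA
  set h : ℝ → ℝ := fun ξ => ‖G ξ‖ + ε * (1 / (1 + ξ ^ 2)) with hh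
  have hA' : ∀ ξ, HasDerivAt A (h ξ) ξ := fun ξ =>
    (intervalIntegral.integral_hasDerivAt_right (hGc.norm.intervalIntegrable _ _)
      hGc.norm.aestronglyMeasurable.stronglyMeasurableAtFilter hGc.norm.continuousAt).add
      ((Real.hasDerivAt_arctan ξ).const_mul ε)
  have hAc : Continuous A := continuous_iff_continuousAt.2 fun ξ => (hA' ξ).continuousAt
  have hhc : Continuous h := by
    refine hGc.norm.add (continuous_const.mul (Continuous.div continuous_const (by fun_prop) ?_))
    intro ξ
    positivity
  have hhpos : ∀ ξ, 0 < h ξ := fun ξ => by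
    have : 0 < 1 / (1 + ξ ^ 2) := by positivity
    have := mul_pos hε0 this
    have := norm_nonneg (G ξ)
    simp only [hh]
    linarith
  have hhle : ∀ ξ, h ξ ≤ 1 + ε := fun ξ => by
    have h1 : 1 / (1 + ξ ^ 2) ≤ 1 := by
      rw [div_le_one (by positivity)]
      linarith [sq_nonneg ξ]
    have h2 := mul_le_mul_of_nonneg_left h1 hε0.le
    have := hG1 ξ
    simp only [hh]
    linarith
  have hAle : ∀ ξ, A ξ ≤ M + ε * (Real.pi / 2) := by
    have hmono : StrictMono A := strictMono_of_deriv_pos fun ξ => by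
      rw [(hA' ξ).deriv]; exact hhpos ξ
    have hpos : ∀ ξ, 0 ≤ ξ → A ξ ≤ M + ε * (Real.pi / 2) := by
      intro ξ hξ
      have h1 : ∫ x in (0 : ℝ)..ξ, ‖G x‖ ≤ M := by
        rw [intervalIntegral.integral_of_le hξ]
        exact setIntegral_mono_set hGi.norm (ae_of_all _ fun _ => norm_nonneg _)
          (Ioc_subset_Ioi_self.eventuallyLE)
      have h2 := mul_le_mul_of_nonneg_left (Real.arctan_lt_pi_div_two ξ).le hε0.le
      simp only [hA]
      linarith
    intro ξ
    exact (hmono.monotone (le_max_left ξ 0)).trans (hpos _ (le_max_right _ _))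
  set d₀ : ℝ := 1 - lam * (M + ε * (Real.pi / 2)) with hd₀
  have hd₀pos : 0 < d₀ := by
    have : lam * (M + ε * (Real.pi / 2)) = lam * M + (1 - lam * M) / 2 := by
      rw [hε]
      field_simp
    rw [hd₀, this]
    linarith
  set d : ℝ → ℝ := fun ξ => 1 - lam * A ξ with hd
  have hdge : ∀ ξ, d₀ ≤ d ξ := fun ξ => by
    have := mul_le_mul_of_nonneg_left (hAle ξ) hlam.le
    simp only [hd, hd₀]
    linarith
  have hdpos : ∀ ξ, 0 < d ξ := fun ξ => hd₀pos.trans_le (hdge ξ)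
  have hdc : Continuous d := by fun_prop
  have hd' : ∀ ξ, HasDerivAt d (-(lam * h ξ)) ξ := fun ξ => ((hA' ξ).const_mul lam).const_sub 1
  set φ' : ℝ → ℝ := fun ξ => lam * h ξ * (d ξ)⁻¹ ^ 2 with hφ'
  have hφd : ∀ ξ, HasDerivAt (fun x => (d x)⁻¹) (φ' ξ) ξ := fun ξ => by
    refine ((hd' ξ).inv (hdpos ξ).ne').congr_deriv ?_
    simp only [hφ']
    field_simp
  have hφ'c : Continuous φ' := (hhc.const_mul lam).mul ((hdc.inv₀ fun ξ => (hdpos ξ).ne').pow 2)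
  have hφle : ∀ ξ, (d ξ)⁻¹ ≤ d₀⁻¹ := fun ξ => inv_anti₀ hd₀pos (hdge ξ)
  refine ⟨fun x => (d x)⁻¹, φ', d₀⁻¹, lam * (1 + ε) * d₀⁻¹ ^ 2,
    ⟨hφ'c, hφd, fun ξ _ => inv_pos.2 (hdpos ξ), fun ξ _ => hφle ξ, fun ξ _ => ?_, fun ξ _ => ?_,
      by simp [hd, hA]⟩, ?_, ?_⟩
  · have h1 := inv_pos.2 (hdpos ξ)
    have h2 := hφle ξ
    have h3 := hhle ξ
    have h4 := hhpos ξ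
    simp only [hφ']
    gcongr
  · have h1 : ‖G ξ‖ ≤ h ξ := by
      simp only [hh]
      exact le_add_of_nonneg_right (by positivity)
    simp only [hφ']
    gcongr
  · rw [contDiff_one_iff_deriv]
    exact ⟨fun ξ => (hφd ξ).differentiableAt, by
      rwa [show deriv (fun x => (d x)⁻¹) = φ' from funext fun ξ => (hφd ξ).deriv]⟩
  · refine strictMono_of_deriv_pos fun ξ => ?_
    rw [(hφd ξ).deriv]
    have h1 := inv_pos.2 (hdpos ξ)
    have h2 := hhpos ξ
    simp only [hφ']
    positivity

/-- The two requirements say `K² M / 4 < lam < 1 / M`, an interval that is nonempty when `K M < 2`;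
its midpoint is taken. -/
theorem exists_coupling_rate {K M : ℝ} (hK : 0 ≤ K) (hM : 0 ≤ M) (h : K < 2 / M) :
    ∃ lam : ℝ, 0 < lam ∧ lam * M < 1 ∧ 0 < 1 - K ^ 2 / (4 * lam) * M := by
  have hM0 : 0 < M := by
    -- If `M` were 0, the convention `2 / 0 = 0` would turn the hypothesis into `K < 0`.
    refine hM.lt_of_ne fun h0 => ?_
    rw [← h0, div_zero] at h
    exact absurd h (not_lt.2 hK)
  rw [lt_div_iff₀ hM0] at h
  have h1 : (K * M) ^ 2 < 4 := by
    have := pow_lt_pow_left₀ h (by positivity) two_ne_zero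
    linarith
  set lam := (K ^ 2 * M / 4 + 1 / M) / 2 with hlam
  have hlam0 : 0 < lam := by positivity
  have e : lam * M = ((K * M) ^ 2 / 4 + 1) / 2 := by
    rw [hlam]
    field_simp
  refine ⟨lam, hlam0, by rw [e]; linarith, ?_⟩
  rw [sub_pos, div_mul_eq_mul_div, div_lt_one (by positivity)]
  have h2 : K ^ 2 * M * M < 4 * lam * M := by
    rw [mul_assoc 4, e]
    nlinarith
  exact lt_of_mul_lt_mul_right h2 hM0.le

/-! ### Assembly of the theorem -/

/-- Square integrability on the infinite measure space `Γ` does not give integrability; here it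
comes from the total mass being one. -/
theorem integrable_of_eq_withDensity (ρ : ProbabilityMeasure Phase) {f : Phase → ℝ}
    (hf0 : ∀ P, 0 ≤ f P) (hfm : AEStronglyMeasurable f volume)
    (h : (ρ : Measure Phase) = volume.withDensity fun P => ENNReal.ofReal (f P)) :
    Integrable f := by
  refine ⟨hfm, ?_⟩
  have h1 : (ρ : Measure Phase) univ = 1 := measure_univ
  rw [h, withDensity_apply _ MeasurableSet.univ, Measure.restrict_univ] at h1
  rw [HasFiniteIntegral]
  calc _ = ∫⁻ P, ENNReal.ofReal (f P) := by
        refine lintegral_congr fun P => ?_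
        rw [← ofReal_norm, Real.norm_of_nonneg (hf0 P)]
    _ < ⊤ := by
        rw [h1]
        exact ENNReal.one_lt_top

theorem lintegral_Ioi_le_of_forall_Ioc {f : ℝ → ℝ≥0∞} {b : ℝ≥0∞}
    (h : ∀ t, 0 ≤ t → ∫⁻ s in Ioc 0 t, f s ≤ b) : ∫⁻ s in Ioi (0 : ℝ), f s ≤ b := by
  have hU : ⋃ n : ℕ, Ioc (0 : ℝ) n = Ioi 0 := iUnion_Ioc_eq_Ioi_self_iff.2 fun x _ => exists_nat_ge x
  rw [← hU, setLIntegral_iUnion_of_directed _ (Monotone.directed_le fun m n hmn =>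
    Ioc_subset_Ioc_right (by exact_mod_cast hmn))]
  exact iSup_le fun n => h n n.cast_nonneg

/-- The Fourier modes of a weak solution, as a mild family. -/
theorem IsSolution.exists_isMildFamily {K : ℝ} (hK : 0 ≤ K) {ρin : ProbabilityMeasure Phase}
    {ρ : ℝ → ProbabilityMeasure Phase} (h : IsSolution K ρin ρ) {g : Measure ℝ}
    (hg : (ρin : Measure Phase).map Prod.snd = g) (φ : ℝ → ℝ) :
    ∃ u, IsMildFamily K (charFun g) u ∧
      (∀ t, 0 ≤ t → energy φ (ρ t) = modesEnergy φ (u t)) ∧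
      (∀ t, 0 ≤ t → u t 1 0 = orderParam (ρ t)) ∧ energy φ (ρ 0) = energy φ ρin := by
  obtain ⟨hu, hinit⟩ := h.isMildFamily hK hg
  refine ⟨_, hu, fun t ht => ?_, fun t ht => ?_, ?_⟩
  · rw [max_eq_left ht]
    rfl
  · rw [max_eq_left ht, fourierTransform_one_zero]
  · simp only [energy, hinit]

end Kuramoto

end

theorem mainTheorem1 (g : ProbabilityMeasure ℝ)
    (hg : IntegrableOn (charFun (g : Measure ℝ)) (Ioi 0))
    (K : ℝ) (hK0 : 0 ≤ K) (hK : K < Kuramoto.criticalCoupling g) :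
    ∃ (c : ℝ) (φ : ℝ → ℝ), 0 < c ∧
      ContDiffOn ℝ 1 φ (Ici 0) ∧ StrictMonoOn φ (Ici 0) ∧ BddAbove (φ '' Ici 0) ∧ φ 0 = 1 ∧
      ∀ (ρin : ProbabilityMeasure Kuramoto.Phase) (ρ : ℝ → ProbabilityMeasure Kuramoto.Phase),
        (ρin : Measure Kuramoto.Phase).map Prod.snd = (g : Measure ℝ) →
        Kuramoto.IsSolution K ρin ρ →
        (∀ t : ℝ, 0 ≤ t →
          Kuramoto.energy φ (ρ t) +
            ENNReal.ofReal c * (∫⁻ s in Ioc 0 t, ‖Kuramoto.orderParam (ρ s)‖ₑ ^ 2)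
              ≤ Kuramoto.energy φ (ρ 0)) ∧
        AntitoneOn (fun t : ℝ => Kuramoto.energy φ (ρ t)) (Ici 0) ∧
        (∫⁻ s in Ioi (0 : ℝ), ‖Kuramoto.orderParam (ρ s)‖ₑ ^ 2)
          ≤ (ENNReal.ofReal c)⁻¹ * Kuramoto.energy φ (ρ 0) ∧
        (Kuramoto.energy φ (ρ 0) < ⊤ →
          (∫⁻ s in Ioi (0 : ℝ), ‖Kuramoto.orderParam (ρ s)‖ₑ ^ 2) < ⊤) ∧
        (∀ f : Kuramoto.Phase → ℝ, (∀ P, 0 ≤ f P) → MemLp f 2 volume →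
          (ρin : Measure Kuramoto.Phase) = volume.withDensity (fun P => ENNReal.ofReal (f P)) →
          Kuramoto.energy φ (ρ 0) ≤
              ENNReal.ofReal (4 * Real.pi ^ 2) *
                eLpNorm φ ⊤ (volume.restrict (Ici 0)) * eLpNorm f 2 volume ^ 2 ∧
            Kuramoto.energy φ (ρ 0) < ⊤ ∧
            (∫⁻ s in Ioi (0 : ℝ), ‖Kuramoto.orderParam (ρ s)‖ₑ ^ 2) < ⊤) := by
  have hM0 : 0 ≤ ∫ ξ in Ioi (0 : ℝ), ‖charFun (g : Measure ℝ) ξ‖ :=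
    integral_nonneg fun _ => norm_nonneg _
  obtain ⟨lam, hlam, hlamM, hc⟩ := Kuramoto.exists_coupling_rate hK0 hM0 hK
  obtain ⟨φ, φ', B, B', hφ, hφ1, hφmono⟩ := Kuramoto.exists_isEnergyWeight
    continuous_charFun hg norm_charFun_le_one hlam hlamM
  set c := 1 - K ^ 2 / (4 * lam) * ∫ ξ in Ioi (0 : ℝ), ‖charFun (g : Measure ℝ) ξ‖ with hcdef
  have hc0 : ENNReal.ofReal c ≠ 0 := (ENNReal.ofReal_pos.2 hc).ne'
  refine ⟨c, φ, hc, hφ1.contDiffOn, hφmono.strictMonoOn _, ⟨B, ?_⟩, hφ.apply_zero,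
    fun ρin ρ hmarg hsol => ?_⟩
  · rintro _ ⟨ξ, hξ, rfl⟩
    exact hφ.le ξ hξ
  obtain ⟨u, hu, hE, hη, h0⟩ := hsol.exists_isMildFamily hK0 hmarg φ
  have hineq : ∀ t : ℝ, 0 ≤ t → Kuramoto.energy φ (ρ t) +
      ENNReal.ofReal c * (∫⁻ s in Ioc 0 t, ‖Kuramoto.orderParam (ρ s)‖ₑ ^ 2)
        ≤ Kuramoto.energy φ (ρ 0) := fun t ht => by
    rw [hE t ht, hE 0 le_rfl, setLIntegral_congr_fun (g := fun s => ‖u s 1 0‖ₑ ^ 2)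
      measurableSet_Ioc fun s hs => by simp only [hη s hs.1.le]]
    exact Kuramoto.modesEnergy_add_le hK0 hlam ht hg hc.le hφ hu
  have hbound : (∫⁻ s in Ioi (0 : ℝ), ‖Kuramoto.orderParam (ρ s)‖ₑ ^ 2)
      ≤ (ENNReal.ofReal c)⁻¹ * Kuramoto.energy φ (ρ 0) :=
    Kuramoto.lintegral_Ioi_le_of_forall_Ioc fun t ht =>
      (ENNReal.mul_le_iff_le_inv hc0 ENNReal.ofReal_ne_top).1
        (le_add_self.trans (hineq t ht))
  have hfin : Kuramoto.energy φ (ρ 0) < ⊤ →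
      (∫⁻ s in Ioi (0 : ℝ), ‖Kuramoto.orderParam (ρ s)‖ₑ ^ 2) < ⊤ := fun h =>
    hbound.trans_lt (ENNReal.mul_lt_top (ENNReal.inv_lt_top.2 (ENNReal.ofReal_pos.2 hc)) h)
  refine ⟨hineq, fun s hs t ht hst => ?_, hbound, hfin, fun f hf0 hf2 hf => ?_⟩
  -- The inequality, which only starts at time 0, is applied to the modes translated by `s` over the
  -- interval of length `t - s`.
  · have h := Kuramoto.modesEnergy_add_le hK0 hlam (sub_nonneg.2 hst) hg hc.le hφ
      (hu.shift (r := s) hs)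
    simp only [sub_add_cancel, zero_add] at h
    simp only [hE s hs, hE t ht]
    exact le_self_add.trans h
  · have hf1 := Kuramoto.integrable_of_eq_withDensity ρin hf0 hf2.1 hf
    have hle := Kuramoto.energy_withDensity_le hf0 hf1 hf2 (φ := φ) fun l => by
      rw [← hf]
      exact (Kuramoto.continuous_fourierTransform _ l).measurable
    rw [← hf, ← h0] at hle
    have hφtop : eLpNorm φ ⊤ (volume.restrict (Ici 0)) < ⊤ := by
      refine (memLp_top_of_bound hφ.continuous.aestronglyMeasurable B
        ((ae_restrict_iff' measurableSet_Ici).2 (ae_of_all _ fun ξ hξ => ?_))).2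
      rw [Real.norm_of_nonneg (hφ.pos ξ hξ).le]
      exact hφ.le ξ hξ
    have hlt : Kuramoto.energy φ (ρ 0) < ⊤ := hle.trans_lt
      (ENNReal.mul_lt_top (ENNReal.mul_lt_top ENNReal.ofReal_lt_top hφtop)
        (ENNReal.pow_lt_top hf2.2))
    exact ⟨hle, hlt, hfin hlt⟩
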